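/- Let $n\ge 2$ be an integer, $\lambda=\frac{n-2}{2}$, let $a$ be a real number with $a+\lambda^2>0$, and let $-1\le s\le 1$. Let $P_a$ be the Friedrichs extension in $L^2(\mathbb{R}^n)$ of the nonnegative symmetric operator $-\Delta+\frac{a}{|x|^2}$ with domain $C_c^\infty(\mathbb{R}^n\setminus\{0\})$, and let $P_a^{s/2}$ be defined by the spectral calculus. If $n\ge 3$, let $X=\dot H^s(\mathbb{R}^n)$; if $n=2$, let $X=\dot H^s_{\ge 1}(\mathbb{R}^2)$, the subspace of $\dot H^s(\mathbb{R}^2)$ of elements orthogonal to all radial functions. Here $\|f\|_{\dot H^s}=\|(-\Delta)^{s/2}f\|_{L^2}$, elements of $\dot H^s$ are tempered distributions, and for $s=1$, $n=2$ the space $\dot H^1(\mathbb{R}^2)$ is understood modulo constants. Then there exist constants $C_1,C_2>0$ depending only on $n,a,s$ such that $$C_1\|f\|_{\dot H^s(\mathbb{R}^n)}\le \|P_a^{s/2}f\|_{L^2(\mathbb{R}^n)}\le C_2\|f\|_{\dot H^s(\mathbb{R}^n)}\qquad\text{for all } f\in X.$$ In particular, every $f\in X\cap L^2$ lies in the domain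 of $P_a^{s/2}$; for $f\in X$ not in $L^2$, $P_a^{s/2}f\in L^2$ is defined as the unique extension by continuity: $P_a^{s/2}f=g$ if there are $f_k\in X\cap L^2$ in the domain of $P_a^{s/2}$ with $f_k\to f$ in $\dot H^s$ and $P_a^{s/2}f_k\to g$ in $L^2$, and exactly one such $g$ exists. -/

import Mathlib

open MeasureTheory Filter Topology FourierTransform
open scoped SchwartzMap ContDiff

namespace InverseSquare

/-- Euclidean space `ℝⁿ`. -/
abbrev Rn (n : ℕ) : Type := EuclideanSpace ℝ (Fin n)

/-- The complex Hilbert space `L²(ℝⁿ)`. -/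
abbrev L2 (n : ℕ) : Type := Lp ℂ 2 (volume : Measure (Rn n))

/-! ### Nonnegative operators in a Hilbert space, given by their graphs -/

section Operators

variable {H : Type*} [NormedAddCommGroup H] [InnerProductSpace ℂ H] [CompleteSpace H]

/-- The graph of the Friedrichs extension of a densely defined nonnegative symmetric operator `S`
(given by its graph): the restriction of the adjoint `S*` to the form domain of `S`, which is the
set of limits in `H` of sequences in the domain of `S` that are Cauchy for the quadratic form
`φ ↦ ⟪S φ, φ⟫`. -/
def friedrichs (S : Set (H × H)) : Set (H × H) :=
  {p | (∀ q ∈ S, inner ℂ p.2 q.1 = inner ℂ p.1 q.2) ∧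
    ∃ w : ℕ → H × H, (∀ k, w k ∈ S) ∧
      Tendsto (fun k => (w k).1) atTop (𝓝 p.1) ∧
      Tendsto (fun km : ℕ × ℕ =>
          inner ℂ ((w km.1).2 - (w km.2).2) ((w km.1).1 - (w km.2).1))
        (atTop ×ˢ atTop) (𝓝 (0 : ℂ))}

/-- `R` is the bounded operator `(1 + A)⁻¹`, with `0 ≤ R ≤ 1`, where `A` is given by its graph. -/
def IsResolvent (A : Set (H × H)) (R : H →L[ℂ] H) : Prop :=
  0 ≤ R ∧ R ≤ 1 ∧ A = Set.range fun h : H => (R h, h - R h)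

/-- The graph of the real power `A ^ σ` of a nonnegative self-adjoint operator `A`, given by its
graph. With `R = (1 + A)⁻¹` one has `A = (1 - R) R⁻¹`. Hence for `σ ≥ 0` the spectral calculus
gives `A ^ σ` the domain `Ran (R ^ σ)` and `A ^ σ (R ^ σ h) = (1 - R) ^ σ h`; for `σ < 0` it gives
`A ^ σ` the domain `Ran ((1 - R) ^ (-σ))` and `A ^ σ ((1 - R) ^ (-σ) h) = R ^ (-σ) h`.
The powers of the bounded nonnegative operators `R` and `1 - R` are those of the continuous
functional calculus. -/
def powGraph (A : Set (H × H)) (σ : ℝ) : Set (H × H) :=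
  {p | ∃ R : H →L[ℂ] H, IsResolvent A R ∧ ∃ h : H,
    if 0 ≤ σ then p.1 = (R ^ σ) h ∧ p.2 = ((1 - R) ^ σ) h
    else p.1 = ((1 - R) ^ (-σ)) h ∧ p.2 = (R ^ (-σ)) h}

end Operators

/-! ### The operator `P_a = -Δ + a / |x|²` -/

/-- The graph of `-Δ + a / |x|²` on `C_c^∞(ℝⁿ ∖ {0})`, as an operator in `L²(ℝⁿ)`. -/
def minimalGraph (n : ℕ) (a : ℝ) : Set (L2 n × L2 n) :=
  {p | ∃ φ : Rn n → ℂ, ContDiff ℝ ∞ φ ∧ HasCompactSupport φ ∧ (0 : Rn n) ∉ tsupport φ ∧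
    p.1 =ᵐ[volume] φ ∧
    p.2 =ᵐ[volume] fun x => -(Laplacian.laplacian φ x) + ((a / ‖x‖ ^ 2 : ℝ) : ℂ) * φ x}

/-- The graph of the self-adjoint operator `P_a`. -/
def Pgraph (n : ℕ) (a : ℝ) : Set (L2 n × L2 n) := friedrichs (minimalGraph n a)

/-! ### Homogeneous Sobolev spaces -/

/-- `h` is `|2πξ|^s û(ξ)`, and lies in `L²`: the Fourier transform of `u` is `|2πξ|^(-s) h(ξ)`.
For `s < n/2` this is an identity of tempered distributions. For `s ≥ n/2`, where `|ξ|^(-s)` is not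
locally square integrable, it is tested on the functions that vanish at the origin, that is, `u`
matters modulo constants only. -/
def HasSymbol {n : ℕ} (s : ℝ) (u : 𝓢'(Rn n, ℂ)) (h : L2 n) : Prop :=
  ∀ φ : 𝓢(Rn n, ℂ), (s < n / 2 ∨ φ 0 = 0) →
    Integrable (fun ξ : Rn n => (((2 * Real.pi * ‖ξ‖) ^ (-s) : ℝ) : ℂ) * h ξ * φ ξ) ∧
    𝓕 u φ = ∫ ξ : Rn n, (((2 * Real.pi * ‖ξ‖) ^ (-s) : ℝ) : ℂ) * h ξ * φ ξ

/-- The homogeneous Sobolev space `Ḣ^s(ℝⁿ)`. -/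
def homSobolev (n : ℕ) (s : ℝ) : Set 𝓢'(Rn n, ℂ) := {u | ∃ h : L2 n, HasSymbol s u h}

/-- The norm of `Ḣ^s(ℝⁿ)`: the `L²` norm of the (unique) function `|2πξ|^s û(ξ)`. -/
noncomputable def homNorm {n : ℕ} (s : ℝ) (u : 𝓢'(Rn n, ℂ)) : ℝ :=
  sInf {r | ∃ h : L2 n, HasSymbol s u h ∧ r = ‖h‖}

/-- `u` is orthogonal to all radial functions, that is, to the spherical harmonics of degree
zero. -/
def OrthRadial {n : ℕ} (u : 𝓢'(Rn n, ℂ)) : Prop :=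
  ∀ φ : 𝓢(Rn n, ℂ), (∀ x y : Rn n, ‖x‖ = ‖y‖ → φ x = φ y) → u φ = 0

/-- The subspace of `Ḣ^s(ℝⁿ)` of elements orthogonal to all radial functions. -/
def homSobolevGeOne (n : ℕ) (s : ℝ) : Set 𝓢'(Rn n, ℂ) := {u | u ∈ homSobolev n s ∧ OrthRadial u}

/-! ### `P_a ^ (s/2)` on homogeneous Sobolev spaces -/

/-- `P_a ^ (s/2) u = g`, for `u` in a subspace `X` of `Ḣ^s(ℝⁿ)` that need not be contained in `L²`:
the operator `P_a ^ (s/2)` on its domain in `L² ∩ X` is extended by continuity, namely closed as an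
operator from `X`, with the norm of `Ḣ^s`, to `L²`. -/
def IsPow (n : ℕ) (a s : ℝ) (X : Set 𝓢'(Rn n, ℂ)) (u : 𝓢'(Rn n, ℂ)) (g : L2 n) : Prop :=
  u ∈ X ∧ ∃ f v : ℕ → L2 n,
    (∀ k, (f k, v k) ∈ powGraph (Pgraph n a) (s / 2)) ∧
    (∀ k, Lp.toTemperedDistribution (f k) ∈ X) ∧
    (∀ k, Lp.toTemperedDistribution (f k) - u ∈ X) ∧
    Tendsto (fun k => homNorm s (Lp.toTemperedDistribution (f k) - u)) atTop (𝓝 0) ∧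
    Tendsto v atTop (𝓝 g)

end InverseSquare

open scoped BoundedContinuousFunction

namespace InverseSquare

section Operators

variable {H : Type*} [NormedAddCommGroup H] [InnerProductSpace ℂ H] [CompleteSpace H]

/-! ### Functional calculus of operators between `0` and `1` -/

/-! For `s = 1` the theorem compares two quadratic forms; the other exponents follow by operator
monotonicity and duality. On test functions supported away from the origin the form of `P_a` is `∫
|∇w|² + a ∫ |w|²/|x|²`. Hardy's inequality with constant `λ²` (`hardy`) and `a + λ² > 0` show that
it dominates `∫ |∇w|²` (`exists_dirichlet_le`). The converse needs `∫ |w|²/|x|² ≤ C ∫ |∇w|²`. For `n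
≥ 3` this is Hardy again. For `n = 2` Hardy's constant vanishes, but the bound holds when all circle
means of `w` vanish, by a Poincaré inequality on circles (`hardyForm_le_of_circleInt_eq_zero`);
hence the restriction to elements orthogonal to radial functions.

To avoid form domains, both bounds are stated for the bounded operators `(A + ε)⁻¹`, `ε > 0`. Since
`⟪h, (A + ε)⁻¹ h⟫` is the supremum of `|⟪h, q⟫|²` over the form of `A + ε` at `q`, form inequalities
reverse for the inverses (`exists_greenOp_le`, `exists_greenOp_ge`). The second bound tests `P_a` on
annular cutoffs of Schwartz functions, whose Dirichlet integrals stay controlled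
(`exists_dirichlet_cut_le`), and uses Schwartz approximants that respect the orthogonality condition
(`exists_schwartz_approx`).

The Heinz inequality (`heinz`) passes to powers: `x ^ p` with `0 < p < 1` is an integral of
resolvents, so the bound for all `ε` is inherited by `(A + ε)^(-p)`, and letting `ε → 0` compares `A
^ σ` for `0 ≤ σ ≤ 1/2`. A self-adjoint `E` in its statement, the projection off the radial
functions, confines one of the comparisons to a subspace. Negative powers are treated by duality
(`exists_inverse_power`, `IsComparable.norm_ge`).

Unbounded operators enter only through `R = (1 + A)⁻¹`: the relation `A ^ σ v = g` is `(1 - R) ^ σ v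
= R ^ σ g`. For a Friedrichs extension `R = J J*`, where `J` maps the completion in the form norm to
`H` (`IsNonnegSymmetric.exists_isResolvent`); for `-Δ` it is a Fourier multiplier. Frequency cutoffs
and the two-sided bound on `L²` then give the extension by continuity (`IsComparable.main`). -/

theorem spectrum_subset_Icc {R : H →L[ℂ] H} (h0 : 0 ≤ R) (h1 : R ≤ 1) :
    spectrum ℝ R ⊆ Set.Icc 0 1 := fun x hx =>
  ⟨spectrum_nonneg_of_nonneg h0 hx,
    (CFC.le_one_iff (R := ℝ) R (IsSelfAdjoint.of_nonneg h0)).1 h1 x hx⟩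

theorem cfc_mul_apply {R : H →L[ℂ] H} (h0 : 0 ≤ R) (h1 : R ≤ 1) {f g : ℝ → ℝ}
    (hf : ContinuousOn f (Set.Icc 0 1)) (hg : ContinuousOn g (Set.Icc 0 1)) (h : H) :
    cfc f R (cfc g R h) = cfc (fun x => f x * g x) R h := by
  have hs := spectrum_subset_Icc h0 h1
  rw [cfc_mul f g R (hf.mono hs) (hg.mono hs)]
  rfl

theorem inner_cfc_left (R : H →L[ℂ] H) (f : ℝ → ℝ) (x y : H) :
    inner ℂ (cfc f R x) y = inner ℂ x (cfc f R y) := by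
  have h : IsSelfAdjoint (cfc f R) := cfc_predicate f R
  exact (ContinuousLinearMap.isSelfAdjoint_iff_isSymmetric.1 h) x y

theorem norm_cfc_sq {R : H →L[ℂ] H} (h0 : 0 ≤ R) (h1 : R ≤ 1) {f : ℝ → ℝ}
    (hf : ContinuousOn f (Set.Icc 0 1)) (h : H) :
    ‖cfc f R h‖ ^ 2 = (inner ℂ h (cfc (fun x => f x ^ 2) R h)).re := by
  have : cfc (fun x => f x ^ 2) R h = cfc f R (cfc f R h) := by
    rw [cfc_mul_apply h0 h1 hf hf]; simp only [sq]
  rw [this, ← inner_cfc_left, ← inner_self_eq_norm_sq (𝕜 := ℂ)]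
  rfl

theorem inner_cfc_mono {R : H →L[ℂ] H} (h0 : 0 ≤ R) (h1 : R ≤ 1) {f g : ℝ → ℝ}
    (hf : ContinuousOn f (Set.Icc 0 1)) (hg : ContinuousOn g (Set.Icc 0 1))
    (hfg : ∀ x ∈ Set.Icc (0 : ℝ) 1, f x ≤ g x) (h : H) :
    (inner ℂ h (cfc f R h)).re ≤ (inner ℂ h (cfc g R h)).re := by
  have hs := spectrum_subset_Icc h0 h1
  have := cfc_mono (a := R) (fun x hx => hfg x (hs hx)) (hf.mono hs) (hg.mono hs)
  rw [ContinuousLinearMap.le_def] at this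
  have h2 := this.re_inner_nonneg_right h
  simp only [sub_apply, inner_sub_right, map_sub] at h2
  exact sub_nonneg.1 h2

/-- Because `‖f(R) h‖²` is `⟪h, f²(R) h⟫`, pointwise inequalities between squares of symbols become
inequalities between norms. This replaces the spectral measure. -/
theorem norm_cfc_sq_le_add {R : H →L[ℂ] H} (h0 : 0 ≤ R) (h1 : R ≤ 1) {f g k : ℝ → ℝ}
    (hf : ContinuousOn f (Set.Icc 0 1)) (hg : ContinuousOn g (Set.Icc 0 1))
    (hk : ContinuousOn k (Set.Icc 0 1))
    (hfg : ∀ x ∈ Set.Icc (0 : ℝ) 1, f x ^ 2 ≤ g x ^ 2 + k x ^ 2) (h : H) :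
    ‖cfc f R h‖ ^ 2 ≤ ‖cfc g R h‖ ^ 2 + ‖cfc k R h‖ ^ 2 := by
  have hs := spectrum_subset_Icc h0 h1
  rw [norm_cfc_sq h0 h1 hf, norm_cfc_sq h0 h1 hg, norm_cfc_sq h0 h1 hk]
  have hg2 : ContinuousOn (fun x => g x ^ 2) (Set.Icc 0 1) := hg.pow 2
  have hk2 : ContinuousOn (fun x => k x ^ 2) (Set.Icc 0 1) := hk.pow 2
  refine (inner_cfc_mono h0 h1 (hf.pow 2) (hg2.add hk2) hfg h).trans ?_
  rw [Pi.add_def, cfc_add (R := ℝ) R _ _ (hg2.mono hs) (hk2.mono hs), add_apply, inner_add_right,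
    Complex.add_re]

theorem cfc_one_apply {R : H →L[ℂ] H} (h0 : 0 ≤ R) (h1 : R ≤ 1) {f : ℝ → ℝ}
    (hf : ∀ x ∈ Set.Icc (0 : ℝ) 1, f x = 1) (h : H) : cfc f R h = h := by
  have hs := spectrum_subset_Icc h0 h1
  rw [cfc_congr (g := fun _ => (1 : ℝ)) (fun x hx => hf x (hs hx)),
    cfc_const_one ℝ R (IsSelfAdjoint.of_nonneg h0)]
  rfl

theorem cfc_congr_Icc {R : H →L[ℂ] H} (h0 : 0 ≤ R) (h1 : R ≤ 1) {f g : ℝ → ℝ}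
    (hf : ∀ x ∈ Set.Icc (0 : ℝ) 1, f x = g x) : cfc f R = cfc g R :=
  cfc_congr fun x hx => hf x (spectrum_subset_Icc h0 h1 hx)

theorem rpow_eq_cfc {R : H →L[ℂ] H} (h0 : 0 ≤ R) (σ : ℝ) : R ^ σ = cfc (fun x : ℝ => x ^ σ) R :=
  CFC.rpow_eq_cfc_real h0

theorem one_sub_rpow_eq_cfc {R : H →L[ℂ] H} (h0 : 0 ≤ R) (h1 : R ≤ 1) {σ : ℝ} (hσ : 0 ≤ σ) :
    (1 - R) ^ σ = cfc (fun x : ℝ => (1 - x) ^ σ) R := by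
  have hsa : IsSelfAdjoint R := IsSelfAdjoint.of_nonneg h0
  have e : (1 - R) = cfc (fun x : ℝ => 1 - x) R := by
    rw [cfc_sub (R := ℝ) (fun _ => 1) (fun x => x) R, cfc_const_one ℝ R, cfc_id' ℝ R]
  rw [CFC.rpow_eq_cfc_real (sub_nonneg.2 h1), e, ← cfc_comp' (fun x : ℝ => x ^ σ) (fun x => 1 - x) R
    (Real.continuous_rpow_const hσ).continuousOn (by fun_prop) hsa]

theorem continuousOn_rpow_id {σ : ℝ} (hσ : 0 ≤ σ) :
    ContinuousOn (fun x : ℝ => x ^ σ) (Set.Icc 0 1) :=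
  (Real.continuous_rpow_const hσ).continuousOn

theorem continuousOn_one_sub_rpow {σ : ℝ} (hσ : 0 ≤ σ) :
    ContinuousOn (fun x : ℝ => (1 - x) ^ σ) (Set.Icc 0 1) :=
  ((Real.continuous_rpow_const hσ).comp (continuous_const.sub continuous_id)).continuousOn

/-- `R ^ σ` and `(1 - R) ^ σ` generate the closed relation of pairs with
`(1 - R) ^ σ v = R ^ σ g`. -/
theorem exists_rpow_eq_iff {R : H →L[ℂ] H} (h0 : 0 ≤ R) (h1 : R ≤ 1) {σ : ℝ} (hσ : 0 ≤ σ)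
    (v g : H) :
    (∃ h, v = (R ^ σ) h ∧ g = ((1 - R) ^ σ) h) ↔ ((1 - R) ^ σ) v = (R ^ σ) g := by
  rw [rpow_eq_cfc h0, one_sub_rpow_eq_cfc h0 h1 hσ]
  have c1 := continuousOn_rpow_id hσ
  have c2 := continuousOn_one_sub_rpow hσ
  -- The two symbols never vanish together, so their sum is invertible on `[0, 1]`. The generator of
  -- the pair is then `(R ^ σ + (1 - R) ^ σ)⁻¹ (v + g)`.
  have pos : ∀ x ∈ Set.Icc (0 : ℝ) 1, 0 < x ^ σ + (1 - x) ^ σ := by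
    intro x hx
    rcases hx.1.eq_or_lt with h | h
    · subst h
      simpa using add_pos_of_nonneg_of_pos (Real.rpow_nonneg le_rfl σ) one_pos
    · exact add_pos_of_pos_of_nonneg (Real.rpow_pos_of_pos h σ) (Real.rpow_nonneg (by linarith [hx.2]) σ)
  have c3 : ContinuousOn (fun x : ℝ => (x ^ σ + (1 - x) ^ σ)⁻¹) (Set.Icc 0 1) :=
    (c1.add c2).inv₀ fun x hx => (pos x hx).ne'
  constructor
  · rintro ⟨h, rfl, rfl⟩
    rw [cfc_mul_apply h0 h1 c2 c1, cfc_mul_apply h0 h1 c1 c2]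
    simp only [mul_comm]
  · intro e
    have key : ∀ w : H, cfc (fun x : ℝ => x ^ σ) R (cfc (fun x : ℝ => (x ^ σ + (1 - x) ^ σ)⁻¹) R w)
        + cfc (fun x : ℝ => (1 - x) ^ σ) R (cfc (fun x : ℝ => (x ^ σ + (1 - x) ^ σ)⁻¹) R w) = w := by
      intro w
      have c13 : ContinuousOn (fun x : ℝ => x ^ σ * (x ^ σ + (1 - x) ^ σ)⁻¹) (Set.Icc 0 1) :=
        c1.mul c3
      have c23 : ContinuousOn (fun x : ℝ => (1 - x) ^ σ * (x ^ σ + (1 - x) ^ σ)⁻¹) (Set.Icc 0 1) :=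
        c2.mul c3
      rw [cfc_mul_apply h0 h1 c1 c3, cfc_mul_apply h0 h1 c2 c3, ← add_apply,
        ← cfc_add (R := ℝ) R _ _ (c13.mono (spectrum_subset_Icc h0 h1))
          (c23.mono (spectrum_subset_Icc h0 h1))]
      refine cfc_one_apply h0 h1 (fun x hx => ?_) w
      rw [← add_mul, mul_inv_cancel₀ (pos x hx).ne']
    have comm : ∀ {f : ℝ → ℝ}, ContinuousOn f (Set.Icc 0 1) → ∀ w,
        cfc f R (cfc (fun x : ℝ => (x ^ σ + (1 - x) ^ σ)⁻¹) R w) =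
          cfc (fun x : ℝ => (x ^ σ + (1 - x) ^ σ)⁻¹) R (cfc f R w) := by
      intro f hf w
      rw [cfc_mul_apply h0 h1 hf c3, cfc_mul_apply h0 h1 c3 hf]
      simp only [mul_comm]
    refine ⟨cfc (fun x : ℝ => (x ^ σ + (1 - x) ^ σ)⁻¹) R (v + g), ?_, ?_⟩
    · conv_lhs => rw [← key v]
      rw [comm c2, e, ← comm c1, map_add, map_add]
    · conv_lhs => rw [← key g]
      rw [comm c1, ← e, ← comm c2, map_add, map_add]

/-! ### Resolvents and powers of graphs -/

/-- `powGraph` quantifies over the resolvent; uniqueness lets a fixed one be used throughout. -/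
theorem IsResolvent.eq {A : Set (H × H)} {R R' : H →L[ℂ] H} (h : IsResolvent A R)
    (h' : IsResolvent A R') : R = R' := by
  ext x
  have : (R x, x - R x) ∈ A := by rw [h.2.2]; exact ⟨x, rfl⟩
  rw [h'.2.2] at this
  obtain ⟨y, hy⟩ := this
  rw [Prod.mk.injEq] at hy
  have : y = x := by
    have := congrArg₂ (· + ·) hy.1 hy.2
    simpa using this
  rw [← hy.1, this]

theorem mem_powGraph_of_nonneg {A : Set (H × H)} {R : H →L[ℂ] H} (hR : IsResolvent A R) {σ : ℝ}
    (hσ : 0 ≤ σ) (v g : H) : (v, g) ∈ powGraph A σ ↔ ((1 - R) ^ σ) v = (R ^ σ) g := by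
  rw [← exists_rpow_eq_iff hR.1 hR.2.1 hσ]
  constructor
  · rintro ⟨R', hR', h, hh⟩
    obtain rfl := hR.eq hR'
    rw [if_pos hσ] at hh
    exact ⟨h, hh⟩
  · rintro ⟨h, hh⟩
    exact ⟨R, hR, h, by rw [if_pos hσ]; exact hh⟩

/-- A negative power is the inverse relation of the positive one, so `v` and `g` trade places. -/
theorem mem_powGraph_of_neg {A : Set (H × H)} {R : H →L[ℂ] H} (hR : IsResolvent A R) {σ : ℝ}
    (hσ : σ < 0) (v g : H) : (v, g) ∈ powGraph A σ ↔ ((1 - R) ^ (-σ)) g = (R ^ (-σ)) v := by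
  rw [← exists_rpow_eq_iff hR.1 hR.2.1 (by linarith : 0 ≤ -σ)]
  constructor
  · rintro ⟨R', hR', h, hh⟩
    obtain rfl := hR.eq hR'
    rw [if_neg (not_le.2 hσ)] at hh
    exact ⟨h, hh.2, hh.1⟩
  · rintro ⟨h, hh⟩
    exact ⟨R, hR, h, by rw [if_neg (not_le.2 hσ)]; exact hh.symm⟩

/-- The factorization `f = f ^ (1 - σ) * f ^ σ` puts the kernel of `f ^ σ (R)` inside that of
`f(R)`. -/
theorem cfc_rpow_injective {R : H →L[ℂ] H} (h0 : 0 ≤ R) (h1 : R ≤ 1) {f : ℝ → ℝ}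
    (hf : ContinuousOn f (Set.Icc 0 1)) (hpos : ∀ x ∈ Set.Icc (0 : ℝ) 1, 0 ≤ f x)
    (hinj : Function.Injective ⇑(cfc f R)) {σ : ℝ} (hσ : 0 ≤ σ) (hσ1 : σ ≤ 1) :
    Function.Injective ⇑(cfc (fun x => f x ^ σ) R) := by
  rw [injective_iff_map_eq_zero]
  intro h hh
  have e : cfc (fun x => f x ^ (1 - σ)) R (cfc (fun x => f x ^ σ) R h) = cfc f R h := by
    rw [cfc_mul_apply h0 h1 (hf.rpow_const fun _ _ => Or.inr (by linarith))
      (hf.rpow_const fun _ _ => Or.inr hσ)]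
    congr 1
    refine cfc_congr_Icc h0 h1 fun x hx => ?_
    rcases (hpos x hx).eq_or_lt with h | h
    · rw [← h]
      rcases hσ.eq_or_lt with h' | h'
      · rw [← h']; simp
      · rw [Real.zero_rpow h'.ne', mul_zero]
    · rw [← Real.rpow_add h]; simp
  rw [hh, map_zero] at e
  exact (injective_iff_map_eq_zero _).1 hinj h e.symm

theorem rpow_injective {R : H →L[ℂ] H} (h0 : 0 ≤ R) (h1 : R ≤ 1)
    (hinj : Function.Injective R) {σ : ℝ} (hσ : 0 ≤ σ) (hσ1 : σ ≤ 1) :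
    Function.Injective ⇑(R ^ σ) := by
  rw [rpow_eq_cfc h0]
  refine cfc_rpow_injective (f := fun x => x) h0 h1 continuousOn_id (fun x hx => hx.1) ?_ hσ hσ1
  rwa [cfc_id' ℝ R (IsSelfAdjoint.of_nonneg h0)]

theorem one_sub_rpow_injective {R : H →L[ℂ] H} (h0 : 0 ≤ R) (h1 : R ≤ 1)
    (hinj : ∀ h, R h = h → h = 0) {σ : ℝ} (hσ : 0 ≤ σ) (hσ1 : σ ≤ 1) :
    Function.Injective ⇑((1 - R) ^ σ) := by
  refine rpow_injective (sub_nonneg.2 h1) (by simpa using h0) ?_ hσ hσ1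
  rw [injective_iff_map_eq_zero]
  intro h hh
  exact hinj h (sub_eq_zero.1 hh).symm

/-! ### Ranges of self-adjoint operators -/

/-- The functional `T x ↦ ⟪f, x⟫` is bounded by `c` on the range of `T`. Extended by Hahn–Banach and
represented by a vector `w`, it yields `⟪w, T x⟫ = ⟪f, x⟫`, and `T` moves to the other side. -/
theorem exists_preimage_of_inner_le {T : H →L[ℂ] H} (hT : ∀ x y, inner ℂ (T x) y = inner ℂ x (T y))
    (hinj : Function.Injective T) {c : ℝ} (hc : 0 ≤ c) {f : H}
    (hf : ∀ x, ‖inner ℂ f x‖ ≤ c * ‖T x‖) : ∃ w, T w = f ∧ ‖w‖ ≤ c := by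
  let e := LinearEquiv.ofInjective (T : H →ₗ[ℂ] H) hinj
  let ℓ₀ : (T : H →ₗ[ℂ] H).range →ₗ[ℂ] ℂ := (innerSL ℂ f : H →ₗ[ℂ] ℂ) ∘ₗ e.symm.toLinearMap
  have hℓ₀ : ∀ y, ‖ℓ₀ y‖ ≤ c * ‖y‖ := by
    intro y
    obtain ⟨x, rfl⟩ := e.surjective y
    simpa [ℓ₀, e] using hf x
  obtain ⟨ℓ, h1, h2⟩ := exists_extension_norm_eq _ (ℓ₀.mkContinuous c hℓ₀)
  refine ⟨(InnerProductSpace.toDual ℂ H).symm ℓ, ?_, ?_⟩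
  · refine ext_inner_right ℂ fun x => ?_
    rw [hT, InnerProductSpace.toDual_symm_apply]
    have := h1 (e x)
    rw [LinearMap.mkContinuous_apply] at this
    have h3 : ℓ₀ (e x) = inner ℂ f x := by simp [ℓ₀]
    rw [h3] at this
    exact this
  · rw [LinearIsometryEquiv.norm_map, h2]
    exact LinearMap.mkContinuous_norm_le _ hc _

end Operators

section Operators

variable {H : Type*} [NormedAddCommGroup H] [InnerProductSpace ℂ H] [CompleteSpace H]

/-! ### The operators `(A + ε)⁻¹` -/

/-- If `x = (1 + A)⁻¹`, then `green ε x = (A + ε)⁻¹`. -/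
noncomputable def green (ε x : ℝ) : ℝ := x / (1 - x + ε * x)

theorem green_denom_pos {ε : ℝ} (hε : 0 < ε) {x : ℝ} (hx : x ∈ Set.Icc (0 : ℝ) 1) :
    0 < 1 - x + ε * x := by
  rcases hx.2.eq_or_lt with h | h
  · rw [h]; linarith
  · nlinarith [mul_nonneg hε.le hx.1]

theorem green_nonneg {ε : ℝ} (hε : 0 < ε) {x : ℝ} (hx : x ∈ Set.Icc (0 : ℝ) 1) :
    0 ≤ green ε x := div_nonneg hx.1 (green_denom_pos hε hx).le

theorem continuousOn_green {ε : ℝ} (hε : 0 < ε) : ContinuousOn (green ε) (Set.Icc 0 1) :=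
  ContinuousOn.div continuousOn_id (by fun_prop) fun _ hx => (green_denom_pos hε hx).ne'

theorem cfc_green_nonneg {R : H →L[ℂ] H} (h0 : 0 ≤ R) (h1 : R ≤ 1) {ε : ℝ} (hε : 0 < ε) :
    0 ≤ cfc (green ε) R :=
  cfc_nonneg fun _ hx => green_nonneg hε (spectrum_subset_Icc h0 h1 hx)

/-- The integrand is `t ^ p (1/t - 1/(t + x))`. At `x = 1/(A + ε)` it equals `t ^ (p - 2) / (A + ε +
1/t)`: the representation of the power only shifts `ε`. -/
theorem cfcₙ_rpowIntegrand_green {R : H →L[ℂ] H} (h0 : 0 ≤ R) (h1 : R ≤ 1) {ε : ℝ} (hε : 0 < ε)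
    {p t : ℝ} (hp : p ∈ Set.Ioo (0 : ℝ) 1) (ht : 0 < t) :
    cfcₙ (Real.rpowIntegrand₀₁ p t) (cfc (green ε) R) =
      (t ^ p * t⁻¹ * t⁻¹) • cfc (green (ε + t⁻¹)) R := by
  have hs := spectrum_subset_Icc h0 h1
  have hε' : 0 < ε + t⁻¹ := by positivity
  have hg := cfc_green_nonneg h0 h1 hε
  have hq : quasispectrum ℝ (cfc (green ε) R) ⊆ Set.Ici 0 := by
    intro x hx
    exact quasispectrum_nonneg_of_nonneg _ hg x hx
  have hc : ContinuousOn (Real.rpowIntegrand₀₁ p t) (Set.Ici 0) :=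
    Real.continuousOn_rpowIntegrand₀₁_Ici hp ht
  have hsub : green ε '' spectrum ℝ R ⊆ Set.Ici 0 := by
    rintro _ ⟨x, hx, rfl⟩
    exact green_nonneg hε (hs hx)
  rw [cfcₙ_eq_cfc (hc.mono hq) (by simp),
    ← cfc_comp (Real.rpowIntegrand₀₁ p t) (green ε) R (IsSelfAdjoint.of_nonneg h0)
      (hc.mono hsub) ((continuousOn_green hε).mono hs),
    ← cfc_smul (R := ℝ) _ _ R ((continuousOn_green hε').mono hs)]
  refine cfc_congr_Icc h0 h1 fun x hx => ?_
  have hd := green_denom_pos hε hx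
  have hd' := green_denom_pos hε' hx
  have hgn := green_nonneg hε hx
  simp only [Function.comp, Real.rpowIntegrand₀₁, smul_eq_mul, green] at *
  rw [show 1 - x + (ε + t⁻¹) * x = 1 - x + ε * x + t⁻¹ * x by ring] at hd' ⊢
  generalize 1 - x + ε * x = d at *
  have e : t + x / d = t * (d + t⁻¹ * x) / d := by
    field_simp
  have hd2 : 0 < d * t + x := by
    have : d * t + x = t * (d + t⁻¹ * x) := by field_simp
    rw [this]
    positivity
  rw [e, inv_div, mul_assoc, mul_assoc]
  congr 1
  have hd3 : d + t⁻¹ * x = (d * t + x) / t := by field_simp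
  rw [hd3]
  obtain ⟨y, rfl⟩ : ∃ y, x = y - d * t := ⟨x + d * t, by ring⟩
  rw [add_sub_cancel] at hd2 ⊢
  field_simp

/-- For `p < 1` both sides are integrals, against the same measure in `t`, of nonnegative multiples
of the hypothesis at `ε + 1/t`. -/
theorem inner_green_rpow_le {RA RB : H →L[ℂ] H} (hA0 : 0 ≤ RA) (hA1 : RA ≤ 1) (hB0 : 0 ≤ RB)
    (hB1 : RB ≤ 1) {E : H →L[ℂ] H} {C : ℝ}
    (hG : ∀ ε > 0, ∀ h, (inner ℂ (E h) (cfc (green ε) RB (E h))).re ≤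
      C * (inner ℂ h (cfc (green ε) RA h)).re) {p : ℝ} (hp : 0 < p) (hp1 : p ≤ 1)
    {ε : ℝ} (hε : 0 < ε) (h : H) :
    (inner ℂ (E h) (cfc (fun x => green ε x ^ p) RB (E h))).re ≤
      C * (inner ℂ h (cfc (fun x => green ε x ^ p) RA h)).re := by
  rcases hp1.eq_or_lt with rfl | hp1
  · simpa using hG ε hε h
  let q : NNReal := ⟨p, hp.le⟩
  have conv : ∀ {R : H →L[ℂ] H}, 0 ≤ R → R ≤ 1 →
      cfc (fun x => green ε x ^ p) R = cfc (green ε) R ^ q := by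
    intro R h0 h1
    rw [CFC.nnrpow_eq_cfcₙ_real _ _ (cfc_green_nonneg h0 h1 hε)]
    change _ = cfcₙ (fun x : ℝ => x ^ p) _
    rw [cfcₙ_eq_cfc (Real.continuous_rpow_const hp.le).continuousOn (Real.zero_rpow hp.ne'),
      ← cfc_comp' (fun x : ℝ => x ^ p) (green ε) R (Real.continuous_rpow_const hp.le).continuousOn
        ((continuousOn_green hε).mono (spectrum_subset_Icc h0 h1)) (IsSelfAdjoint.of_nonneg h0)]
  obtain ⟨μ, hμ⟩ := CFC.exists_measure_nnrpow_eq_integral_cfcₙ_rpowIntegrand₀₁ (H →L[ℂ] H)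
    (p := q) ⟨hp, hp1⟩
  let ℓ : H → (H →L[ℂ] H) →L[ℝ] ℝ := fun k =>
    Complex.reCLM ∘L ((innerSL ℂ k).restrictScalars ℝ) ∘L
      ((ContinuousLinearMap.apply ℂ H k).restrictScalars ℝ)
  have hℓ : ∀ k T, ℓ k T = (inner ℂ k (T k)).re := fun k T => rfl
  obtain ⟨iA, eA⟩ := hμ _ (cfc_green_nonneg hA0 hA1 hε)
  obtain ⟨iB, eB⟩ := hμ _ (cfc_green_nonneg hB0 hB1 hε)
  rw [conv hA0 hA1, conv hB0 hB1, ← hℓ, ← hℓ, eA, eB, ← (ℓ _).integral_comp_comm iA,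
    ← (ℓ _).integral_comp_comm iB, ← integral_const_mul]
  refine setIntegral_mono_on ((ℓ _).integrable_comp iB) (((ℓ _).integrable_comp iA).const_mul C)
    measurableSet_Ioi fun t ht => ?_
  have ht : 0 < t := ht
  change ℓ (E h) (cfcₙ (Real.rpowIntegrand₀₁ p t) _) ≤ C * ℓ h (cfcₙ (Real.rpowIntegrand₀₁ p t) _)
  rw [cfcₙ_rpowIntegrand_green hA0 hA1 hε ⟨hp, hp1⟩ ht,
    cfcₙ_rpowIntegrand_green hB0 hB1 hε ⟨hp, hp1⟩ ht, map_smul, map_smul, smul_eq_mul, smul_eq_mul,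
    mul_left_comm]
  exact mul_le_mul_of_nonneg_left (hG _ (by positivity) h) (by positivity)

/-- The Heinz inequality on the range of an operator `E`: the quadratic form
inequality `A ≤ C B` on the range of `E`, stated for the inverses `(A + ε)⁻¹` and `(B + ε)⁻¹`,
is inherited by the powers of exponent at most one. -/
theorem heinz {RA RB : H →L[ℂ] H} (hA0 : 0 ≤ RA) (hA1 : RA ≤ 1) (hB0 : 0 ≤ RB)
    (hB1 : RB ≤ 1) (hinj : Function.Injective RA) {E : H →L[ℂ] H}
    (hE : ∀ x y, inner ℂ (E x) y = inner ℂ x (E y)) {C : ℝ} (hC : 1 ≤ C)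
    (hG : ∀ ε > 0, ∀ h, (inner ℂ (E h) (cfc (green ε) RB (E h))).re ≤
      C * (inner ℂ h (cfc (green ε) RA h)).re) {σ : ℝ} (hσ : 0 ≤ σ) (hσ1 : σ ≤ 1 / 2)
    {f g : H} (hfg : ((1 - RB) ^ σ) f = (RB ^ σ) g) (hf : E f = f) :
    ∃ g', ((1 - RA) ^ σ) f = (RA ^ σ) g' ∧ ‖g'‖ ≤ C * ‖g‖ := by
  -- The exponent zero is separate: `ε ^ σ` must tend to zero below, and the integral representation
  -- needs `2σ > 0`.
  rcases hσ.eq_or_lt with rfl | hσ0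
  · rw [CFC.rpow_zero _ (sub_nonneg.2 hB1), CFC.rpow_zero _ hB0] at hfg
    refine ⟨f, ?_, ?_⟩
    · rw [CFC.rpow_zero _ (sub_nonneg.2 hA1), CFC.rpow_zero _ hA0]
    · have : f = g := hfg
      rw [this]
      exact le_mul_of_one_le_left (norm_nonneg g) hC
  have hinjσ : Function.Injective ⇑(RA ^ σ) := rpow_injective hA0 hA1 hinj hσ (by linarith)
  obtain ⟨k, hk, hk'⟩ := (exists_rpow_eq_iff hB0 hB1 hσ f g).2 hfg
  have crp : ∀ {ε τ : ℝ}, 0 < ε → ContinuousOn (fun x : ℝ => (1 - x + ε * x) ^ τ) (Set.Icc 0 1) := by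
    intro ε τ hε
    exact ContinuousOn.rpow_const (by fun_prop) fun x hx => Or.inl (green_denom_pos hε hx).ne'
  have cgr : ∀ {ε : ℝ}, 0 < ε → ContinuousOn (fun x : ℝ => green ε x ^ σ) (Set.Icc 0 1) :=
    fun hε => (continuousOn_green hε).rpow_const fun _ _ => Or.inr hσ
  -- the bound for fixed `ε`
  have main : ∀ ε > 0, ∃ k', f = (RA ^ σ) k' ∧
      ‖((1 - RA) ^ σ) k'‖ ≤ C * (‖g‖ + ε ^ σ * ‖f‖) := by
    intro ε hε
    -- The power `p = 2σ` of the form inequality is an inequality between squared norms. Its natural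
    -- constant is `√C`, enlarged to `C` because `C ≥ 1`.
    have hT : ∀ h, ‖cfc (fun x => green ε x ^ σ) RB (E h)‖ ≤
        C * ‖cfc (fun x => green ε x ^ σ) RA h‖ := by
      intro h
      have e := inner_green_rpow_le hA0 hA1 hB0 hB1 hG (p := 2 * σ) (by linarith) (by linarith)
        hε h
      have e2 : ∀ {R : H →L[ℂ] H}, 0 ≤ R → R ≤ 1 → cfc (fun x => green ε x ^ (2 * σ)) R =
          cfc (fun x => (green ε x ^ σ) ^ 2) R := by
        intro R h0 h1
        refine cfc_congr_Icc h0 h1 fun x hx => ?_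
        rw [← Real.rpow_natCast, ← Real.rpow_mul (green_nonneg hε hx)]
        congr 1
        push_cast
        ring
      rw [e2 hA0 hA1, e2 hB0 hB1, ← norm_cfc_sq hA0 hA1 (cgr hε),
        ← norm_cfc_sq hB0 hB1 (cgr hε)] at e
      refine le_of_sq_le_sq ?_ (by positivity)
      rw [mul_pow]
      refine e.trans (mul_le_mul_of_nonneg_right ?_ (sq_nonneg _))
      nlinarith
    -- The vector on the left is `(B + ε) ^ σ f`. Since `2σ ≤ 1`, the function `t ↦ t ^ (2σ)` is
    -- subadditive, which separates `B` from `ε`.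
    have hτ : ‖cfc (fun x => (1 - x + ε * x) ^ σ) RB k‖ ≤ ‖g‖ + ε ^ σ * ‖f‖ := by
      have h2 : ‖cfc (fun x => (1 - x + ε * x) ^ σ) RB k‖ ^ 2 ≤ ‖g‖ ^ 2 + (ε ^ σ * ‖f‖) ^ 2 := by
        have := norm_cfc_sq_le_add hB0 hB1 (crp (τ := σ) hε) (continuousOn_one_sub_rpow hσ)
          (k := fun x => ε ^ σ • x ^ σ) ((continuousOn_rpow_id hσ).const_smul (ε ^ σ))
          (fun x hx => ?_) k
        · have e3 : cfc (fun x : ℝ => ε ^ σ • x ^ σ) RB k = ((ε ^ σ : ℝ) : ℂ) • f := by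
            rw [cfc_smul (R := ℝ) (ε ^ σ) (fun x : ℝ => x ^ σ) RB
              ((continuousOn_rpow_id hσ).mono (spectrum_subset_Icc hB0 hB1)), hk, rpow_eq_cfc hB0]
            rfl
          rw [e3, norm_smul, ← one_sub_rpow_eq_cfc hB0 hB1 hσ, ← hk', Complex.norm_real,
            Real.norm_of_nonneg (by positivity)] at this
          exact this
        · have hx1 : 0 ≤ 1 - x := by linarith [hx.2]
          have hx0 := hx.1
          rw [smul_eq_mul, ← Real.mul_rpow hε.le hx0, ← Real.rpow_natCast,
            ← Real.rpow_natCast, ← Real.rpow_natCast, ← Real.rpow_mul (green_denom_pos hε hx).le,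
            ← Real.rpow_mul hx1, ← Real.rpow_mul (by positivity)]
          exact Real.rpow_add_le_add_rpow hx1 (by positivity) (by push_cast; linarith)
            (by push_cast; linarith)
      refine le_of_sq_le_sq (h2.trans ?_) (by positivity)
      nlinarith [norm_nonneg g, mul_nonneg (norm_nonneg g)
        (mul_nonneg (Real.rpow_nonneg hε.le σ) (norm_nonneg f))]
    have hfac : ∀ {R : H →L[ℂ] H}, 0 ≤ R → R ≤ 1 → ∀ h,
        cfc (fun x => green ε x ^ σ) R (cfc (fun x => (1 - x + ε * x) ^ σ) R h) = (R ^ σ) h := by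
      intro R h0 h1 h
      rw [cfc_mul_apply h0 h1 (cgr hε) (crp hε), rpow_eq_cfc h0]
      congr 1
      refine cfc_congr_Icc h0 h1 fun x hx => ?_
      have := green_denom_pos hε hx
      rw [green, Real.div_rpow hx.1 this.le, div_mul_cancel₀ _ (Real.rpow_pos_of_pos this σ).ne']
    have hτinv : ∀ {a : ℝ} h, cfc (fun x => (1 - x + ε * x) ^ a) RA
        (cfc (fun x => (1 - x + ε * x) ^ (-a)) RA h) = h := by
      intro a h
      rw [cfc_mul_apply hA0 hA1 (crp hε) (crp hε)]
      refine cfc_one_apply hA0 hA1 (fun x hx => ?_) h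
      rw [← Real.rpow_add (green_denom_pos hε hx), add_neg_cancel, Real.rpow_zero]
    have hTinj : Function.Injective ⇑(cfc (fun x => green ε x ^ σ) RA) := by
      rw [injective_iff_map_eq_zero]
      intro h hh
      have e := hfac hA0 hA1 (cfc (fun x => (1 - x + ε * x) ^ (-σ)) RA h)
      rw [hτinv, hh] at e
      have e4 := (injective_iff_map_eq_zero _).1 hinjσ _ e.symm
      have := hτinv (a := σ) h
      rw [e4, map_zero] at this
      exact this.symm
    -- Here `⟪f, h⟫ = ⟪(B + ε) ^ σ f, (B + ε) ^ (-σ) E h⟫`, which uses `E f = f` and the symmetry of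
    -- `E`.
    have hbound : ∀ h, ‖inner ℂ f h‖ ≤
        (C * (‖g‖ + ε ^ σ * ‖f‖)) * ‖cfc (fun x => green ε x ^ σ) RA h‖ := by
      intro h
      have e : inner ℂ f h = inner ℂ (cfc (fun x => (1 - x + ε * x) ^ σ) RB k)
          (cfc (fun x => green ε x ^ σ) RB (E h)) := by
        rw [← inner_cfc_left, hfac hB0 hB1, ← hk, ← hE, hf]
      rw [e]
      calc _ ≤ ‖cfc (fun x => (1 - x + ε * x) ^ σ) RB k‖ *
            ‖cfc (fun x => green ε x ^ σ) RB (E h)‖ := norm_inner_le_norm _ _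
        _ ≤ (‖g‖ + ε ^ σ * ‖f‖) * (C * ‖cfc (fun x => green ε x ^ σ) RA h‖) :=
            mul_le_mul hτ (hT h) (norm_nonneg _) (by positivity)
        _ = _ := by ring
    obtain ⟨w, hw, hwn⟩ := exists_preimage_of_inner_le (inner_cfc_left RA _) hTinj
      (by positivity) hbound
    -- With `f = (A + ε) ^ (-σ) w`, the candidate for `A ^ σ f` is `(A / (A + ε)) ^ σ w`, which is
    -- no longer than `w`.
    refine ⟨cfc (fun x => (1 - x + ε * x) ^ (-σ)) RA w, ?_, ?_⟩
    · rw [← hfac hA0 hA1, hτinv, hw]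
    · refine le_trans ?_ hwn
      rw [one_sub_rpow_eq_cfc hA0 hA1 hσ]
      refine le_of_sq_le_sq ?_ (norm_nonneg _)
      rw [cfc_mul_apply hA0 hA1 (continuousOn_one_sub_rpow hσ) (crp hε)]
      have := norm_cfc_sq_le_add hA0 hA1 (f := fun x => (1 - x) ^ σ * (1 - x + ε * x) ^ (-σ))
        (g := fun _ => 1) (k := fun _ => 0) ((continuousOn_one_sub_rpow hσ).mul (crp hε))
        continuousOn_const continuousOn_const (fun x hx => ?_) w
      · rw [cfc_one_apply hA0 hA1 (fun _ _ => rfl), cfc_const_zero] at this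
        simpa using this
      · have hx1 : 0 ≤ 1 - x := by linarith [hx.2]
        have hd := green_denom_pos hε hx
        rw [Real.rpow_neg hd.le, ← div_eq_mul_inv, ← Real.div_rpow hx1 hd.le]
        have h1 : (1 - x) / (1 - x + ε * x) ≤ 1 := by
          rw [div_le_one hd]
          nlinarith [hx.1]
        have h2 : ((1 - x) / (1 - x + ε * x)) ^ σ ≤ 1 :=
          Real.rpow_le_one (by positivity) h1 hσ
        have h3 : 0 ≤ ((1 - x) / (1 - x + ε * x)) ^ σ := by positivity
        nlinarith
  -- Injectivity of `RA ^ σ` makes the generator `k'` independent of `ε`, so the bound can be passed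
  -- to the limit `ε → 0`.
  obtain ⟨k', hfk', -⟩ := main 1 one_pos
  refine ⟨((1 - RA) ^ σ) k', (exists_rpow_eq_iff hA0 hA1 hσ _ _).1 ⟨k', hfk', rfl⟩, ?_⟩
  have lim : Tendsto (fun ε : ℝ => C * (‖g‖ + ε ^ σ * ‖f‖)) (𝓝[>] 0) (𝓝 (C * (‖g‖ + 0 * ‖f‖))) := by
    have : Tendsto (fun ε : ℝ => ε ^ σ) (𝓝[>] 0) (𝓝 0) := by
      have := (Real.continuous_rpow_const hσ).tendsto 0
      rw [Real.zero_rpow hσ0.ne'] at this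
      exact this.mono_left nhdsWithin_le_nhds
    exact (tendsto_const_nhds.add (this.mul_const _)).const_mul C
  rw [zero_mul, add_zero] at lim
  refine ge_of_tendsto lim ?_
  filter_upwards [self_mem_nhdsWithin] with ε hε
  obtain ⟨k'', hk'', hle⟩ := main ε hε
  rw [hinjσ (hfk'.symm.trans hk'')]
  exact hle

/-- Duality: a bound of the powers of `B` by those of `A` gives a bound of the negative powers of
`A` by those of `B`. -/
theorem exists_inverse_power {RA RB : H →L[ℂ] H} (hA0 : 0 ≤ RA) (hA1 : RA ≤ 1) (hB0 : 0 ≤ RB)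
    (hB1 : RB ≤ 1) {σ : ℝ} (hσ : 0 ≤ σ) (hinj : Function.Injective ⇑((1 - RA) ^ σ)) {C : ℝ} (hC : 0 ≤ C)
    (hAB : ∀ v g, ((1 - RA) ^ σ) v = (RA ^ σ) g →
      ∃ g', ((1 - RB) ^ σ) v = (RB ^ σ) g' ∧ ‖g'‖ ≤ C * ‖g‖)
    {f h : H} (hfh : ((1 - RB) ^ σ) h = (RB ^ σ) f) :
    ∃ v, ((1 - RA) ^ σ) v = (RA ^ σ) f ∧ ‖v‖ ≤ C * ‖h‖ := by
  have sa1 : ∀ {R : H →L[ℂ] H}, 0 ≤ R → ∀ x y, inner ℂ ((R ^ σ) x) y = inner ℂ x ((R ^ σ) y) := by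
    intro R h0 x y
    rw [rpow_eq_cfc h0, inner_cfc_left]
  obtain ⟨k, rfl, rfl⟩ := (exists_rpow_eq_iff hB0 hB1 hσ h f).2 hfh
  -- Solvability is tested on `x`: the vector `RA ^ σ x` lies in the domain of `A ^ σ`, hence of `B
  -- ^ σ`. Pairing it with `f = B ^ σ h` moves `B ^ σ` off `h`.
  obtain ⟨v, hv, hvn⟩ := exists_preimage_of_inner_le (T := (1 - RA) ^ σ)
    (f := (RA ^ σ) (((1 - RB) ^ σ) k)) (c := C * ‖(RB ^ σ) k‖)
    (sa1 (sub_nonneg.2 hA1)) hinj (by positivity) (fun x => by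
      obtain ⟨g', hg', hgn⟩ := hAB ((RA ^ σ) x) (((1 - RA) ^ σ) x)
        ((exists_rpow_eq_iff hA0 hA1 hσ _ _).1 ⟨x, rfl, rfl⟩)
      obtain ⟨y, hy, rfl⟩ := (exists_rpow_eq_iff hB0 hB1 hσ _ _).2 hg'
      rw [sa1 hA0, hy, sa1 (sub_nonneg.2 hB1)]
      have e : ((1 - RB) ^ σ) ((RB ^ σ) y) = (RB ^ σ) (((1 - RB) ^ σ) y) :=
        (exists_rpow_eq_iff hB0 hB1 hσ _ _).1 ⟨y, rfl, rfl⟩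
      rw [e, ← sa1 hB0]
      calc _ ≤ _ := norm_inner_le_norm _ _
        _ ≤ ‖(RB ^ σ) k‖ * (C * ‖((1 - RA) ^ σ) x‖) := by gcongr
        _ = _ := by ring)
  exact ⟨v, hv, hvn⟩

end Operators

section Operators

variable {H : Type*} [NormedAddCommGroup H] [InnerProductSpace ℂ H]

/-! ### The Friedrichs extension -/

/-- A submodule of `H × H` is the graph of a nonnegative symmetric operator. -/
structure IsNonnegSymmetric (S : Submodule ℂ (H × H)) : Prop where
  symm : ∀ p ∈ S, ∀ q ∈ S, inner ℂ p.2 q.1 = inner ℂ p.1 q.2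
  nonneg : ∀ p ∈ S, 0 ≤ (inner ℂ p.2 p.1).re

/-- The domain of a nonnegative symmetric operator, to be equipped with its form norm. -/
def FormSpace (S : Submodule ℂ (H × H)) : Type _ := S

variable (S : Submodule ℂ (H × H))

instance : AddCommGroup (FormSpace S) := inferInstanceAs (AddCommGroup S)

instance : Module ℂ (FormSpace S) := inferInstanceAs (Module ℂ S)

/-- The inclusion of the form space into pairs. -/
def FormSpace.val : FormSpace S →ₗ[ℂ] H × H := S.subtype

variable {S}

theorem FormSpace.val_mem (x : FormSpace S) : FormSpace.val S x ∈ S := Subtype.property (p := (· ∈ S)) x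

/-- The inner product `⟪(S + ε) x, y⟫`. -/
@[reducible]
noncomputable def formCore (hS : IsNonnegSymmetric S) {ε : ℝ} (hε : 0 ≤ ε) :
    PreInnerProductSpace.Core ℂ (FormSpace S) where
  inner x y := inner ℂ (FormSpace.val S x).2 (FormSpace.val S y).1 +
    ε * inner ℂ (FormSpace.val S x).1 (FormSpace.val S y).1
  conj_inner_symm x y := by
    rw [map_add, map_mul, Complex.conj_ofReal, inner_conj_symm, inner_conj_symm,
      hS.symm _ x.val_mem _ y.val_mem]
  re_inner_nonneg x := by
    rw [map_add]
    refine add_nonneg (hS.nonneg _ x.val_mem) ?_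
    change 0 ≤ (_ : ℂ).re
    rw [Complex.re_ofReal_mul]
    exact mul_nonneg hε (inner_self_nonneg (𝕜 := ℂ))
  add_left x y z := by
    simp only [map_add, Prod.fst_add, Prod.snd_add, inner_add_left]
    ring
  smul_left x y r := by
    simp only [map_smul, Prod.smul_fst, Prod.smul_snd, inner_smul_left]
    ring

/-- Cauchy–Schwarz for the semi-inner product `⟪(S + ε) x, y⟫`. -/
theorem IsNonnegSymmetric.norm_inner_add_sq_le (hS : IsNonnegSymmetric S) {ε : ℝ} (hε : 0 ≤ ε)
    {p q : H × H} (hp : p ∈ S) (hq : q ∈ S) :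
    ‖inner ℂ p.2 q.1 + ε * inner ℂ p.1 q.1‖ ^ 2 ≤
      ((inner ℂ p.2 p.1).re + ε * ‖p.1‖ ^ 2) * ((inner ℂ q.2 q.1).re + ε * ‖q.1‖ ^ 2) := by
  let core := formCore hS hε
  let _ : SeminormedAddCommGroup (FormSpace S) :=
    InnerProductSpace.Core.toSeminormedAddCommGroup (𝕜 := ℂ)
  let _ : InnerProductSpace ℂ (FormSpace S) := InnerProductSpace.ofCore core
  have norm_def : ∀ x : FormSpace S, ‖x‖ ^ 2 = (inner ℂ (FormSpace.val S x).2
      (FormSpace.val S x).1).re + ε * ‖(FormSpace.val S x).1‖ ^ 2 := by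
    intro x
    rw [← inner_self_eq_norm_sq (𝕜 := ℂ), ← inner_self_eq_norm_sq (𝕜 := ℂ) (FormSpace.val S x).1]
    change (_ + _ : ℂ).re = _
    rw [Complex.add_re, Complex.re_ofReal_mul]
    rfl
  let x : FormSpace S := ⟨p, hp⟩
  let y : FormSpace S := ⟨q, hq⟩
  have h := norm_inner_le_norm (𝕜 := ℂ) x y
  have h2 := pow_le_pow_left₀ (norm_nonneg _) h 2
  rw [mul_pow, norm_def, norm_def] at h2
  exact h2

variable [CompleteSpace H]

/-- The Friedrichs extension of a nonnegative symmetric operator is self-adjoint and nonnegative: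
it has a bounded resolvent `(1 + A)⁻¹`. Moreover, its form is the closure of the form of the given
operator. -/
theorem IsNonnegSymmetric.exists_isResolvent (hS : IsNonnegSymmetric S) :
    (∃ R, IsResolvent (friedrichs (S : Set (H × H))) R) ∧
    ∀ p ∈ friedrichs (S : Set (H × H)), ∃ w : ℕ → H × H, (∀ k, w k ∈ S) ∧
      Tendsto (fun k => (w k).1) atTop (𝓝 p.1) ∧
      Tendsto (fun k => (inner ℂ (w k).2 (w k).1).re) atTop (𝓝 (inner ℂ p.2 p.1).re) := by
  let core := formCore hS zero_le_one
  let _ : SeminormedAddCommGroup (FormSpace S) :=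
    InnerProductSpace.Core.toSeminormedAddCommGroup (𝕜 := ℂ)
  let _ : InnerProductSpace ℂ (FormSpace S) := InnerProductSpace.ofCore core
  have inner_def : ∀ x y : FormSpace S, inner ℂ x y = inner ℂ (FormSpace.val S x).2
      (FormSpace.val S y).1 + inner ℂ (FormSpace.val S x).1 (FormSpace.val S y).1 := by
    intro x y
    change _ + ((1 : ℝ) : ℂ) * _ = _
    simp
  have norm_def : ∀ x : FormSpace S, ‖x‖ ^ 2 = (inner ℂ (FormSpace.val S x).2
      (FormSpace.val S x).1).re + ‖(FormSpace.val S x).1‖ ^ 2 := by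
    intro x
    rw [← inner_self_eq_norm_sq (𝕜 := ℂ), inner_def, map_add, inner_self_eq_norm_sq]
    rfl
  have hjn : ∀ x, ‖(LinearMap.fst ℂ H H ∘ₗ FormSpace.val S) x‖ ≤ 1 * ‖x‖ := by
    intro x
    rw [one_mul]
    refine le_of_sq_le_sq ?_ (norm_nonneg x)
    rw [norm_def]
    exact le_add_of_nonneg_left (hS.nonneg _ x.val_mem)
  let j : FormSpace S →L[ℂ] H := LinearMap.mkContinuous _ 1 hjn
  have hj : ∀ x, j x = (FormSpace.val S x).1 := fun _ => rfl
  let J : UniformSpace.Completion (FormSpace S) →L[ℂ] H := j.fromCompletion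
  have hJ : ∀ x : FormSpace S, J x = (FormSpace.val S x).1 := fun x => by
    rw [← hj]
    exact j.fromCompletion_apply_coe x
  have hJ1 : ‖J‖ ≤ 1 := by
    refine J.opNorm_le_bound zero_le_one fun v => ?_
    induction v using UniformSpace.Completion.induction_on with
    | hp => exact isClosed_le (by fun_prop) (by fun_prop)
    | ih x =>
      rw [UniformSpace.Completion.norm_coe, hJ]
      exact hjn x
  -- elements of the form space are limits of elements of the domain
  have hseq : ∀ v : UniformSpace.Completion (FormSpace S), ∃ x : ℕ → FormSpace S,
      Tendsto (fun k => (x k : UniformSpace.Completion (FormSpace S))) atTop (𝓝 v) := by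
    intro v
    have := UniformSpace.Completion.denseRange_coe (α := FormSpace S) v
    obtain ⟨y, hy, hlim⟩ := mem_closure_iff_seq_limit.1 this
    choose x hx using hy
    exact ⟨x, by simpa only [hx] using hlim⟩
  -- The symmetry `⟪S y, x⟫ = ⟪y, S x⟫` extends in `y` to the completion, because its right side
  -- involves `y` only through `J`.
  have hpair : ∀ (v : UniformSpace.Completion (FormSpace S)) (x : FormSpace S),
      inner ℂ v (x : UniformSpace.Completion (FormSpace S)) =
        inner ℂ (J v) (FormSpace.val S x).2 + inner ℂ (J v) (FormSpace.val S x).1 := by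
    intro v x
    obtain ⟨y, hy⟩ := hseq v
    refine tendsto_nhds_unique (hy.inner tendsto_const_nhds) ?_
    have hJy := (J.continuous.tendsto v).comp hy
    have h2 : Tendsto (fun k => inner ℂ (J (y k)) (FormSpace.val S x).2) atTop
        (𝓝 (inner ℂ (J v) (FormSpace.val S x).2)) := hJy.inner tendsto_const_nhds
    have h1 : Tendsto (fun k => inner ℂ (J (y k)) (FormSpace.val S x).1) atTop
        (𝓝 (inner ℂ (J v) (FormSpace.val S x).1)) := hJy.inner tendsto_const_nhds
    refine (h2.add h1).congr fun k => ?_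
    rw [UniformSpace.Completion.inner_coe, inner_def, hJ,
      hS.symm _ (y k).val_mem _ x.val_mem]
  -- The adjoint condition says that the form limit `v` of an approximating sequence represents `p.1
  -- + p.2` in the form space, that is `v = J* (p.1 + p.2)`. Applying `J` gives `p.1 = J J* (p.1 +
  -- p.2)`.
  have hmem : friedrichs (S : Set (H × H)) =
      Set.range fun h : H => (J (J.adjoint h), h - J (J.adjoint h)) := by
    ext p
    constructor
    · rintro ⟨hadj, w, hw, hlim, hcauchy⟩
      let x : ℕ → FormSpace S := fun k => ⟨w k, hw k⟩
      have hx : ∀ k, FormSpace.val S (x k) = w k := fun _ => rfl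
      have hxc : CauchySeq x := by
        rw [cauchySeq_iff_tendsto_dist_atTop_0, ← prod_atTop_atTop_eq]
        have e : ∀ km : ℕ × ℕ, dist (x km.1) (x km.2) =
            √((inner ℂ ((w km.1).2 - (w km.2).2) ((w km.1).1 - (w km.2).1)).re +
              ‖(w km.1).1 - (w km.2).1‖ ^ 2) := by
          intro km
          rw [dist_eq_norm, ← Real.sqrt_sq (norm_nonneg (x km.1 - x km.2)), norm_def, map_sub]
          rfl
        simp only [e]
        have h1 := (Complex.continuous_re.tendsto 0).comp hcauchy
        have h2 : Tendsto (fun km : ℕ × ℕ => ‖(w km.1).1 - (w km.2).1‖ ^ 2) (atTop ×ˢ atTop)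
            (𝓝 (‖p.1 - p.1‖ ^ 2)) :=
          (((hlim.comp tendsto_fst).sub (hlim.comp tendsto_snd)).norm).pow 2
        have h3 := (Real.continuous_sqrt.tendsto _).comp (h1.add h2)
        simpa [Function.comp_def] using h3
      have hxc' : CauchySeq (fun k => (x k : UniformSpace.Completion (FormSpace S))) :=
        hxc.map (UniformSpace.Completion.uniformContinuous_coe _)
      obtain ⟨v, hv⟩ := cauchySeq_tendsto_of_complete hxc'
      have hJv : J v = p.1 := by
        refine tendsto_nhds_unique ((J.continuous.tendsto v).comp hv) (hlim.congr fun k => ?_)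
        rw [Function.comp, hJ, hx]
      have hv' : v = J.adjoint (p.1 + p.2) := by
        refine ext_inner_right ℂ fun u => ?_
        obtain ⟨y, hy⟩ := hseq u
        refine tendsto_nhds_unique (tendsto_const_nhds.inner hy)
          ((tendsto_const_nhds.inner hy).congr fun k => ?_)
        rw [ContinuousLinearMap.adjoint_inner_left, hpair, hJ, hJv, ← hadj _ (y k).val_mem,
          inner_add_left, add_comm]
      refine ⟨p.1 + p.2, ?_⟩
      simp only
      rw [← hv', hJv, add_sub_cancel_left]
    · rintro ⟨h, rfl⟩
      refine ⟨fun q hq => ?_, ?_⟩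
      · let y : FormSpace S := ⟨q, hq⟩
        have := hpair (J.adjoint h) y
        rw [ContinuousLinearMap.adjoint_inner_left, hJ] at this
        change inner ℂ h q.1 = inner ℂ _ q.2 + inner ℂ _ q.1 at this
        rw [inner_sub_left, this, add_sub_cancel_right]
      · obtain ⟨x, hx⟩ := hseq (J.adjoint h)
        refine ⟨fun k => FormSpace.val S (x k), fun k => (x k).val_mem, ?_, ?_⟩
        · exact ((J.continuous.tendsto _).comp hx).congr fun k => hJ (x k)
        · have h1 : Tendsto (fun km : ℕ × ℕ => ((x km.1 : UniformSpace.Completion (FormSpace S)) -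
              (x km.2 : UniformSpace.Completion (FormSpace S)))) (atTop ×ˢ atTop)
              (𝓝 (J.adjoint h - J.adjoint h)) :=
            (hx.comp tendsto_fst).sub (hx.comp tendsto_snd)
          have h2 := (h1.inner h1 (𝕜 := ℂ)).sub
            (((J.continuous.tendsto _).comp h1).inner ((J.continuous.tendsto _).comp h1) (𝕜 := ℂ))
          simp only [sub_self, inner_zero_left, map_zero] at h2
          refine h2.congr fun km => ?_
          rw [← UniformSpace.Completion.coe_sub, UniformSpace.Completion.inner_coe, inner_def]
          simp only [Function.comp]
          rw [← UniformSpace.Completion.coe_sub, hJ, add_sub_cancel_right, map_sub]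
          rfl
  have hpos : 0 ≤ J ∘L J.adjoint := by
    rw [ContinuousLinearMap.nonneg_iff_isPositive]
    exact ContinuousLinearMap.isPositive_self_comp_adjoint J
  have hle : J ∘L J.adjoint ≤ 1 := by
    rw [← CStarAlgebra.norm_le_one_iff_of_nonneg _ hpos]
    refine (ContinuousLinearMap.opNorm_comp_le _ _).trans ?_
    rw [LinearIsometryEquiv.norm_map]
    exact mul_le_one₀ hJ1 (norm_nonneg _) hJ1
  refine ⟨⟨J ∘L J.adjoint, hpos, hle, hmem⟩, ?_⟩
  rw [hmem]
  rintro _ ⟨h, rfl⟩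
  obtain ⟨x, hx⟩ := hseq (J.adjoint h)
  have hJx := (J.continuous.tendsto _).comp hx
  refine ⟨fun k => FormSpace.val S (x k), fun k => (x k).val_mem, hJx.congr fun k => hJ (x k), ?_⟩
  have h1 := (hx.norm.pow 2).sub (hJx.norm.pow 2)
  -- The form of `A` at `J J* h` is the form norm squared minus the norm squared, and both are
  -- continuous along the approximating sequence.
  have e : (inner ℂ (h - J (J.adjoint h)) (J (J.adjoint h))).re =
      ‖J.adjoint h‖ ^ 2 - ‖J (J.adjoint h)‖ ^ 2 := by
    rw [inner_sub_left, ← ContinuousLinearMap.adjoint_inner_left, Complex.sub_re,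
      ← inner_self_eq_norm_sq (𝕜 := ℂ), ← inner_self_eq_norm_sq (𝕜 := ℂ)]
    rfl
  rw [e]
  refine h1.congr fun k => ?_
  simp only [Function.comp]
  rw [UniformSpace.Completion.norm_coe, norm_def, hJ, add_sub_cancel_right]

/-- The operators `(A + ε)⁻¹` map into the domain of `A`. -/
theorem IsResolvent.green_mem {A : Set (H × H)} {R : H →L[ℂ] H} (hR : IsResolvent A R) {ε : ℝ}
    (hε : 0 < ε) (h : H) :
    (cfc (green ε) R h, h - (ε : ℂ) • cfc (green ε) R h) ∈ A := by
  obtain ⟨h0, h1, hA⟩ := hR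
  have hs := spectrum_subset_Icc h0 h1
  have cd : ContinuousOn (fun x : ℝ => (1 - x + ε * x)⁻¹) (Set.Icc 0 1) :=
    ContinuousOn.inv₀ (by fun_prop) fun x hx => (green_denom_pos hε hx).ne'
  set k := cfc (fun x : ℝ => (1 - x + ε * x)⁻¹) R h with hk
  have e1 : R k = cfc (green ε) R h := by
    have : R k = cfc (fun x : ℝ => x) R k := by rw [cfc_id' ℝ R (IsSelfAdjoint.of_nonneg h0)]
    rw [this, hk, cfc_mul_apply (f := fun x => x) h0 h1 continuousOn_id cd]
    rfl
  have e2 : k = h + R k - (ε : ℂ) • R k := by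
    have c2 : ContinuousOn (fun x : ℝ => (1 - ε) * green ε x) (Set.Icc 0 1) :=
      continuousOn_const.mul (continuousOn_green hε)
    have : cfc (fun x : ℝ => (1 - x + ε * x)⁻¹) R = 1 + (1 - ε) • cfc (green ε) R := by
      rw [← cfc_const_one ℝ R (IsSelfAdjoint.of_nonneg h0),
        ← cfc_smul (R := ℝ) _ _ R ((continuousOn_green hε).mono hs),
        ← cfc_add (R := ℝ) R (fun _ => 1) (fun x => (1 - ε) • green ε x) continuousOn_const
          (c2.mono hs)]
      refine cfc_congr_Icc h0 h1 fun x hx => ?_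
      have := green_denom_pos hε hx
      refine mul_right_cancel₀ this.ne' ?_
      rw [inv_mul_cancel₀ this.ne', smul_eq_mul, green, add_mul, mul_assoc,
        div_mul_cancel₀ _ this.ne']
      ring
    rw [e1, hk, this, add_apply, smul_apply, sub_smul, one_smul]
    change h + _ = _
    rw [add_sub_assoc]
    rfl
  rw [hA]
  refine ⟨k, ?_⟩
  simp only
  rw [← e1]
  refine Prod.ext rfl ?_
  change k - R k = _
  rw [sub_eq_iff_eq_add]
  conv_lhs => rw [e2]
  rw [add_sub_right_comm]

/-- The variational characterization of `⟪h, (A + ε)⁻¹ h⟫`, for the Friedrichs extension `A`. -/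
theorem exists_seq_green {R : H →L[ℂ] H} (hS : IsNonnegSymmetric S)
    (hR : IsResolvent (friedrichs (S : Set (H × H))) R) {ε : ℝ} (hε : 0 < ε) (h : H) :
    ∃ w : ℕ → H × H, (∀ k, w k ∈ S) ∧ Tendsto (fun k => (w k).1) atTop (𝓝 (cfc (green ε) R h)) ∧
      Tendsto (fun k => (inner ℂ (w k).2 (w k).1).re + ε * ‖(w k).1‖ ^ 2) atTop
        (𝓝 (inner ℂ h (cfc (green ε) R h)).re) := by
  obtain ⟨w, hw, h1, h2⟩ := hS.exists_isResolvent.2 _ (hR.green_mem hε h)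
  refine ⟨w, hw, h1, ?_⟩
  have := h2.add ((h1.norm.pow 2).const_mul ε)
  refine this.trans (le_of_eq ?_)
  rw [inner_sub_left, inner_smul_left, Complex.conj_ofReal, Complex.sub_re, Complex.re_ofReal_mul,
    ← inner_self_eq_norm_sq (𝕜 := ℂ)]
  congr 1
  exact sub_add_cancel _ _

/-- With `u = (A + ε)⁻¹ h`, the number `⟪h, q⟫` is the form of `A + ε` at `(u, q)`. Cauchy–Schwarz
is applied to form approximants of `u` taken from the domain of `S`. -/
theorem norm_inner_sq_le_green {R : H →L[ℂ] H} (hS : IsNonnegSymmetric S)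
    (hR : IsResolvent (friedrichs (S : Set (H × H))) R) {ε : ℝ} (hε : 0 < ε) (h : H)
    {q : H × H} (hq : q ∈ S) :
    ‖inner ℂ h q.1‖ ^ 2 ≤ (inner ℂ h (cfc (green ε) R h)).re *
      ((inner ℂ q.2 q.1).re + ε * ‖q.1‖ ^ 2) := by
  obtain ⟨w, hw, h1, h2⟩ := exists_seq_green hS hR hε h
  have hadj := (hR.green_mem hε h).1 q hq
  simp only at hadj
  have e : inner ℂ h q.1 = inner ℂ (cfc (green ε) R h) q.2 +
      ε * inner ℂ (cfc (green ε) R h) q.1 := by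
    rw [← hadj, inner_sub_left, inner_smul_left, Complex.conj_ofReal, sub_add_cancel]
  have lim : Tendsto (fun k => ‖inner ℂ (w k).1 q.2 + ε * inner ℂ (w k).1 q.1‖ ^ 2) atTop
      (𝓝 (‖inner ℂ h q.1‖ ^ 2)) := by
    rw [e]
    have l1 : Tendsto (fun k => inner ℂ (w k).1 q.2) atTop (𝓝 (inner ℂ (cfc (green ε) R h) q.2)) :=
      h1.inner tendsto_const_nhds
    have l2 : Tendsto (fun k => inner ℂ (w k).1 q.1) atTop (𝓝 (inner ℂ (cfc (green ε) R h) q.1)) :=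
      h1.inner tendsto_const_nhds
    exact ((l1.add (l2.const_mul _)).norm).pow 2
  refine le_of_tendsto_of_tendsto' lim (h2.mul_const _) fun k => ?_
  rw [← hS.symm _ (hw k) _ hq]
  exact hS.norm_inner_add_sq_le hε.le (hw k) hq

end Operators

/-! ### Shifted inverses and power relations, and their evaluation on multipliers -/

section Operators

variable {H : Type*} [NormedAddCommGroup H] [InnerProductSpace ℂ H] [CompleteSpace H]

/-- With `R = (1 + A)⁻¹`, the operator `(A + ε)⁻¹`. -/
noncomputable def greenOp (ε : ℝ) (R : H →L[ℂ] H) : H →L[ℂ] H := cfc (green ε) R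

/-- With `R = (1 + A)⁻¹` and `σ ≥ 0`, the relation `A ^ σ v = g`. -/
def PowRel (R : H →L[ℂ] H) (σ : ℝ) (v g : H) : Prop := ((1 - R) ^ σ) v = (R ^ σ) g

theorem IsResolvent.mem_powGraph_iff {A : Set (H × H)} {R : H →L[ℂ] H} (hR : IsResolvent A R)
    {σ : ℝ} (hσ : 0 ≤ σ) (v g : H) : (v, g) ∈ powGraph A σ ↔ PowRel R σ v g :=
  mem_powGraph_of_nonneg hR hσ v g

theorem IsResolvent.mem_powGraph_iff_of_neg {A : Set (H × H)} {R : H →L[ℂ] H}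
    (hR : IsResolvent A R) {σ : ℝ} (hσ : σ < 0) (v g : H) :
    (v, g) ∈ powGraph A σ ↔ PowRel R (-σ) g v :=
  mem_powGraph_of_neg hR hσ v g

theorem PowRel.sub {R : H →L[ℂ] H} {σ : ℝ} {v g v' g' : H} (h : PowRel R σ v g)
    (h' : PowRel R σ v' g') : PowRel R σ (v - v') (g - g') := by
  unfold PowRel at *
  rw [map_sub, map_sub, h, h']

theorem PowRel.eq {R : H →L[ℂ] H} (h0 : 0 ≤ R) (h1 : R ≤ 1) (hinj : Function.Injective R) {σ : ℝ}
    (hσ : 0 ≤ σ) (hσ1 : σ ≤ 1) {v g g' : H} (h : PowRel R σ v g) (h' : PowRel R σ v g') : g = g' :=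
  rpow_injective h0 h1 hinj hσ hσ1 (h.symm.trans h')

theorem PowRel.eq_left {R : H →L[ℂ] H} (h0 : 0 ≤ R) (h1 : R ≤ 1) (hinj : ∀ h, R h = h → h = 0)
    {σ : ℝ} (hσ : 0 ≤ σ) (hσ1 : σ ≤ 1) {v v' g : H} (h : PowRel R σ v g) (h' : PowRel R σ v' g) :
    v = v' :=
  one_sub_rpow_injective h0 h1 hinj hσ hσ1 (h.trans h'.symm)

theorem PowRel.heinz {RA RB : H →L[ℂ] H} (hA0 : 0 ≤ RA) (hA1 : RA ≤ 1) (hB0 : 0 ≤ RB)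
    (hB1 : RB ≤ 1) (hinj : Function.Injective RA) {E : H →L[ℂ] H}
    (hE : ∀ x y, inner ℂ (E x) y = inner ℂ x (E y)) {C : ℝ} (hC : 1 ≤ C)
    (hG : ∀ ε > 0, ∀ h, (inner ℂ (E h) (greenOp ε RB (E h))).re ≤
      C * (inner ℂ h (greenOp ε RA h)).re) {σ : ℝ} (hσ : 0 ≤ σ) (hσ1 : σ ≤ 1 / 2)
    {f g : H} (hfg : PowRel RB σ f g) (hf : E f = f) :
    ∃ g', PowRel RA σ f g' ∧ ‖g'‖ ≤ C * ‖g‖ :=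
  InverseSquare.heinz hA0 hA1 hB0 hB1 hinj hE hC hG hσ hσ1 hfg hf

theorem PowRel.exists_inverse {RA RB : H →L[ℂ] H} (hA0 : 0 ≤ RA) (hA1 : RA ≤ 1) (hB0 : 0 ≤ RB)
    (hB1 : RB ≤ 1) (hinj : ∀ h, RA h = h → h = 0) {σ : ℝ} (hσ : 0 ≤ σ) (hσ1 : σ ≤ 1)
    {C : ℝ} (hC : 0 ≤ C)
    (hAB : ∀ v g, PowRel RA σ v g → ∃ g', PowRel RB σ v g' ∧ ‖g'‖ ≤ C * ‖g‖)
    {f h : H} (hfh : PowRel RB σ h f) :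
    ∃ v, PowRel RA σ v f ∧ ‖v‖ ≤ C * ‖h‖ :=
  exists_inverse_power hA0 hA1 hB0 hB1 hσ (one_sub_rpow_injective hA0 hA1 hinj hσ hσ1) hC hAB hfh

theorem exists_seq_greenOp {S : Submodule ℂ (H × H)} {R : H →L[ℂ] H} (hS : IsNonnegSymmetric S)
    (hR : IsResolvent (friedrichs (S : Set (H × H))) R) {ε : ℝ} (hε : 0 < ε) (h : H) :
    ∃ w : ℕ → H × H, (∀ k, w k ∈ S) ∧ Tendsto (fun k => (w k).1) atTop (𝓝 (greenOp ε R h)) ∧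
      Tendsto (fun k => (inner ℂ (w k).2 (w k).1).re + ε * ‖(w k).1‖ ^ 2) atTop
        (𝓝 (inner ℂ h (greenOp ε R h)).re) :=
  exists_seq_green hS hR hε h

theorem norm_inner_sq_le_greenOp {S : Submodule ℂ (H × H)} {R : H →L[ℂ] H}
    (hS : IsNonnegSymmetric S) (hR : IsResolvent (friedrichs (S : Set (H × H))) R) {ε : ℝ}
    (hε : 0 < ε) (h : H) {q : H × H} (hq : q ∈ S) :
    ‖inner ℂ h q.1‖ ^ 2 ≤ (inner ℂ h (greenOp ε R h)).re *
      ((inner ℂ q.2 q.1).re + ε * ‖q.1‖ ^ 2) :=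
  norm_inner_sq_le_green hS hR hε h hq

variable {A : Type*} [CStarAlgebra A] (Φ : A →⋆ₐ[ℂ] (H →L[ℂ] H)) {ι : Type*} (χ : ι → A →⋆ₐ[ℂ] ℂ)

/-- The functional calculus in a commutative algebra of multipliers is pointwise. -/
theorem cfc_starAlgHom (hχ : ∀ b c : A, (∀ i, χ i b = χ i c) → b = c)
    {a : A} (ha : IsSelfAdjoint a) (hspec : spectrum ℝ a ⊆ Set.Icc 0 1) {f : ℝ → ℝ}
    (hf : ContinuousOn f (Set.Icc 0 1)) {t : ι → ℝ} (ht : ∀ i, χ i a = t i) {b : A}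
    (hb : ∀ i, χ i b = (f (t i) : ℝ)) : cfc f (Φ a) = Φ b := by
  have hcfc : cfc f a = b := by
    refine hχ _ _ fun i => ?_
    have := StarAlgHom.map_cfc (χ i) f a (hf.mono hspec) (map_continuous (χ i)) ha (ha.map (χ i))
    rw [this, ht, hb]
    exact cfc_algebraMap (A := ℂ) (t i) f
  rw [← hcfc]
  exact (StarAlgHom.map_cfc Φ f a (hf.mono hspec)
    (AddMonoidHomClass.continuous_of_bound Φ 1 fun x => by
      simpa using NonUnitalStarAlgHom.norm_apply_le Φ x) ha (ha.map Φ)).symm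

theorem greenOp_starAlgHom (hχ : ∀ b c : A, (∀ i, χ i b = χ i c) → b = c)
    {a : A} (ha : IsSelfAdjoint a) (hspec : spectrum ℝ a ⊆ Set.Icc 0 1) {ε : ℝ} (hε : 0 < ε)
    {t : ι → ℝ} (ht : ∀ i, χ i a = t i) {b : A} (hb : ∀ i, χ i b = (green ε (t i) : ℝ)) :
    greenOp ε (Φ a) = Φ b :=
  cfc_starAlgHom Φ χ hχ ha hspec (continuousOn_green hε) ht hb

theorem powRel_starAlgHom (hχ : ∀ b c : A, (∀ i, χ i b = χ i c) → b = c)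
    {a : A} (ha : IsSelfAdjoint a) (hspec : spectrum ℝ a ⊆ Set.Icc 0 1) (h0 : 0 ≤ Φ a)
    (h1 : Φ a ≤ 1) {σ : ℝ} (hσ : 0 ≤ σ)
    {t : ι → ℝ} (ht : ∀ i, χ i a = t i) {b c : A} (hb : ∀ i, χ i b = ((1 - t i) ^ σ : ℝ))
    (hc : ∀ i, χ i c = (t i ^ σ : ℝ)) (v g : H) : PowRel (Φ a) σ v g ↔ Φ b v = Φ c g := by
  rw [PowRel, one_sub_rpow_eq_cfc h0 h1 hσ, rpow_eq_cfc h0,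
    cfc_starAlgHom Φ χ hχ ha hspec (continuousOn_one_sub_rpow hσ) ht hb,
    cfc_starAlgHom Φ χ hχ ha hspec (continuousOn_rpow_id hσ) ht hc]

end Operators

/-! ### Fourier multipliers on `L²` -/

section Multiplier

variable {n : ℕ}

theorem memLp_bcf_mul (g : Rn n →ᵇ ℂ) (f : L2 n) :
    MemLp (fun x => g x * f x) 2 (volume : Measure (Rn n)) :=
  MemLp.of_le_mul (c := ‖g‖) (Lp.memLp f)
    (g.continuous.aestronglyMeasurable.mul (Lp.aestronglyMeasurable f))
    (Eventually.of_forall fun x => by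
      rw [norm_mul]
      gcongr
      exact g.norm_coe_le_norm x)

/-- Multiplication by a bounded continuous function, as an operator on `L²`. -/
noncomputable def mulCLM (g : Rn n →ᵇ ℂ) : L2 n →L[ℂ] L2 n :=
  LinearMap.mkContinuous
    { toFun := fun f => (memLp_bcf_mul g f).toLp _
      map_add' := fun f f' => by
        refine Lp.ext ?_
        filter_upwards [(memLp_bcf_mul g (f + f')).coeFn_toLp, (memLp_bcf_mul g f).coeFn_toLp,
          (memLp_bcf_mul g f').coeFn_toLp, Lp.coeFn_add f f',
          Lp.coeFn_add ((memLp_bcf_mul g f).toLp _) ((memLp_bcf_mul g f').toLp _)]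
          with x h1 h2 h3 h4 h5
        rw [h1, h5, Pi.add_apply, h2, h3, h4, Pi.add_apply, mul_add]
      map_smul' := fun c f => by
        refine Lp.ext ?_
        filter_upwards [(memLp_bcf_mul g (c • f)).coeFn_toLp, (memLp_bcf_mul g f).coeFn_toLp,
          Lp.coeFn_smul c f, Lp.coeFn_smul c ((memLp_bcf_mul g f).toLp _)] with x h1 h2 h3 h4
        rw [h1, RingHom.id_apply, h4, Pi.smul_apply, h2, h3, Pi.smul_apply, smul_eq_mul,
          smul_eq_mul, mul_left_comm] }
    ‖g‖ (fun f => by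
      refine Lp.norm_le_mul_norm_of_ae_le_mul ?_
      filter_upwards [(memLp_bcf_mul g f).coeFn_toLp] with x hx
      change ‖(memLp_bcf_mul g f).toLp _ x‖ ≤ _
      rw [hx, norm_mul]
      gcongr
      exact g.norm_coe_le_norm x)

theorem coeFn_mulCLM (g : Rn n →ᵇ ℂ) (f : L2 n) :
    mulCLM g f =ᵐ[volume] fun x => g x * f x :=
  (memLp_bcf_mul g f).coeFn_toLp

theorem L2.inner_eq_integral (f g : L2 n) :
    inner ℂ f g = ∫ x, (starRingEnd ℂ) (f x) * g x := by
  rw [L2.inner_def]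
  simp only [RCLike.inner_apply, mul_comm]

/-- Multiplication by bounded continuous functions is a representation on `L²`. -/
noncomputable def mulStarAlgHom (n : ℕ) : (Rn n →ᵇ ℂ) →⋆ₐ[ℂ] (L2 n →L[ℂ] L2 n) where
  toFun := mulCLM
  map_one' := by
    ext1 f
    refine Lp.ext ?_
    filter_upwards [coeFn_mulCLM 1 f] with x hx
    simp [hx]
  map_mul' g k := by
    ext1 f
    refine Lp.ext ?_
    filter_upwards [coeFn_mulCLM (g * k) f, coeFn_mulCLM g (mulCLM k f), coeFn_mulCLM k f]
      with x h1 h2 h3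
    change mulCLM (g * k) f x = mulCLM g (mulCLM k f) x
    rw [h1, h2, h3, BoundedContinuousFunction.mul_apply, mul_assoc]
  map_zero' := by
    ext1 f
    refine Lp.ext ?_
    filter_upwards [coeFn_mulCLM 0 f] with x h1
    simp [h1]
  map_add' g k := by
    ext1 f
    refine Lp.ext ?_
    filter_upwards [coeFn_mulCLM (g + k) f, coeFn_mulCLM g f, coeFn_mulCLM k f,
      Lp.coeFn_add (mulCLM g f) (mulCLM k f)] with x h1 h2 h3 h4
    rw [add_apply, h1, h4, Pi.add_apply, h2, h3, BoundedContinuousFunction.add_apply, add_mul]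
  commutes' c := by
    ext1 f
    refine Lp.ext ?_
    filter_upwards [coeFn_mulCLM (algebraMap ℂ _ c) f, Lp.coeFn_smul c f] with x h1 h2
    change mulCLM (algebraMap ℂ _ c) f x = (c • f) x
    rw [h1, h2]
    rfl
  map_star' g := by
    rw [ContinuousLinearMap.star_eq_adjoint]
    rw [ContinuousLinearMap.eq_adjoint_iff]
    intro f k
    rw [L2.inner_eq_integral, L2.inner_eq_integral]
    refine integral_congr_ae ?_
    filter_upwards [coeFn_mulCLM (star g) f, coeFn_mulCLM g k] with x h1 h2
    rw [h1, h2, BoundedContinuousFunction.star_apply, map_mul]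
    simp only [Complex.star_def, Complex.conj_conj]
    ring

/-- The Fourier transform on `L²`. -/
noncomputable def fourierL2 (n : ℕ) : L2 n ≃ₗᵢ[ℂ] L2 n := Lp.fourierTransformₗᵢ (Rn n) ℂ

/-- Fourier multipliers with bounded continuous symbol. -/
noncomputable def fourierMul (n : ℕ) : (Rn n →ᵇ ℂ) →⋆ₐ[ℂ] (L2 n →L[ℂ] L2 n) :=
  ((fourierL2 n).symm.conjStarAlgEquiv.toStarAlgHom).comp (mulStarAlgHom n)

theorem fourier_fourierMul (g : Rn n →ᵇ ℂ) (f : L2 n) :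
    fourierL2 n (fourierMul n g f) =ᵐ[volume] fun ξ => g ξ * fourierL2 n f ξ := by
  have : fourierL2 n (fourierMul n g f) = mulCLM g (fourierL2 n f) :=
    (fourierL2 n).apply_symm_apply _
  rw [this]
  exact coeFn_mulCLM g _

/-- The symbol `(1 + |2πξ|²)⁻¹` of the free resolvent. -/
noncomputable def freeSymbol (ξ : Rn n) : ℝ := (1 + (2 * Real.pi * ‖ξ‖) ^ 2)⁻¹

theorem freeSymbol_pos (ξ : Rn n) : 0 < freeSymbol ξ := by
  unfold freeSymbol; positivity

theorem freeSymbol_le_one (ξ : Rn n) : freeSymbol ξ ≤ 1 :=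
  inv_le_one_of_one_le₀ (le_add_of_nonneg_right (by positivity))

theorem freeSymbol_mem (ξ : Rn n) : freeSymbol ξ ∈ Set.Icc (0 : ℝ) 1 :=
  ⟨(freeSymbol_pos ξ).le, freeSymbol_le_one ξ⟩

theorem continuous_freeSymbol : Continuous (freeSymbol : Rn n → ℝ) :=
  Continuous.inv₀ (by fun_prop) fun ξ => by positivity

/-- A continuous function of the symbol of the free resolvent. -/
noncomputable def symbolComp (n : ℕ) (f : ℝ → ℝ) (hf : ContinuousOn f (Set.Icc 0 1)) :
    Rn n →ᵇ ℂ :=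
  BoundedContinuousFunction.ofNormedAddCommGroup (fun ξ => (f (freeSymbol ξ) : ℂ))
    (Complex.continuous_ofReal.comp (hf.comp_continuous continuous_freeSymbol freeSymbol_mem))
    (isCompact_Icc.exists_bound_of_continuousOn hf).choose (fun ξ => by
      rw [Complex.norm_real]
      exact (isCompact_Icc.exists_bound_of_continuousOn hf).choose_spec _ (freeSymbol_mem ξ))

theorem symbolComp_apply {f : ℝ → ℝ} (hf : ContinuousOn f (Set.Icc 0 1)) (ξ : Rn n) :
    symbolComp n f hf ξ = (f (freeSymbol ξ) : ℂ) := rfl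

theorem isSelfAdjoint_symbolComp {f : ℝ → ℝ} (hf : ContinuousOn f (Set.Icc 0 1)) :
    IsSelfAdjoint (symbolComp n f hf) := by
  ext ξ
  rw [BoundedContinuousFunction.star_apply, symbolComp_apply, Complex.star_def, Complex.conj_ofReal]

/-- The free resolvent `(1 - Δ)⁻¹` on `L²`. -/
noncomputable def freeResolvent (n : ℕ) : L2 n →L[ℂ] L2 n :=
  fourierMul n (symbolComp n (fun x => x) continuousOn_id)

theorem fourierMul_symbolComp_nonneg {f : ℝ → ℝ} (hf : ContinuousOn f (Set.Icc 0 1))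
    (h0 : ∀ x ∈ Set.Icc (0 : ℝ) 1, 0 ≤ f x) : 0 ≤ fourierMul n (symbolComp n f hf) := by
  have hs : ContinuousOn (fun x => √(f x)) (Set.Icc 0 1) := Real.continuous_sqrt.comp_continuousOn hf
  have e : symbolComp n f hf = symbolComp n _ hs * symbolComp n _ hs := by
    ext ξ
    rw [BoundedContinuousFunction.mul_apply, symbolComp_apply, symbolComp_apply,
      ← Complex.ofReal_mul, Real.mul_self_sqrt (h0 _ (freeSymbol_mem ξ))]
  rw [e, map_mul]
  exact ((isSelfAdjoint_symbolComp hs).map (fourierMul n)).mul_self_nonneg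

theorem freeResolvent_nonneg : 0 ≤ freeResolvent n :=
  fourierMul_symbolComp_nonneg _ fun _ hx => hx.1

theorem freeResolvent_le_one : freeResolvent n ≤ 1 := by
  have h := fourierMul_symbolComp_nonneg (n := n) (f := fun x => 1 - x)
    (by fun_prop) (fun x hx => sub_nonneg.2 hx.2)
  have e : symbolComp n (fun x => 1 - x) (by fun_prop) =
      1 - symbolComp n (fun x => x) continuousOn_id := by
    ext ξ
    rw [BoundedContinuousFunction.sub_apply, symbolComp_apply, symbolComp_apply]
    simp
  rw [e, map_sub, map_one] at h
  exact sub_nonneg.1 h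

/-- Evaluation at a point. -/
noncomputable def evalStarAlgHom (ξ : Rn n) : (Rn n →ᵇ ℂ) →⋆ₐ[ℂ] ℂ where
  toFun g := g ξ
  map_one' := rfl
  map_mul' _ _ := rfl
  map_zero' := rfl
  map_add' _ _ := rfl
  commutes' c := by simp
  map_star' _ := rfl

theorem evalStarAlgHom_ext (b c : Rn n →ᵇ ℂ)
    (h : ∀ ξ : Rn n, evalStarAlgHom ξ b = evalStarAlgHom ξ c) : b = c :=
  BoundedContinuousFunction.ext h

/-- For `r` outside `[0, 1]` the function `x ↦ (r - x)⁻¹` is continuous on `[0, 1]` and furnishes a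
bounded continuous inverse. -/
theorem spectrum_symbolComp_id :
    spectrum ℝ (symbolComp n (fun x => x) continuousOn_id) ⊆ Set.Icc 0 1 := by
  intro r hr
  by_contra hr'
  refine hr ?_
  have hne : ∀ x ∈ Set.Icc (0 : ℝ) 1, r - x ≠ 0 := by
    intro x hx h
    rw [sub_eq_zero.1 h] at hr'
    exact hr' hx
  have c1 : ContinuousOn (fun x => r - x) (Set.Icc 0 1) := by fun_prop
  have c2 : ContinuousOn (fun x => (r - x)⁻¹) (Set.Icc 0 1) := c1.inv₀ hne
  have e1 : algebraMap ℝ (Rn n →ᵇ ℂ) r - symbolComp n (fun x => x) continuousOn_id =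
      symbolComp n _ c1 := by
    ext ξ
    rw [BoundedContinuousFunction.sub_apply, symbolComp_apply, symbolComp_apply,
      Algebra.algebraMap_eq_smul_one]
    simp
  have e2 : symbolComp n _ c1 * symbolComp n _ c2 = 1 := by
    ext ξ
    rw [BoundedContinuousFunction.mul_apply, symbolComp_apply, symbolComp_apply,
      ← Complex.ofReal_mul, mul_inv_cancel₀ (hne _ (freeSymbol_mem ξ))]
    simp
  change IsUnit (algebraMap ℝ (Rn n →ᵇ ℂ) r - symbolComp n (fun x => x) continuousOn_id)
  rw [e1]
  exact IsUnit.of_mul_eq_one _ e2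

theorem greenOp_freeResolvent {ε : ℝ} (hε : 0 < ε) :
    greenOp ε (freeResolvent n) = fourierMul n (symbolComp n _ (continuousOn_green hε)) :=
  greenOp_starAlgHom (fourierMul n) evalStarAlgHom evalStarAlgHom_ext
    (isSelfAdjoint_symbolComp continuousOn_id) spectrum_symbolComp_id hε (fun _ => rfl)
    (fun _ => rfl)

theorem green_freeSymbol (ε : ℝ) (ξ : Rn n) :
    green ε (freeSymbol ξ) = ((2 * Real.pi * ‖ξ‖) ^ 2 + ε)⁻¹ := by
  have : (1 : ℝ) + (2 * Real.pi * ‖ξ‖) ^ 2 ≠ 0 := by positivity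
  rw [green, freeSymbol]
  field_simp
  congr 1
  ring

theorem fourierL2_greenOp {ε : ℝ} (hε : 0 < ε) (v : L2 n) :
    fourierL2 n (greenOp ε (freeResolvent n) v) =ᵐ[volume]
      fun ξ => ((((2 * Real.pi * ‖ξ‖) ^ 2 + ε)⁻¹ : ℝ) : ℂ) * fourierL2 n v ξ := by
  rw [greenOp_freeResolvent hε]
  filter_upwards [fourier_fourierMul (symbolComp n _ (continuousOn_green hε)) v] with ξ h
  rw [h, symbolComp_apply, green_freeSymbol]

theorem fourierL2_ext {f g : L2 n} (h : fourierL2 n f =ᵐ[volume] fourierL2 n g) : f = g :=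
  (fourierL2 n).injective (Lp.ext h)

/-- The powers of `-Δ` are Fourier multipliers. -/
theorem powRel_freeResolvent_iff {σ : ℝ} (hσ : 0 ≤ σ) (v g : L2 n) :
    PowRel (freeResolvent n) σ v g ↔ fourierL2 n g =ᵐ[volume]
      fun ξ => (((2 * Real.pi * ‖ξ‖) ^ (2 * σ) : ℝ) : ℂ) * fourierL2 n v ξ := by
  refine (powRel_starAlgHom (fourierMul n) evalStarAlgHom evalStarAlgHom_ext
    (isSelfAdjoint_symbolComp continuousOn_id) spectrum_symbolComp_id freeResolvent_nonneg
    freeResolvent_le_one hσ (t := freeSymbol)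
    (b := symbolComp n _ (continuousOn_one_sub_rpow hσ))
    (c := symbolComp n _ (continuousOn_rpow_id hσ)) (fun _ => rfl)
    (fun _ => rfl) (fun _ => rfl) v g).trans ?_
  have h1 := fourier_fourierMul (symbolComp n _ (continuousOn_one_sub_rpow hσ)) v
  have h2 := fourier_fourierMul (symbolComp n _ (continuousOn_rpow_id hσ)) g
  -- The symbol `m` of the resolvent satisfies `1 - m = m |2πξ|²`. As `m > 0`, the factor `m ^ σ`
  -- cancels from the power relation.
  have hs : ∀ ξ : Rn n, (1 - freeSymbol ξ) ^ σ =
      freeSymbol ξ ^ σ * (2 * Real.pi * ‖ξ‖) ^ (2 * σ) := by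
    intro ξ
    rw [Real.rpow_mul (by positivity), ← Real.mul_rpow (freeSymbol_pos ξ).le (by positivity)]
    congr 1
    rw [freeSymbol]
    norm_cast
    field_simp
    ring
  have hne : ∀ ξ : Rn n, ((freeSymbol ξ ^ σ : ℝ) : ℂ) ≠ 0 := fun ξ =>
    Complex.ofReal_ne_zero.2 (Real.rpow_pos_of_pos (freeSymbol_pos ξ) σ).ne'
  constructor
  · intro h
    rw [h] at h1
    filter_upwards [h1, h2] with ξ h1 h2
    rw [h2, symbolComp_apply, symbolComp_apply, hs, Complex.ofReal_mul, mul_assoc] at h1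
    exact mul_left_cancel₀ (hne ξ) h1
  · intro h
    refine fourierL2_ext ?_
    filter_upwards [h1, h2, h] with ξ h1 h2 h
    rw [h1, h2, h, symbolComp_apply, symbolComp_apply, hs, Complex.ofReal_mul, mul_assoc]

theorem freeResolvent_injective : Function.Injective (freeResolvent n) := by
  rw [injective_iff_map_eq_zero]
  intro f hf
  have h := fourier_fourierMul (symbolComp n (fun x => x) continuousOn_id) f
  change fourierL2 n (freeResolvent n f) =ᵐ[volume] _ at h
  rw [hf] at h
  refine fourierL2_ext ?_
  have e : fourierL2 n 0 = 0 := (fourierL2 n).map_zero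
  rw [e] at h ⊢
  filter_upwards [h, Lp.coeFn_zero ℂ 2 (volume : Measure (Rn n))] with ξ h h0
  rw [h0] at h ⊢
  rw [symbolComp_apply] at h
  exact (mul_eq_zero.1 h.symm).resolve_left (Complex.ofReal_ne_zero.2 (freeSymbol_pos ξ).ne')

end Multiplier

/-! ### Schwartz multipliers, radial functions and annular cutoffs on `L²` -/

section SchwartzTools

variable {n : ℕ}

/-- The product of Schwartz functions. -/
noncomputable def smul𝓢 (ψ φ : 𝓢(Rn n, ℂ)) : 𝓢(Rn n, ℂ) :=
  SchwartzMap.pairing (ContinuousLinearMap.mul ℂ ℂ) ψ φ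

theorem smul𝓢_apply (ψ φ : 𝓢(Rn n, ℂ)) (x : Rn n) : smul𝓢 ψ φ x = ψ x * φ x := rfl

/-- Multiplication by a Schwartz function on `L²`. -/
noncomputable def mulS (ψ : 𝓢(Rn n, ℂ)) : L2 n →L[ℂ] L2 n := mulCLM ψ.toBoundedContinuousFunction

theorem coeFn_mulS (ψ : 𝓢(Rn n, ℂ)) (f : L2 n) : mulS ψ f =ᵐ[volume] fun x => ψ x * f x :=
  coeFn_mulCLM _ f

/-- A function that vanishes near the origin and is smooth elsewhere is smooth. -/
theorem contDiff_of_eventuallyEq_zero {F : Type*} [NormedAddCommGroup F] [NormedSpace ℝ F]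
    {f : Rn n → F} (h0 : f =ᶠ[𝓝 0] 0)
    (h : ∀ x, x ≠ 0 → ContDiffAt ℝ ∞ f x) : ContDiff ℝ ∞ f := by
  rw [contDiff_iff_contDiffAt]
  intro x
  rcases eq_or_ne x 0 with rfl | hx
  · exact contDiffAt_const.congr_of_eventuallyEq h0
  · exact h x hx

/-- A function that is locally integrable away from the origin vanishes if it is orthogonal to all
test functions supported away from the origin. -/
theorem ae_eq_zero_of_forall_schwartz [Nontrivial (Rn n)] {w : Rn n → ℂ}
    (hw : LocallyIntegrableOn w {0}ᶜ)
    (h : ∀ φ : 𝓢(Rn n, ℂ), HasCompactSupport φ → (0 : Rn n) ∉ tsupport φ → ∫ x, φ x * w x = 0) :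
    w =ᵐ[volume] 0 := by
  have := isOpen_compl_singleton.ae_eq_zero_of_integral_contDiff_smul_eq_zero hw (by
    intro g hg hc hs
    have hg₁ : HasCompactSupport (Complex.ofRealCLM ∘ g) := hc.comp_left rfl
    have hg₂ : ContDiff ℝ ∞ (Complex.ofRealCLM ∘ g) := by fun_prop
    have h2 : tsupport (Complex.ofRealCLM ∘ g) ⊆ tsupport g :=
      closure_mono (Function.support_comp_subset rfl g)
    have := h (hg₁.toSchwartzMap hg₂) hg₁ fun h0 => hs (h2 h0) rfl
    simpa using this)
  have h0 : ∀ᵐ x : Rn n, x ≠ 0 := by simp [ae_iff]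
  filter_upwards [this, h0] with x h1 h2
  exact h1 h2

theorem L2.locallyIntegrable (f : L2 n) : LocallyIntegrable f (volume : Measure (Rn n)) :=
  (Lp.memLp f).locallyIntegrable (by norm_num)

theorem continuousOn_norm_rpow (r : ℝ) :
    ContinuousOn (fun x : Rn n => (((2 * Real.pi * ‖x‖) ^ r : ℝ) : ℂ)) {0}ᶜ := by
  refine Complex.continuous_ofReal.comp_continuousOn ?_
  refine ContinuousOn.rpow_const (by fun_prop) fun x hx => Or.inl ?_
  have : ‖x‖ ≠ 0 := norm_ne_zero_iff.2 hx
  positivity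

theorem locallyIntegrableOn_rpow_mul (r : ℝ) (f : L2 n) :
    LocallyIntegrableOn (fun x : Rn n => (((2 * Real.pi * ‖x‖) ^ r : ℝ) : ℂ) * f x) {0}ᶜ :=
  ((L2.locallyIntegrable f).locallyIntegrableOn _).continuousOn_mul (continuousOn_norm_rpow r)
    isOpen_compl_singleton.isLocallyClosed

theorem toTD_apply (f : L2 n) (φ : 𝓢(Rn n, ℂ)) :
    Lp.toTemperedDistribution f φ = ∫ x, φ x * f x := by
  rw [Lp.toTemperedDistribution_apply]
  rfl

theorem toTD_sub (f g : L2 n) : Lp.toTemperedDistribution (f - g) =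
    Lp.toTemperedDistribution f - Lp.toTemperedDistribution g :=
  map_sub (Lp.toTemperedDistributionCLM ℂ (volume : Measure (Rn n)) 2) f g

theorem fourier_toTD (f : L2 n) : 𝓕 (Lp.toTemperedDistribution f) =
    Lp.toTemperedDistribution (fourierL2 n f) :=
  Lp.fourier_toTemperedDistribution_eq f

theorem integral_fourierL2 (f : L2 n) (φ : 𝓢(Rn n, ℂ)) :
    ∫ x, φ x * fourierL2 n f x = ∫ x, 𝓕 φ x * f x := by
  rw [← toTD_apply, ← fourier_toTD, TemperedDistribution.fourier_apply, toTD_apply]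

theorem fourierL2_toLp (φ : 𝓢(Rn n, ℂ)) : fourierL2 n (φ.toLp 2) = (𝓕 φ).toLp 2 :=
  SchwartzMap.toLp_fourier_eq φ

theorem integrable_schwartz_mul (φ : 𝓢(Rn n, ℂ)) (f : L2 n) :
    Integrable (fun x => φ x * f x) :=
  (φ.memLp 2 volume).integrable_mul (Lp.memLp f)

/-! ### Radial functions -/

/-- The function is radial. -/
def IsRadial (φ : 𝓢(Rn n, ℂ)) : Prop := ∀ x y : Rn n, ‖x‖ = ‖y‖ → φ x = φ y

theorem IsRadial.smul𝓢 {ψ φ : 𝓢(Rn n, ℂ)} (hψ : IsRadial ψ) (hφ : IsRadial φ) :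
    IsRadial (smul𝓢 ψ φ) := fun x y h => by
  rw [smul𝓢_apply, smul𝓢_apply, hψ x y h, hφ x y h]

/-- The reflection exchanging `x` and `y`. Radiality is thereby invariance under isometries, with
which the Fourier transform commutes. -/
theorem exists_isometry_of_norm_eq {x y : Rn n} (h : ‖x‖ = ‖y‖) :
    ∃ A : Rn n ≃ₗᵢ[ℝ] Rn n, A x = y :=
  ⟨_, Submodule.reflection_sub h⟩

theorem IsRadial.fourier {φ : 𝓢(Rn n, ℂ)} (hφ : IsRadial φ) : IsRadial (𝓕 φ) := by
  intro x y h
  obtain ⟨A, rfl⟩ := exists_isometry_of_norm_eq h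
  rw [SchwartzMap.fourier_coe, ← Real.fourier_comp_linearIsometry]
  exact congrFun (congrArg 𝓕 (funext fun z => hφ _ _ (A.norm_map z).symm)) x

theorem IsRadial.fourierInv {φ : 𝓢(Rn n, ℂ)} (hφ : IsRadial φ) : IsRadial (𝓕⁻ φ) := by
  intro x y h
  obtain ⟨A, rfl⟩ := exists_isometry_of_norm_eq h
  rw [SchwartzMap.fourierInv_coe, ← Real.fourierInv_comp_linearIsometry]
  exact congrFun (congrArg 𝓕⁻ (funext fun z => hφ _ _ (A.norm_map z).symm)) x

/-- The functions in `L²` that are orthogonal to radial functions if `b` holds; all of `L²`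
otherwise. -/
noncomputable def radialCompl (n : ℕ) (b : Prop) : Submodule ℂ (L2 n) where
  carrier := {f | b → ∀ φ : 𝓢(Rn n, ℂ), IsRadial φ → ∫ x, φ x * f x = 0}
  zero_mem' := fun _ φ _ => by
    rw [← toTD_apply]
    exact congrArg (fun u : 𝓢'(Rn n, ℂ) => u φ)
      (map_zero (Lp.toTemperedDistributionCLM ℂ (volume : Measure (Rn n)) 2))
  add_mem' := fun {f g} hf hg hb φ hφ => by
    have := congrArg (fun u : 𝓢'(Rn n, ℂ) => u φ)
      (map_add (Lp.toTemperedDistributionCLM ℂ (volume : Measure (Rn n)) 2) f g)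
    rw [← toTD_apply]
    refine this.trans ?_
    change Lp.toTemperedDistribution f φ + Lp.toTemperedDistribution g φ = 0
    rw [toTD_apply, toTD_apply, hf hb φ hφ, hg hb φ hφ, add_zero]
  smul_mem' := fun c f hf hb φ hφ => by
    have := congrArg (fun u : 𝓢'(Rn n, ℂ) => u φ)
      (map_smul (Lp.toTemperedDistributionCLM ℂ (volume : Measure (Rn n)) 2) c f)
    rw [← toTD_apply]
    refine this.trans ?_
    change c • Lp.toTemperedDistribution f φ = 0
    rw [toTD_apply, hf hb φ hφ, smul_zero]

theorem mem_radialCompl {b : Prop} {f : L2 n} : f ∈ radialCompl n b ↔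
    (b → ∀ φ : 𝓢(Rn n, ℂ), IsRadial φ → ∫ x, φ x * f x = 0) := Iff.rfl

theorem isClosed_radialCompl (b : Prop) : IsClosed (radialCompl n b : Set (L2 n)) := by
  have : (radialCompl n b : Set (L2 n)) =
      ⋂ (_ : b) (φ : 𝓢(Rn n, ℂ)) (_ : IsRadial φ),
        {f | Lp.toTemperedDistributionCLM ℂ (volume : Measure (Rn n)) 2 f φ = 0} := by
    ext f
    simp only [SetLike.mem_coe, mem_radialCompl, Set.mem_iInter, Set.mem_ofPred_eq,
      Lp.toTemperedDistributionCLM_apply, toTD_apply]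
  rw [this]
  refine isClosed_iInter fun _ => isClosed_iInter fun φ => isClosed_iInter fun _ =>
    isClosed_eq ?_ continuous_const
  exact (PointwiseConvergenceCLM.evalCLM _ ℂ φ).continuous.comp
    (Lp.toTemperedDistributionCLM ℂ (volume : Measure (Rn n)) 2).continuous

theorem mulS_mem_radialCompl {b : Prop} {f : L2 n} (hf : f ∈ radialCompl n b) {ψ : 𝓢(Rn n, ℂ)}
    (hψ : IsRadial ψ) : mulS ψ f ∈ radialCompl n b := by
  intro hb φ hφ
  rw [← hf hb _ (hφ.smul𝓢 hψ)]
  refine integral_congr_ae ?_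
  filter_upwards [coeFn_mulS ψ f] with x hx
  rw [hx, smul𝓢_apply, mul_assoc]

theorem fourierL2_mem_radialCompl {b : Prop} {f : L2 n} (hf : f ∈ radialCompl n b) :
    fourierL2 n f ∈ radialCompl n b := by
  intro hb φ hφ
  rw [integral_fourierL2]
  exact hf hb _ hφ.fourier

theorem fourierL2_symm_mem_radialCompl {b : Prop} {f : L2 n} (hf : f ∈ radialCompl n b) :
    (fourierL2 n).symm f ∈ radialCompl n b := by
  intro hb φ hφ
  have := integral_fourierL2 ((fourierL2 n).symm f) (𝓕⁻ φ)
  rw [LinearIsometryEquiv.apply_symm_apply, fourier_fourierInv_eq] at this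
  rw [← this]
  exact hf hb _ hφ.fourierInv

/-! ### Smooth cutoffs to annuli -/

/-- A smooth radial cutoff to a ball. -/
noncomputable def chi (x : Rn n) : ℝ := Real.smoothTransition (2 - ‖x‖ ^ 2)

theorem contDiff_chi : ContDiff ℝ ∞ (chi : Rn n → ℝ) :=
  Real.smoothTransition.contDiff.comp (contDiff_const.sub (contDiff_norm_sq ℝ))

theorem chi_nonneg (x : Rn n) : 0 ≤ chi x := Real.smoothTransition.nonneg _

theorem chi_le_one (x : Rn n) : chi x ≤ 1 := Real.smoothTransition.le_one _

theorem chi_eq_one {x : Rn n} (h : ‖x‖ ^ 2 ≤ 1) : chi x = 1 :=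
  Real.smoothTransition.one_of_one_le (by linarith)

theorem chi_eq_zero {x : Rn n} (h : 2 ≤ ‖x‖ ^ 2) : chi x = 0 :=
  Real.smoothTransition.zero_of_nonpos (by linarith)

/-- A smooth radial cutoff to the annulus between the radii `1/(k+1)` and `2(k+1)`. -/
noncomputable def annulusFun (k : ℕ) (x : Rn n) : ℝ :=
  chi (((k : ℝ) + 1)⁻¹ • x) * (1 - chi (((k : ℝ) + 1) • x))

theorem annulusFun_nonneg (k : ℕ) (x : Rn n) : 0 ≤ annulusFun k x :=
  mul_nonneg (chi_nonneg _) (sub_nonneg.2 (chi_le_one _))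

theorem annulusFun_le_one (k : ℕ) (x : Rn n) : annulusFun k x ≤ 1 :=
  mul_le_one₀ (chi_le_one _) (sub_nonneg.2 (chi_le_one _)) (by linarith [chi_nonneg (((k : ℝ) + 1) • x)])

theorem contDiff_annulusFun (k : ℕ) : ContDiff ℝ ∞ (annulusFun k : Rn n → ℝ) :=
  (contDiff_chi.comp (contDiff_const_smul _)).mul
    (contDiff_const.sub (contDiff_chi.comp (contDiff_const_smul _)))

theorem norm_smul_sq (c : ℝ) (x : Rn n) : ‖c • x‖ ^ 2 = c ^ 2 * ‖x‖ ^ 2 := by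
  rw [norm_smul, mul_pow, Real.norm_eq_abs, sq_abs]

theorem annulusFun_eq_zero_of_le {k : ℕ} {x : Rn n} (h : ((k : ℝ) + 1) * ‖x‖ ≤ 1) :
    annulusFun k x = 0 := by
  rw [annulusFun, chi_eq_one (x := ((k : ℝ) + 1) • x), sub_self, mul_zero]
  rw [norm_smul, Real.norm_of_nonneg (by positivity)]
  exact pow_le_one₀ (by positivity) h

theorem annulusFun_eq_zero_of_ge {k : ℕ} {x : Rn n} (h : 2 * ((k : ℝ) + 1) ≤ ‖x‖) :
    annulusFun k x = 0 := by
  rw [annulusFun, chi_eq_zero (x := ((k : ℝ) + 1)⁻¹ • x), zero_mul]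
  rw [norm_smul, Real.norm_of_nonneg (by positivity)]
  have : 2 ≤ ((k : ℝ) + 1)⁻¹ * ‖x‖ := by
    rw [inv_mul_eq_div, le_div_iff₀ (by positivity)]
    exact h
  nlinarith

theorem annulusFun_radial (k : ℕ) {x y : Rn n} (h : ‖x‖ = ‖y‖) : annulusFun k x = annulusFun k y := by
  simp only [annulusFun, chi, norm_smul, h]

theorem eventually_annulusFun_eq_one {x : Rn n} (hx : x ≠ 0) :
    ∀ᶠ k : ℕ in atTop, annulusFun k x = 1 := by
  have h0 : 0 < ‖x‖ := norm_pos_iff.2 hx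
  have h1 : Tendsto (fun k : ℕ => (k : ℝ) + 1) atTop atTop :=
    tendsto_atTop_add_const_right _ _ tendsto_natCast_atTop_atTop
  filter_upwards [h1.eventually_ge_atTop ‖x‖, h1.eventually_ge_atTop (2 / ‖x‖)] with k h2 h3
  have h4 : (2 : ℝ) ≤ ((k : ℝ) + 1) * ‖x‖ := (div_le_iff₀ h0).1 h3
  rw [annulusFun, chi_eq_one, chi_eq_zero, sub_zero, mul_one]
  · rw [norm_smul, Real.norm_of_nonneg (by positivity)]
    nlinarith
  · rw [norm_smul, Real.norm_of_nonneg (by positivity)]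
    refine pow_le_one₀ (by positivity) ?_
    rw [inv_mul_eq_div]
    exact (div_le_one (by positivity)).2 h2

theorem hasCompactSupport_annulus (k : ℕ) (g : Rn n → ℂ) :
    HasCompactSupport fun x => (annulusFun k x : ℂ) * g x := by
  refine HasCompactSupport.of_support_subset_isCompact
    (isCompact_closedBall (0 : Rn n) (2 * ((k : ℝ) + 1))) fun x hx => ?_
  rw [mem_closedBall_zero_iff]
  by_contra h
  refine hx ?_
  simp [annulusFun_eq_zero_of_ge (not_le.1 h).le]

theorem annulus_eventuallyEq_zero (k : ℕ) (g : Rn n → ℂ) :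
    (fun x => (annulusFun k x : ℂ) * g x) =ᶠ[𝓝 0] 0 := by
  have : Metric.ball (0 : Rn n) ((k : ℝ) + 1)⁻¹ ∈ 𝓝 0 := Metric.ball_mem_nhds _ (by positivity)
  filter_upwards [this] with x hx
  have hk : (0 : ℝ) < k + 1 := by positivity
  rw [mem_ball_zero_iff, ← one_div, lt_div_iff₀ hk] at hx
  simp [annulusFun_eq_zero_of_le (x := x) (k := k) (by linarith)]

/-- A function that is smooth away from the origin, cut off to an annulus. -/
noncomputable def annulusMul (k : ℕ) (g : Rn n → ℂ) (hg : ∀ x, x ≠ 0 → ContDiffAt ℝ ∞ g x) :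
    𝓢(Rn n, ℂ) :=
  (hasCompactSupport_annulus k g).toSchwartzMap
    (contDiff_of_eventuallyEq_zero (annulus_eventuallyEq_zero k g) fun x hx =>
      (Complex.ofRealCLM.contDiff.comp (contDiff_annulusFun k)).contDiffAt.mul (hg x hx))

theorem annulusMul_apply (k : ℕ) (g : Rn n → ℂ) (hg : ∀ x, x ≠ 0 → ContDiffAt ℝ ∞ g x) (x : Rn n) :
    annulusMul k g hg x = (annulusFun k x : ℂ) * g x := rfl

theorem hasCompactSupport_annulusMul (k : ℕ) (g : Rn n → ℂ)
    (hg : ∀ x, x ≠ 0 → ContDiffAt ℝ ∞ g x) : HasCompactSupport (annulusMul k g hg) :=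
  hasCompactSupport_annulus k g

theorem zero_notMem_tsupport_annulusMul (k : ℕ) (g : Rn n → ℂ)
    (hg : ∀ x, x ≠ 0 → ContDiffAt ℝ ∞ g x) : (0 : Rn n) ∉ tsupport (annulusMul k g hg) :=
  notMem_tsupport_iff_eventuallyEq.2 (annulus_eventuallyEq_zero k g)

theorem contDiffAt_norm_rpow (r : ℝ) (x : Rn n) (hx : x ≠ 0) :
    ContDiffAt ℝ ∞ (fun x : Rn n => (((2 * Real.pi * ‖x‖) ^ r : ℝ) : ℂ)) x := by
  refine Complex.ofRealCLM.contDiff.contDiffAt.comp x ?_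
  refine ContDiffAt.rpow_const_of_ne (contDiffAt_const.mul (contDiffAt_norm ℝ hx)) ?_
  have : ‖x‖ ≠ 0 := norm_ne_zero_iff.2 hx
  positivity

/-- The symbol `|2πξ|^r`, cut off to an annulus. -/
noncomputable def annulus (k : ℕ) (r : ℝ) : 𝓢(Rn n, ℂ) :=
  annulusMul k (fun x => (((2 * Real.pi * ‖x‖) ^ r : ℝ) : ℂ)) (contDiffAt_norm_rpow r)

theorem annulus_apply (k : ℕ) (r : ℝ) (x : Rn n) :
    annulus k r x = (annulusFun k x : ℂ) * (((2 * Real.pi * ‖x‖) ^ r : ℝ) : ℂ) := rfl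

theorem annulus_zero_apply (k : ℕ) (x : Rn n) : annulus k 0 x = (annulusFun k x : ℂ) := by
  rw [annulus_apply, Real.rpow_zero]
  simp

theorem isRadial_annulus (k : ℕ) (r : ℝ) : IsRadial (annulus k r : 𝓢(Rn n, ℂ)) := by
  intro x y h
  rw [annulus_apply, annulus_apply, annulusFun_radial k h, h]

theorem tendsto_mulS_annulus [Nontrivial (Rn n)] (f : L2 n) :
    Tendsto (fun k => mulS (annulus k 0) f) atTop (𝓝 f) := by
  rw [tendsto_iff_norm_sub_tendsto_zero]
  have h0 : ∀ᵐ x : Rn n, x ≠ 0 := by simp [ae_iff]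
  have key : Tendsto (fun k : ℕ => ∫ x, ‖((annulusFun k x : ℝ) : ℂ) * f x - f x‖ ^ 2) atTop (𝓝 0) := by
    have := tendsto_integral_of_dominated_convergence (μ := (volume : Measure (Rn n)))
      (F := fun (k : ℕ) x => ‖((annulusFun k x : ℝ) : ℂ) * f x - f x‖ ^ 2) (f := fun _ => (0 : ℝ))
      (fun x => ‖f x‖ ^ 2) ?_ ?_ ?_ ?_
    · simpa using this
    · intro k
      have : Continuous fun x : Rn n => ((annulusFun k x : ℝ) : ℂ) :=
        Complex.continuous_ofReal.comp (contDiff_annulusFun k).continuous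
      exact ((this.aestronglyMeasurable.mul (Lp.aestronglyMeasurable f)).sub
        (Lp.aestronglyMeasurable f)).norm.pow 2
    · exact (memLp_two_iff_integrable_sq_norm (Lp.aestronglyMeasurable f)).1 (Lp.memLp f)
    · intro k
      refine Eventually.of_forall fun x => ?_
      rw [Real.norm_of_nonneg (by positivity)]
      gcongr
      have e : ((annulusFun k x : ℝ) : ℂ) * f x - f x = ((annulusFun k x - 1 : ℝ) : ℂ) * f x := by
        push_cast; ring
      rw [e, norm_mul, Complex.norm_real, Real.norm_eq_abs]
      refine mul_le_of_le_one_left (norm_nonneg _) ?_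
      rw [abs_le]
      constructor <;> linarith [annulusFun_nonneg k x, annulusFun_le_one k x]
    · filter_upwards [h0] with x hx
      refine tendsto_const_nhds.congr' ?_
      filter_upwards [eventually_annulusFun_eq_one hx] with k hk
      simp [hk]
  have e : ∀ k, ‖mulS (annulus k 0) f - f‖ =
      √(∫ x, ‖((annulusFun k x : ℝ) : ℂ) * f x - f x‖ ^ 2) := by
    intro k
    rw [← Real.sqrt_sq (norm_nonneg (mulS (annulus k 0) f - f)),
      ← inner_self_eq_norm_sq (𝕜 := ℂ), L2.inner_def]
    congr 1
    rw [← integral_re (L2.integrable_inner _ _)]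
    refine integral_congr_ae ?_
    filter_upwards [Lp.coeFn_sub (mulS (annulus k 0) f) f, coeFn_mulS (annulus k 0) f] with x h1 h2
    rw [h1, Pi.sub_apply, h2, annulus_zero_apply, inner_self_eq_norm_sq]
  simp only [e]
  rw [← Real.sqrt_zero]
  exact (Real.continuous_sqrt.tendsto 0).comp key

theorem norm_mulS_annulus_le (k : ℕ) (f : L2 n) : ‖mulS (annulus k 0) f‖ ≤ ‖f‖ := by
  refine Lp.norm_le_norm_of_ae_le ?_
  filter_upwards [coeFn_mulS (annulus k 0) f] with x hx
  rw [hx, annulus_zero_apply, norm_mul, Complex.norm_real, Real.norm_of_nonneg (annulusFun_nonneg k x)]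
  exact mul_le_of_le_one_left (norm_nonneg _) (annulusFun_le_one k x)

end SchwartzTools

/-! ### Symmetry and linearity of power relations -/

section Operators

variable {H : Type*} [NormedAddCommGroup H] [InnerProductSpace ℂ H] [CompleteSpace H]

theorem PowRel.inner_eq {R : H →L[ℂ] H} (h0 : 0 ≤ R) (h1 : R ≤ 1) {σ : ℝ} (hσ : 0 ≤ σ)
    {v g v' g' : H} (h : PowRel R σ v g) (h' : PowRel R σ v' g') :
    inner ℂ g v' = inner ℂ v g' := by
  obtain ⟨x, rfl, rfl⟩ := (exists_rpow_eq_iff h0 h1 hσ v g).2 h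
  obtain ⟨y, rfl, rfl⟩ := (exists_rpow_eq_iff h0 h1 hσ v' g').2 h'
  have c1 := continuousOn_rpow_id hσ
  have c2 := continuousOn_one_sub_rpow hσ
  rw [rpow_eq_cfc h0, one_sub_rpow_eq_cfc h0 h1 hσ, inner_cfc_left, inner_cfc_left,
    cfc_mul_apply h0 h1 c1 c2, cfc_mul_apply h0 h1 c2 c1]
  simp only [mul_comm]

theorem powGraph_sub {A : Set (H × H)} {R : H →L[ℂ] H} (hR : IsResolvent A R) {σ : ℝ}
    {v g v' g' : H} (h : (v, g) ∈ powGraph A σ) (h' : (v', g') ∈ powGraph A σ) :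
    (v - v', g - g') ∈ powGraph A σ := by
  rcases le_or_gt 0 σ with hσ | hσ
  · rw [hR.mem_powGraph_iff hσ] at *
    exact h.sub h'
  · rw [hR.mem_powGraph_iff_of_neg hσ] at *
    exact h.sub h'

end Operators

/-! ### Symbols of homogeneous distributions and powers of the Laplacian -/

section Symbols

variable {n : ℕ} {s : ℝ}

/-- Test functions vanishing near the origin are admissible for every `s` and determine the symbol
almost everywhere. Conversely, the integrand is `φ` times an `L²` function, so every Schwartz
function may be used. -/
theorem hasSymbol_toTD_iff [Nontrivial (Rn n)] (f h : L2 n) :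
    HasSymbol s (Lp.toTemperedDistribution f) h ↔
      fourierL2 n f =ᵐ[volume] fun ξ => (((2 * Real.pi * ‖ξ‖) ^ (-s) : ℝ) : ℂ) * h ξ := by
  constructor
  · intro hs
    have := ae_eq_zero_of_forall_schwartz
      (w := fun ξ => fourierL2 n f ξ - (((2 * Real.pi * ‖ξ‖) ^ (-s) : ℝ) : ℂ) * h ξ)
      (((L2.locallyIntegrable _).locallyIntegrableOn _).sub (locallyIntegrableOn_rpow_mul (-s) h))
      (by
        intro φ _ h2
        obtain ⟨h3, h4⟩ := hs φ (Or.inr (image_eq_zero_of_notMem_tsupport h2))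
        rw [fourier_toTD, toTD_apply] at h4
        have e : ∀ ξ, φ ξ * (fourierL2 n f ξ - (((2 * Real.pi * ‖ξ‖) ^ (-s) : ℝ) : ℂ) * h ξ) =
            φ ξ * fourierL2 n f ξ - (((2 * Real.pi * ‖ξ‖) ^ (-s) : ℝ) : ℂ) * h ξ * φ ξ :=
          fun ξ => by ring
        simp only [e]
        rw [integral_sub (integrable_schwartz_mul φ _) h3, h4, sub_self])
    filter_upwards [this] with ξ hξ
    exact sub_eq_zero.1 hξ
  · intro hf φ _
    have e : (fun ξ => φ ξ * fourierL2 n f ξ) =ᵐ[volume]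
        fun ξ => (((2 * Real.pi * ‖ξ‖) ^ (-s) : ℝ) : ℂ) * h ξ * φ ξ := by
      filter_upwards [hf] with ξ hξ
      rw [hξ, mul_comm]
    refine ⟨(integrable_schwartz_mul φ _).congr e, ?_⟩
    rw [fourier_toTD, toTD_apply]
    exact integral_congr_ae e

theorem HasSymbol.sub {u u' : 𝓢'(Rn n, ℂ)} {h h' : L2 n} (hu : HasSymbol s u h)
    (hu' : HasSymbol s u' h') : HasSymbol s (u - u') (h - h') := by
  intro φ hφ
  obtain ⟨h1, h2⟩ := hu φ hφ
  obtain ⟨h3, h4⟩ := hu' φ hφ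
  have e : (fun ξ => (((2 * Real.pi * ‖ξ‖) ^ (-s) : ℝ) : ℂ) * h ξ * φ ξ -
      (((2 * Real.pi * ‖ξ‖) ^ (-s) : ℝ) : ℂ) * h' ξ * φ ξ) =ᵐ[volume]
      fun ξ => (((2 * Real.pi * ‖ξ‖) ^ (-s) : ℝ) : ℂ) * (h - h') ξ * φ ξ := by
    filter_upwards [Lp.coeFn_sub h h'] with ξ hξ
    rw [hξ, Pi.sub_apply]
    ring
  refine ⟨(h1.sub h3).congr e, ?_⟩
  rw [← integral_congr_ae e, integral_sub h1 h3, ← h2, ← h4]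
  rfl

theorem HasSymbol.unique [Nontrivial (Rn n)] {u : 𝓢'(Rn n, ℂ)} {h h' : L2 n}
    (hu : HasSymbol s u h) (hu' : HasSymbol s u h') : h = h' := by
  have hd := hu.sub hu'
  rw [sub_self] at hd
  have h0 : ∀ᵐ x : Rn n, x ≠ 0 := by simp [ae_iff]
  have := ae_eq_zero_of_forall_schwartz (locallyIntegrableOn_rpow_mul (-s) (h - h')) (by
    intro φ _ h2
    have := (hd φ (Or.inr (image_eq_zero_of_notMem_tsupport h2))).2
    simp only [mul_comm (φ _)]
    rw [← this]
    rfl)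
  rw [← sub_eq_zero]
  refine Lp.ext ?_
  filter_upwards [this, h0, Lp.coeFn_zero ℂ 2 (volume : Measure (Rn n))] with ξ h1 h2 h3
  rw [h3]
  refine (mul_eq_zero.1 h1).resolve_left (Complex.ofReal_ne_zero.2 ?_)
  have : 0 < ‖ξ‖ := norm_pos_iff.2 h2
  positivity

theorem HasSymbol.homNorm_eq [Nontrivial (Rn n)] {u : 𝓢'(Rn n, ℂ)} {h : L2 n}
    (hu : HasSymbol s u h) : homNorm s u = ‖h‖ := by
  have : {r | ∃ h : L2 n, HasSymbol s u h ∧ r = ‖h‖} = {‖h‖} := by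
    ext r
    constructor
    · rintro ⟨h', hh', rfl⟩
      rw [hu.unique hh']
      rfl
    · rintro rfl
      exact ⟨h, hu, rfl⟩
  rw [homNorm, this, csInf_singleton]

/-- The space `Ḣ^s`, restricted to elements orthogonal to radial functions if `b` holds. -/
def homSpace (n : ℕ) (s : ℝ) (b : Prop) : Set 𝓢'(Rn n, ℂ) :=
  {u | u ∈ homSobolev n s ∧ (b → OrthRadial u)}

theorem orthRadial_toTD_iff {b : Prop} (f : L2 n) :
    (b → OrthRadial (Lp.toTemperedDistribution f)) ↔ f ∈ radialCompl n b := by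
  simp only [OrthRadial, toTD_apply]
  rfl

/-- Pairing `u` with the Fourier transform of a radial function supported in an annulus gives zero.
The power `r + s` in that function cancels the weight `|2πξ| ^ (-s)` of the symbol, and its
vanishing at the origin makes it admissible. -/
theorem mulS_annulus_mem_radialCompl {b : Prop} {u : 𝓢'(Rn n, ℂ)} {h : L2 n}
    (hu : HasSymbol s u h) (hb : b → OrthRadial u) (k : ℕ) (r : ℝ) :
    mulS (annulus k r) h ∈ radialCompl n b := by
  intro hb' φ hφ
  have hrad : IsRadial (smul𝓢 (annulus k (r + s)) φ) := (isRadial_annulus k _).smul𝓢 hφ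
  have h0 : smul𝓢 (annulus k (r + s)) φ 0 = 0 := by
    rw [smul𝓢_apply, annulus_apply, annulusFun_eq_zero_of_le (by simp)]
    simp
  have := (hu _ (Or.inr h0)).2
  rw [TemperedDistribution.fourier_apply, hb hb' _ hrad.fourier] at this
  rw [this]
  refine integral_congr_ae ?_
  filter_upwards [coeFn_mulS (annulus k r) h] with ξ hξ
  rw [hξ, smul𝓢_apply, annulus_apply, annulus_apply]
  -- The law of exponents can fail at zero base, but the cutoff vanishes there.
  rcases eq_or_ne ξ 0 with rfl | h1
  · rw [annulusFun_eq_zero_of_le (by simp)]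
    simp
  · have : 0 < 2 * Real.pi * ‖ξ‖ := by
      have : 0 < ‖ξ‖ := norm_pos_iff.2 h1
      positivity
    have e : (2 * Real.pi * ‖ξ‖) ^ r = (2 * Real.pi * ‖ξ‖) ^ (-s) * (2 * Real.pi * ‖ξ‖) ^ (r + s) := by
      rw [← Real.rpow_add this]
      congr 1
      ring
    rw [e]
    push_cast
    ring

/-- On an annulus every power of `|2πξ|` is bounded. Frequency-localized elements thus lie in `L²`,
and exponents can be shifted freely between them. -/
theorem fourierL2_symm_mulS_annulus (k : ℕ) (r t : ℝ) (h : L2 n) :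
    fourierL2 n ((fourierL2 n).symm (mulS (annulus k (r + t)) h)) =ᵐ[volume]
      fun ξ => (((2 * Real.pi * ‖ξ‖) ^ r : ℝ) : ℂ) * mulS (annulus k t) h ξ := by
  rw [LinearIsometryEquiv.apply_symm_apply]
  filter_upwards [coeFn_mulS (annulus k (r + t)) h, coeFn_mulS (annulus k t) h] with ξ h1 h2
  rw [h1, h2, annulus_apply, annulus_apply]
  rcases eq_or_ne ξ 0 with rfl | h3
  · rw [annulusFun_eq_zero_of_le (by simp)]
    simp
  · have : 0 < 2 * Real.pi * ‖ξ‖ := by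
      have : 0 < ‖ξ‖ := norm_pos_iff.2 h3
      positivity
    rw [Real.rpow_add this]
    push_cast
    ring

/-- `L²` approximants of a homogeneous distribution. -/
theorem exists_approx [Nontrivial (Rn n)] {b : Prop} {u : 𝓢'(Rn n, ℂ)} {h : L2 n}
    (hu : HasSymbol s u h) (hb : b → OrthRadial u) (k : ℕ) :
    ∃ f ∈ radialCompl n b, HasSymbol s (Lp.toTemperedDistribution f) (mulS (annulus k 0) h) := by
  refine ⟨(fourierL2 n).symm (mulS (annulus k (-s + 0)) h),
    fourierL2_symm_mem_radialCompl (mulS_annulus_mem_radialCompl hu hb k _), ?_⟩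
  rw [hasSymbol_toTD_iff]
  exact fourierL2_symm_mulS_annulus k (-s) 0 h

/-- For `s ≥ 0` the symbol is the Fourier transform of `(-Δ) ^ (s/2) f`; for `s ≤ 0`, treated next,
`f` is instead obtained from the inverse transform of `h` by a nonnegative power. -/
theorem hasSymbol_iff_powRel [Nontrivial (Rn n)] (hs : 0 ≤ s) (f h : L2 n) :
    HasSymbol s (Lp.toTemperedDistribution f) h ↔
      PowRel (freeResolvent n) (s / 2) f ((fourierL2 n).symm h) := by
  rw [hasSymbol_toTD_iff, powRel_freeResolvent_iff (by positivity),
    LinearIsometryEquiv.apply_symm_apply, mul_div_cancel₀ _ two_ne_zero]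
  have h0 : ∀ᵐ x : Rn n, x ≠ 0 := by simp [ae_iff]
  have key : ∀ᵐ ξ : Rn n, (fourierL2 n f ξ = (((2 * Real.pi * ‖ξ‖) ^ (-s) : ℝ) : ℂ) * h ξ ↔
      h ξ = (((2 * Real.pi * ‖ξ‖) ^ s : ℝ) : ℂ) * fourierL2 n f ξ) := by
    filter_upwards [h0] with ξ h3
    have hp : 0 < 2 * Real.pi * ‖ξ‖ := by
      have : 0 < ‖ξ‖ := norm_pos_iff.2 h3
      positivity
    have hne : (((2 * Real.pi * ‖ξ‖) ^ s : ℝ) : ℂ) ≠ 0 :=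
      Complex.ofReal_ne_zero.2 (Real.rpow_pos_of_pos hp s).ne'
    rw [Real.rpow_neg hp.le, Complex.ofReal_inv, eq_inv_mul_iff_mul_eq₀ hne, eq_comm]
  exact Filter.eventually_congr key

theorem hasSymbol_iff_powRel_of_nonpos [Nontrivial (Rn n)] (hs : s ≤ 0) (f h : L2 n) :
    HasSymbol s (Lp.toTemperedDistribution f) h ↔
      PowRel (freeResolvent n) (-(s / 2)) ((fourierL2 n).symm h) f := by
  rw [hasSymbol_toTD_iff, powRel_freeResolvent_iff (by linarith),
    LinearIsometryEquiv.apply_symm_apply, mul_neg, mul_div_cancel₀ _ two_ne_zero]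

end Symbols

/-! ### From comparable resolvents to the norm equivalence -/

section Comparison

variable {n : ℕ} {A : Set (L2 n × L2 n)} {R : L2 n →L[ℂ] L2 n} {b : Prop} {C s : ℝ}

/-- `P` and `-Δ` have comparable resolvents, the latter on functions orthogonal to radial functions
if `b` holds. -/
structure IsComparable (A : Set (L2 n × L2 n)) (R : L2 n →L[ℂ] L2 n) (b : Prop) (C : ℝ) : Prop where
  isResolvent : IsResolvent A R
  injective : Function.Injective R
  eq_zero : ∀ h, R h = h → h = 0
  one_le : 1 ≤ C
  le : ∀ ε > 0, ∀ h, (inner ℂ h (greenOp ε R h)).re ≤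
    C * (inner ℂ h (greenOp ε (freeResolvent n) h)).re
  -- The vector `v` is the orthogonal projection of `h`, characterized by its inner products.
  ge : ∀ ε > 0, ∀ h, ∀ v ∈ radialCompl n b, (∀ f ∈ radialCompl n b, inner ℂ v f = inner ℂ h f) →
    (inner ℂ v (greenOp ε (freeResolvent n) v)).re ≤ C * (inner ℂ h (greenOp ε R h)).re

/-- The upper bound on the resolvent of `P` holds on all of `L²`, so no projection is needed in this
direction. -/
theorem IsComparable.powRel_free (hc : IsComparable A R b C) {σ : ℝ} (hσ : 0 ≤ σ)
    (hσ1 : σ ≤ 1 / 2) {f g : L2 n} (hf : PowRel R σ f g) :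
    ∃ g', PowRel (freeResolvent n) σ f g' ∧ ‖g'‖ ≤ C * ‖g‖ :=
  PowRel.heinz (E := 1) freeResolvent_nonneg freeResolvent_le_one hc.isResolvent.1
    hc.isResolvent.2.1 freeResolvent_injective (fun _ _ => rfl) hc.one_le (fun ε hε h => hc.le ε hε h)
    hσ hσ1 hf rfl

/-- Here the Heinz inequality is used with `E` the orthogonal projection off the radial functions,
which fixes `f`. -/
theorem IsComparable.powRel (hc : IsComparable A R b C) {σ : ℝ} (hσ : 0 ≤ σ)
    (hσ1 : σ ≤ 1 / 2) {f g : L2 n} (hf : PowRel (freeResolvent n) σ f g)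
    (hfb : f ∈ radialCompl n b) : ∃ g', PowRel R σ f g' ∧ ‖g'‖ ≤ C * ‖g‖ := by
  have : CompleteSpace (radialCompl n b) := (isClosed_radialCompl b).completeSpace_coe
  refine PowRel.heinz (E := (radialCompl n b).starProjection) hc.isResolvent.1
    hc.isResolvent.2.1 freeResolvent_nonneg freeResolvent_le_one hc.injective
    (fun x y => Submodule.inner_starProjection_left_eq_right _ x y) hc.one_le
    (fun ε hε h => hc.ge ε hε h _ (Submodule.starProjection_apply_mem _ _) fun f hf => ?_)
    hσ hσ1 hf (Submodule.starProjection_eq_self_iff.2 hfb)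
  rw [Submodule.inner_starProjection_left_eq_right, Submodule.starProjection_eq_self_iff.2 hf]

/-- For `s ≥ 0` the Dirichlet form controls `P`. For `s < 0` the roles reverse: the dual of the
bound of `-Δ` by `P` supplies a preimage of `f`. -/
theorem IsComparable.powGraph_of_mem [Nontrivial (Rn n)] (hc : IsComparable A R b C)
    (hs : -1 ≤ s ∧ s ≤ 1) {f h : L2 n} (hf : HasSymbol s (Lp.toTemperedDistribution f) h)
    (hfb : f ∈ radialCompl n b) :
    ∃ v, (f, v) ∈ powGraph A (s / 2) ∧ ‖v‖ ≤ C * ‖h‖ := by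
  obtain ⟨hR0, hR1, -⟩ := hc.isResolvent
  rcases le_or_gt 0 s with hs0 | hs0
  · rw [hasSymbol_iff_powRel hs0] at hf
    obtain ⟨v, h1, h2⟩ := hc.powRel (by linarith) (by linarith) hf hfb
    refine ⟨v, (hc.isResolvent.mem_powGraph_iff (by linarith) _ _).2 h1, ?_⟩
    rwa [LinearIsometryEquiv.norm_map] at h2
  · rw [hasSymbol_iff_powRel_of_nonpos hs0.le] at hf
    obtain ⟨v, h1, h2⟩ := PowRel.exists_inverse hR0 hR1 freeResolvent_nonneg freeResolvent_le_one
      hc.eq_zero (by linarith : 0 ≤ -(s / 2)) (by linarith) (zero_le_one.trans hc.one_le)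
      (fun v g h => hc.powRel_free (by linarith) (by linarith) h) hf
    refine ⟨v, (hc.isResolvent.mem_powGraph_iff_of_neg (by linarith) _ _).2 h1, ?_⟩
    rwa [LinearIsometryEquiv.norm_map] at h2

theorem IsComparable.norm_le [Nontrivial (Rn n)] (hc : IsComparable A R b C)
    (hs : -1 ≤ s ∧ s ≤ 1) {f h v : L2 n} (hf : HasSymbol s (Lp.toTemperedDistribution f) h)
    (hfb : f ∈ radialCompl n b) (hv : (f, v) ∈ powGraph A (s / 2)) : ‖v‖ ≤ C * ‖h‖ := by
  obtain ⟨hR0, hR1, -⟩ := hc.isResolvent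
  obtain ⟨v', h1, h2⟩ := hc.powGraph_of_mem hs hf hfb
  have : v = v' := by
    rcases le_or_gt 0 s with hs0 | hs0
    · rw [hc.isResolvent.mem_powGraph_iff (by linarith)] at h1 hv
      exact hv.eq hR0 hR1 hc.injective (by linarith) (by linarith) h1
    · rw [hc.isResolvent.mem_powGraph_iff_of_neg (by linarith)] at h1 hv
      exact hv.eq_left hR0 hR1 hc.eq_zero (by linarith) (by linarith) h1
  rw [this]
  exact h2

theorem IsComparable.norm_ge [Nontrivial (Rn n)] (hc : IsComparable A R b C)
    (hs : -1 ≤ s ∧ s ≤ 1) {f h v : L2 n} (hf : HasSymbol s (Lp.toTemperedDistribution f) h)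
    (hfb : f ∈ radialCompl n b) (hv : (f, v) ∈ powGraph A (s / 2)) : ‖h‖ ≤ C * ‖v‖ := by
  obtain ⟨hR0, hR1, -⟩ := hc.isResolvent
  rcases le_or_gt 0 s with hs0 | hs0
  · rw [hasSymbol_iff_powRel hs0] at hf
    rw [hc.isResolvent.mem_powGraph_iff (by linarith)] at hv
    obtain ⟨g', h1, h2⟩ := hc.powRel_free (by linarith) (by linarith) hv
    rw [← LinearIsometryEquiv.norm_map (fourierL2 n).symm h,
      hf.eq freeResolvent_nonneg freeResolvent_le_one freeResolvent_injective (by linarith)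
        (by linarith) h1]
    exact h2
  · have hp := (hasSymbol_iff_powRel_of_nonpos hs0.le f h).1 hf
    rw [hc.isResolvent.mem_powGraph_iff_of_neg (by linarith)] at hv
    have hσ : 0 ≤ -(s / 2) := by linarith
    -- Put `σ = -s/2` and let `g` be the inverse transform of `|2πξ| ^ s h` cut off in frequency.
    -- Then `⟪h, (cut-off h)⟫ = ⟪f, g⟫ = ⟪v, P ^ σ g⟫`, and the bound for the positive power of `P`
    -- applies to `g`.
    have key : ∀ k : ℕ, ‖inner ℂ h (mulS (annulus k 0) h)‖ ≤ ‖v‖ * (C * ‖h‖) := by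
      intro k
      have hg : PowRel (freeResolvent n) (-(s / 2)) ((fourierL2 n).symm (mulS (annulus k s) h))
          ((fourierL2 n).symm (mulS (annulus k 0) h)) := by
        rw [powRel_freeResolvent_iff hσ]
        have := fourierL2_symm_mulS_annulus k (-s) s h
        rw [neg_add_cancel] at this
        simpa [mul_div_cancel₀] using this
      obtain ⟨g', h1, h2⟩ := hc.powRel hσ (by linarith) hg (fourierL2_symm_mem_radialCompl
        (mulS_annulus_mem_radialCompl hf ((orthRadial_toTD_iff f).2 hfb) k s))
      have e1 := hp.inner_eq freeResolvent_nonneg freeResolvent_le_one hσ hg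
      have e2 := hv.inner_eq hR0 hR1 hσ h1
      rw [LinearIsometryEquiv.inner_map_map] at e1
      rw [← e1, e2]
      refine (norm_inner_le_norm _ _).trans ?_
      gcongr
      refine h2.trans ?_
      rw [LinearIsometryEquiv.norm_map]
      exact mul_le_mul_of_nonneg_left (norm_mulS_annulus_le k h) (zero_le_one.trans hc.one_le)
    have lim : Tendsto (fun k => ‖inner ℂ h (mulS (annulus k 0) h)‖) atTop (𝓝 ‖inner ℂ h h‖) :=
      (tendsto_const_nhds.inner (tendsto_mulS_annulus h)).norm
    have h3 := le_of_tendsto' lim key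
    rw [inner_self_eq_norm_sq_to_K, norm_pow, RCLike.norm_ofReal, abs_norm] at h3
    rcases (norm_nonneg h).eq_or_lt with h4 | h4
    · rw [← h4]
      have := hc.one_le
      positivity
    · refine le_of_mul_le_mul_right ?_ h4
      nlinarith

/-- The extension by continuity. -/
theorem IsComparable.main [Nontrivial (Rn n)] {a : ℝ} (hc : IsComparable (Pgraph n a) R b C)
    (hs : -1 ≤ s ∧ s ≤ 1) {X : Set 𝓢'(Rn n, ℂ)} (hX : X = homSpace n s b) (u : 𝓢'(Rn n, ℂ))
    (hu : u ∈ X) :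
    (∃! g : L2 n, IsPow n a s X u g) ∧
    (∀ g : L2 n, IsPow n a s X u g → C⁻¹ * homNorm s u ≤ ‖g‖ ∧ ‖g‖ ≤ C * homNorm s u) ∧
    (∀ f : L2 n, Lp.toTemperedDistribution f = u →
      ∃ g : L2 n, (f, g) ∈ powGraph (Pgraph n a) (s / 2)) := by
  have hC : 0 < C := zero_lt_one.trans_le hc.one_le
  subst hX
  obtain ⟨⟨h, hh⟩, hb⟩ := hu
  -- symbols of approximating sequences
  have hseq : ∀ g, IsPow n a s (homSpace n s b) u g → ∃ f v hk : ℕ → L2 n,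
      (∀ k, (f k, v k) ∈ powGraph (Pgraph n a) (s / 2)) ∧ (∀ k, f k ∈ radialCompl n b) ∧
      (∀ k, HasSymbol s (Lp.toTemperedDistribution (f k)) (hk k)) ∧ Tendsto hk atTop (𝓝 h) ∧
      Tendsto v atTop (𝓝 g) := by
    rintro g ⟨-, f, v, h1, h2, -, h4, h5⟩
    choose hk hhk using fun k => (h2 k).1
    refine ⟨f, v, hk, h1, fun k => (orthRadial_toTD_iff _).1 (h2 k).2, hhk, ?_, h5⟩
    rw [tendsto_iff_norm_sub_tendsto_zero]
    refine h4.congr fun k => ((hhk k).sub hh).homNorm_eq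
  have hbound : ∀ g, IsPow n a s (homSpace n s b) u g → ‖h‖ ≤ C * ‖g‖ ∧ ‖g‖ ≤ C * ‖h‖ := by
    intro g hg
    obtain ⟨f, v, hk, h1, h2, h3, h4, h5⟩ := hseq g hg
    exact ⟨le_of_tendsto_of_tendsto' h4.norm (h5.norm.const_mul C)
        fun k => hc.norm_ge hs (h3 k) (h2 k) (h1 k),
      le_of_tendsto_of_tendsto' h5.norm (h4.norm.const_mul C)
        fun k => hc.norm_le hs (h3 k) (h2 k) (h1 k)⟩
  -- This Lipschitz bound yields both the convergence of the images and their independence of the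
  -- approximating sequence.
  have hdiff : ∀ {f v h f' v' h' : L2 n}, (f, v) ∈ powGraph (Pgraph n a) (s / 2) →
      (f', v') ∈ powGraph (Pgraph n a) (s / 2) → f ∈ radialCompl n b → f' ∈ radialCompl n b →
      HasSymbol s (Lp.toTemperedDistribution f) h → HasSymbol s (Lp.toTemperedDistribution f') h' →
      ‖v - v'‖ ≤ C * ‖h - h'‖ := by
    intro f v h f' v' h' h1 h2 h3 h4 h5 h6
    refine hc.norm_le hs (f := f - f') ?_ (sub_mem h3 h4) (powGraph_sub hc.isResolvent h1 h2)
    rw [toTD_sub]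
    exact h5.sub h6
  refine ⟨?_, ?_, ?_⟩
  -- The approximants are frequency cutoffs of `u` to growing annuli; their symbols converge to `h`
  -- in `L²`.
  · choose f hf1 hf2 using exists_approx (s := s) hh hb
    choose v hv1 hv2 using fun k => hc.powGraph_of_mem hs (hf2 k) (hf1 k)
    have hlim := tendsto_mulS_annulus h
    have hcau : CauchySeq v := by
      rw [Metric.cauchySeq_iff']
      intro ε hε
      obtain ⟨N, hN⟩ := Metric.cauchySeq_iff'.1 hlim.cauchySeq (ε / C) (by positivity)
      refine ⟨N, fun k hk => ?_⟩
      rw [dist_eq_norm]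
      refine (hdiff (hv1 k) (hv1 N) (hf1 k) (hf1 N) (hf2 k) (hf2 N)).trans_lt ?_
      rw [← dist_eq_norm, ← lt_div_iff₀' hC]
      exact hN k hk
    obtain ⟨g, hg⟩ := cauchySeq_tendsto_of_complete hcau
    refine ⟨g, ⟨⟨⟨h, hh⟩, hb⟩, f, v, hv1, fun k => ⟨⟨_, hf2 k⟩, (orthRadial_toTD_iff _).2 (hf1 k)⟩,
      fun k => ⟨⟨_, (hf2 k).sub hh⟩, fun hb' φ hφ => ?_⟩, ?_, hg⟩, ?_⟩
    · have e1 := (orthRadial_toTD_iff _).2 (hf1 k) hb' φ hφ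
      have e2 := hb hb' φ hφ
      change Lp.toTemperedDistribution (f k) φ - u φ = 0
      rw [e1, e2, sub_zero]
    · have := tendsto_iff_norm_sub_tendsto_zero.1 hlim
      exact this.congr fun k => ((hf2 k).sub hh).homNorm_eq.symm
    · intro g' hg'
      obtain ⟨f', v', hk', h1, h2, h3, h4, h5⟩ := hseq g' hg'
      have e1 : Tendsto (fun k => C * ‖hk' k - mulS (annulus k 0) h‖) atTop (𝓝 0) := by
        have := ((h4.sub hlim).norm).const_mul C
        simpa using this
      have e2 : Tendsto (fun k => ‖v' k - v k‖) atTop (𝓝 ‖g' - g‖) := (h5.sub hg).norm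
      have := le_of_tendsto_of_tendsto' e2 e1 fun k =>
        hdiff (h1 k) (hv1 k) (h2 k) (hf1 k) (h3 k) (hf2 k)
      exact sub_eq_zero.1 (norm_le_zero_iff.1 this)
  · intro g hg
    rw [hh.homNorm_eq]
    obtain ⟨h1, h2⟩ := hbound g hg
    exact ⟨(inv_mul_le_iff₀ hC).2 h1, h2⟩
  · rintro f rfl
    obtain ⟨v, hv, -⟩ := hc.powGraph_of_mem hs hh ((orthRadial_toTD_iff f).1 hb)
    exact ⟨v, hv⟩

end Comparison

section Operators

variable {H : Type*} [NormedAddCommGroup H] [InnerProductSpace ℂ H] [CompleteSpace H]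

/-- The Cauchy–Schwarz inequality for `(A + ε)⁻¹`. -/
theorem norm_inner_greenOp_sq_le {R : H →L[ℂ] H} (h0 : 0 ≤ R) (h1 : R ≤ 1) {ε : ℝ} (hε : 0 < ε)
    (x y : H) : ‖inner ℂ x (greenOp ε R y)‖ ^ 2 ≤
      (inner ℂ x (greenOp ε R x)).re * (inner ℂ y (greenOp ε R y)).re := by
  have c : ContinuousOn (fun x => √(green ε x)) (Set.Icc 0 1) :=
    Real.continuous_sqrt.comp_continuousOn (continuousOn_green hε)
  have e2 : ∀ z : H, (inner ℂ z (greenOp ε R z)).re = ‖cfc (fun x => √(green ε x)) R z‖ ^ 2 := by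
    intro z
    rw [norm_cfc_sq h0 h1 c, greenOp, cfc_congr_Icc h0 h1 (f := fun x => √(green ε x) ^ 2)]
    exact fun t ht => Real.sq_sqrt (green_nonneg hε ht)
  have e1 : greenOp ε R y = cfc (fun x => √(green ε x)) R (cfc (fun x => √(green ε x)) R y) := by
    rw [cfc_mul_apply h0 h1 c c, greenOp, cfc_congr_Icc h0 h1 (f := fun x => √(green ε x) * _)]
    exact fun t ht => Real.mul_self_sqrt (green_nonneg hε ht)
  rw [e2, e2, e1, ← inner_cfc_left, ← mul_pow]
  exact pow_le_pow_left₀ (norm_nonneg _) (norm_inner_le_norm _ _) 2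

theorem greenOp_nonneg {R : H →L[ℂ] H} (h0 : 0 ≤ R) (h1 : R ≤ 1) {ε : ℝ} (hε : 0 < ε)
    (x : H) : 0 ≤ (inner ℂ x (greenOp ε R x)).re :=
  ((ContinuousLinearMap.nonneg_iff_isPositive _).1
    (cfc_green_nonneg h0 h1 hε)).re_inner_nonneg_right x

end Operators

/-! ### The Dirichlet form on Schwartz functions -/

section Forms

open Laplacian LineDeriv

variable {n : ℕ}

/-- Partial derivatives of Schwartz functions. -/
noncomputable def pd (i : Fin n) (w : 𝓢(Rn n, ℂ)) : 𝓢(Rn n, ℂ) :=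
  ∂_{EuclideanSpace.basisFun (Fin n) ℝ i} w

theorem pd_apply (i : Fin n) (w : 𝓢(Rn n, ℂ)) (x : Rn n) :
    pd i w x = fderiv ℝ w x (EuclideanSpace.basisFun (Fin n) ℝ i) := rfl

theorem laplacian_eq_sum_pd (w : 𝓢(Rn n, ℂ)) : Δ w = ∑ i, pd i (pd i w) :=
  SchwartzMap.laplacian_eq_sum _ _

/-- The sesquilinear map `(u, v) ↦ conj u * v`. -/
noncomputable def conjMul : ℂ →L[ℝ] ℂ →L[ℝ] ℂ :=
  (ContinuousLinearMap.mul ℝ ℂ).comp (Complex.conjCLE : ℂ →L[ℝ] ℂ)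

theorem integral_conj_pd (i : Fin n) (f g : 𝓢(Rn n, ℂ)) :
    ∫ x, (starRingEnd ℂ) (f x) * pd i g x = -∫ x, (starRingEnd ℂ) (pd i f x) * g x :=
  SchwartzMap.integral_bilinear_lineDerivOp_right_eq_neg_left f g conjMul _

theorem integral_conj_laplacian (f g : 𝓢(Rn n, ℂ)) :
    ∫ x, (starRingEnd ℂ) (f x) * (Δ g) x = ∫ x, (starRingEnd ℂ) ((Δ f) x) * g x :=
  SchwartzMap.integral_bilinear_laplacian_right_eq_left f g conjMul

theorem integrable_conj_mul (f g : 𝓢(Rn n, ℂ)) :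
    Integrable fun x => (starRingEnd ℂ) (f x) * g x :=
  (SchwartzMap.pairing conjMul f g).integrable

theorem integrable_norm_sq (f : 𝓢(Rn n, ℂ)) : Integrable fun x => ‖f x‖ ^ 2 := by
  refine (integrable_conj_mul f f).norm.congr (Eventually.of_forall fun x => ?_)
  simp [sq]

/-- The Dirichlet form `∫ |∇w|²`. -/
noncomputable def dirichlet (w : 𝓢(Rn n, ℂ)) : ℝ := ∫ x, ∑ i, ‖pd i w x‖ ^ 2

theorem integrable_gradSq (w : 𝓢(Rn n, ℂ)) : Integrable fun x => ∑ i, ‖pd i w x‖ ^ 2 :=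
  integrable_finsetSum _ fun i _ => integrable_norm_sq (pd i w)

theorem dirichlet_nonneg (w : 𝓢(Rn n, ℂ)) : 0 ≤ dirichlet w :=
  integral_nonneg fun _ => by positivity

/-- The class in `L²` of a Schwartz function. -/
noncomputable def toL2 (f : 𝓢(Rn n, ℂ)) : L2 n := f.toLp 2

theorem coeFn_toL2 (f : 𝓢(Rn n, ℂ)) : toL2 f =ᵐ[volume] f := f.coeFn_toLp 2 volume

theorem fourierL2_toL2 (f : 𝓢(Rn n, ℂ)) : fourierL2 n (toL2 f) = toL2 (𝓕 f) := fourierL2_toLp f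

theorem inner_toLp (f g : 𝓢(Rn n, ℂ)) :
    inner ℂ (toL2 f) (toL2 g) = ∫ x, (starRingEnd ℂ) (f x) * g x := by
  rw [L2.inner_eq_integral]
  refine integral_congr_ae ?_
  filter_upwards [coeFn_toL2 f, coeFn_toL2 g] with x h1 h2
  rw [h1, h2]

theorem toLp_add (f g : 𝓢(Rn n, ℂ)) : toL2 (f + g) = toL2 f + toL2 g :=
  map_add (SchwartzMap.toLpCLM ℂ ℂ 2 (volume : Measure (Rn n))) f g

theorem toLp_smul (c : ℂ) (f : 𝓢(Rn n, ℂ)) : toL2 (c • f) = c • (toL2 f) :=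
  map_smul (SchwartzMap.toLpCLM ℂ ℂ 2 (volume : Measure (Rn n))) c f

theorem inner_neg_laplacian_self (w : 𝓢(Rn n, ℂ)) :
    inner ℂ (toL2 (-(Δ w))) (toL2 w) = dirichlet w := by
  rw [inner_toLp, dirichlet, ← integral_complex_ofReal]
  have e : ∀ x, (starRingEnd ℂ) ((-(Δ w)) x) * w x =
      -∑ i, (starRingEnd ℂ) (pd i (pd i w) x) * w x := by
    intro x
    rw [laplacian_eq_sum_pd, _root_.neg_apply, _root_.sum_apply, map_neg, map_sum,
      neg_mul, Finset.sum_mul]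
  simp only [e]
  rw [integral_neg, integral_finsetSum _ fun i _ => integrable_conj_mul _ _,
    ← Finset.sum_neg_distrib]
  simp only [← integral_conj_pd]
  rw [← integral_finsetSum _ fun i _ => integrable_conj_mul _ _]
  congr 1
  ext x
  rw [Complex.ofReal_sum]
  refine Finset.sum_congr rfl fun i _ => ?_
  rw [← Complex.normSq_eq_conj_mul_self, Complex.normSq_eq_norm_sq]

theorem fourier_neg_laplacian (w : 𝓢(Rn n, ℂ)) (ξ : Rn n) :
    𝓕 (-(Δ w)) ξ = (((2 * Real.pi * ‖ξ‖) ^ 2 : ℝ) : ℂ) * 𝓕 w ξ := by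
  have hg : (fun x : Rn n => ‖x‖ ^ 2).HasTemperateGrowth := by fun_prop
  rw [SchwartzMap.laplacian_eq_fourierMultiplierCLM, SchwartzMap.fourierMultiplierCLM_apply,
    ← neg_smul, neg_neg, FourierTransform.fourier_smul, fourier_fourierInv_eq]
  change ((2 * Real.pi) ^ 2) • (SchwartzMap.smulLeftCLM ℂ (fun x : Rn n => ‖x‖ ^ 2) (𝓕 w)) ξ = _
  rw [SchwartzMap.smulLeftCLM_apply_apply hg, smul_smul, Complex.real_smul, ← mul_pow]

theorem greenOp_freeResolvent_laplacian {ε : ℝ} (hε : 0 < ε) (w : 𝓢(Rn n, ℂ)) :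
    greenOp ε (freeResolvent n) (toL2 (-(Δ w)) + (ε : ℂ) • toL2 w) = toL2 w := by
  refine fourierL2_ext ?_
  refine (fourierL2_greenOp hε _).trans ?_
  rw [map_add, map_smul, fourierL2_toL2, fourierL2_toL2]
  filter_upwards [Lp.coeFn_add (toL2 (𝓕 (-(Δ w)))) ((ε : ℂ) • toL2 (𝓕 w)),
    Lp.coeFn_smul (ε : ℂ) (toL2 (𝓕 w)), coeFn_toL2 (𝓕 w),
    coeFn_toL2 (𝓕 (-(Δ w)))] with ξ h1 h2 h3 h4
  rw [h1, Pi.add_apply, h2, Pi.smul_apply, h3, h4, fourier_neg_laplacian, smul_eq_mul, ← add_mul,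
    ← mul_assoc, ← Complex.ofReal_add, ← Complex.ofReal_mul, inv_mul_cancel₀ (by positivity)]
  simp

/-- Cauchy–Schwarz for `(-Δ + ε)⁻¹` between `h` and `(-Δ + ε) w`. All Schwartz functions are
allowed, in particular those not vanishing near the origin. -/
theorem norm_inner_toLp_sq_le {ε : ℝ} (hε : 0 < ε) (h : L2 n) (w : 𝓢(Rn n, ℂ)) :
    ‖inner ℂ h (toL2 w)‖ ^ 2 ≤ (inner ℂ h (greenOp ε (freeResolvent n) h)).re *
      (dirichlet w + ε * ‖(toL2 w)‖ ^ 2) := by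
  have e := greenOp_freeResolvent_laplacian hε w
  have := norm_inner_greenOp_sq_le freeResolvent_nonneg freeResolvent_le_one hε h
    (toL2 (-(Δ w)) + (ε : ℂ) • toL2 w)
  rw [e, inner_add_left, inner_neg_laplacian_self, inner_smul_left, inner_self_eq_norm_sq_to_K] at this
  refine this.trans (le_of_eq ?_)
  congr 1
  rw [Complex.conj_ofReal, Complex.add_re, Complex.ofReal_re, Complex.re_ofReal_mul]
  norm_cast

end Forms

/-! ### Test functions away from the origin, Hardy's inequality and the minimal operator -/

section TestFunctions

open Laplacian LineDeriv

variable {n : ℕ}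

/-- Test functions supported away from the origin. -/
structure IsTest (w : 𝓢(Rn n, ℂ)) : Prop where
  hasCompactSupport : HasCompactSupport w
  zero_notMem : (0 : Rn n) ∉ tsupport w

theorem IsTest.eventuallyEq_zero {w : 𝓢(Rn n, ℂ)} (hw : IsTest w) : (w : Rn n → ℂ) =ᶠ[𝓝 0] 0 :=
  notMem_tsupport_iff_eventuallyEq.1 hw.zero_notMem

theorem IsTest.add {w z : 𝓢(Rn n, ℂ)} (hw : IsTest w) (hz : IsTest z) : IsTest (w + z) :=
  ⟨hw.hasCompactSupport.add hz.hasCompactSupport, notMem_tsupport_iff_eventuallyEq.2 (by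
    filter_upwards [hw.eventuallyEq_zero, hz.eventuallyEq_zero] with x h1 h2
    change w x + z x = 0
    rw [h1, h2]
    simp)⟩

theorem IsTest.smul {w : 𝓢(Rn n, ℂ)} (hw : IsTest w) (c : ℂ) : IsTest (c • w) :=
  ⟨hw.hasCompactSupport.smul_left (f := fun _ => c), notMem_tsupport_iff_eventuallyEq.2 (by
    filter_upwards [hw.eventuallyEq_zero] with x h1
    change c * w x = 0
    rw [h1]
    simp)⟩

theorem isTest_zero : IsTest (0 : 𝓢(Rn n, ℂ)) :=
  ⟨HasCompactSupport.zero, notMem_tsupport_iff_eventuallyEq.2 EventuallyEq.rfl⟩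

theorem isTest_annulusMul (k : ℕ) (g : Rn n → ℂ) (hg : ∀ x, x ≠ 0 → ContDiffAt ℝ ∞ g x) :
    IsTest (annulusMul k g hg) :=
  ⟨hasCompactSupport_annulusMul k g hg, zero_notMem_tsupport_annulusMul k g hg⟩

/-- The product of a test function with a function that is smooth away from the origin. -/
noncomputable def awayMul (g : Rn n → ℂ) (hg : ∀ x, x ≠ 0 → ContDiffAt ℝ ∞ g x) (w : 𝓢(Rn n, ℂ))
    (hw : IsTest w) : 𝓢(Rn n, ℂ) :=
  (hw.hasCompactSupport.mul_left (f := g)).toSchwartzMap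
    (contDiff_of_eventuallyEq_zero (by
      filter_upwards [hw.eventuallyEq_zero] with x hx
      rw [Pi.mul_apply, hx]
      simp) fun x hx => (hg x hx).mul (w.smooth ⊤).contDiffAt)

theorem contDiffAt_inv_norm_sq (x : Rn n) (hx : x ≠ 0) :
    ContDiffAt ℝ ∞ (fun x : Rn n => (((‖x‖ ^ 2)⁻¹ : ℝ) : ℂ)) x :=
  Complex.ofRealCLM.contDiff.contDiffAt.comp x
    ((contDiff_norm_sq ℝ).contDiffAt.inv (pow_ne_zero 2 (norm_ne_zero_iff.2 hx)))

theorem contDiffAt_radial_field (i : Fin n) (x : Rn n) (hx : x ≠ 0) :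
    ContDiffAt ℝ ∞ (fun x : Rn n => ((x i * (‖x‖ ^ 2)⁻¹ : ℝ) : ℂ)) x :=
  Complex.ofRealCLM.contDiff.contDiffAt.comp x
    ((EuclideanSpace.proj (𝕜 := ℝ) i).contDiff.contDiffAt.mul
      ((contDiff_norm_sq ℝ).contDiffAt.inv (pow_ne_zero 2 (norm_ne_zero_iff.2 hx))))

/-- `w / |x|²` for a test function `w`. -/
noncomputable def divSq (w : 𝓢(Rn n, ℂ)) (hw : IsTest w) : 𝓢(Rn n, ℂ) :=
  awayMul _ contDiffAt_inv_norm_sq w hw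

theorem divSq_apply (w : 𝓢(Rn n, ℂ)) (hw : IsTest w) (x : Rn n) :
    divSq w hw x = (((‖x‖ ^ 2)⁻¹ : ℝ) : ℂ) * w x := rfl

/-- The form `∫ |w|² / |x|²`. -/
noncomputable def hardyForm (w : 𝓢(Rn n, ℂ)) : ℝ := ∫ x, (‖x‖ ^ 2)⁻¹ * ‖w x‖ ^ 2

theorem hardyForm_nonneg (w : 𝓢(Rn n, ℂ)) : 0 ≤ hardyForm w :=
  integral_nonneg fun _ => by positivity

theorem integrable_real_inner (f g : 𝓢(Rn n, ℂ)) : Integrable fun x => inner ℝ (f x) (g x) :=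
  (SchwartzMap.pairing (innerSL ℝ : ℂ →L[ℝ] ℂ →L[ℝ] ℝ) f g).integrable

theorem IsTest.integrable_hardy {w : 𝓢(Rn n, ℂ)} (hw : IsTest w) :
    Integrable fun x => (‖x‖ ^ 2)⁻¹ * ‖w x‖ ^ 2 := by
  refine (integrable_real_inner w (divSq w hw)).congr (Eventually.of_forall fun x => ?_)
  change inner ℝ (w x) (divSq w hw x) = _
  rw [divSq_apply, ← Complex.real_smul, real_inner_smul_right, real_inner_self_eq_norm_sq]

theorem integral_real_inner_pd (i : Fin n) (f g : 𝓢(Rn n, ℂ)) :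
    ∫ x, inner ℝ (f x) (pd i g x) = -∫ x, inner ℝ (pd i f x) (g x) :=
  SchwartzMap.integral_bilinear_lineDerivOp_right_eq_neg_left f g
    (innerSL ℝ : ℂ →L[ℝ] ℂ →L[ℝ] ℝ) _

/-- `x_i w / |x|²` for a test function `w`. -/
noncomputable def radMul (i : Fin n) (w : 𝓢(Rn n, ℂ)) (hw : IsTest w) : 𝓢(Rn n, ℂ) :=
  awayMul _ (contDiffAt_radial_field i) w hw

theorem radMul_apply (i : Fin n) (w : 𝓢(Rn n, ℂ)) (hw : IsTest w) (x : Rn n) :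
    radMul i w hw x = (x i * (‖x‖ ^ 2)⁻¹ : ℝ) • w x := by
  rw [Complex.real_smul]
  rfl

theorem pd_radMul (i : Fin n) (w : 𝓢(Rn n, ℂ)) (hw : IsTest w) {x : Rn n} (hx : x ≠ 0) :
    pd i (radMul i w hw) x = ((‖x‖ ^ 2)⁻¹ - 2 * x i ^ 2 * ((‖x‖ ^ 2)⁻¹) ^ 2 : ℝ) • w x +
      (x i * (‖x‖ ^ 2)⁻¹ : ℝ) • pd i w x := by
  have h0 : ‖x‖ ^ 2 ≠ 0 := pow_ne_zero 2 (norm_ne_zero_iff.2 hx)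
  have h1 : HasFDerivAt (fun x : Rn n => ‖x‖ ^ 2) (2 • innerSL ℝ x) x :=
    (hasStrictFDerivAt_norm_sq x).hasFDerivAt
  have h2 := (hasDerivAt_inv h0).comp_hasFDerivAt x h1
  have h3 : HasFDerivAt (fun x : Rn n => x i) (EuclideanSpace.proj (𝕜 := ℝ) i) x :=
    (EuclideanSpace.proj (𝕜 := ℝ) i).hasFDerivAt
  have h4 := (h3.mul h2).smul (w.hasFDerivAt x)
  have e : (radMul i w hw : Rn n → ℂ) = fun x => (x i * (‖x‖ ^ 2)⁻¹ : ℝ) • w x :=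
    funext fun x => radMul_apply i w hw x
  rw [pd_apply, e]
  have h5 : HasFDerivAt (fun x : Rn n => (x i * (‖x‖ ^ 2)⁻¹ : ℝ) • w x) _ x := h4
  rw [h5.fderiv, pd_apply, add_comm]
  simp only [EuclideanSpace.basisFun_apply]
  simp [EuclideanSpace.inner_single_right]
  left
  field_simp
  ring

/-- The divergence of the field `x / |x|²` is `(n - 2) / |x|²`. -/
theorem sum_inner_pd_radMul (w : 𝓢(Rn n, ℂ)) (hw : IsTest w) {x : Rn n} (hx : x ≠ 0) :
    ∑ i, inner ℝ (pd i (radMul i w hw) x) (w x) = ((n : ℝ) - 2) * ((‖x‖ ^ 2)⁻¹ * ‖w x‖ ^ 2) +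
      ∑ i, inner ℝ (radMul i w hw x) (pd i w x) := by
  have h0 : ‖x‖ ^ 2 ≠ 0 := pow_ne_zero 2 (norm_ne_zero_iff.2 hx)
  have e : ∀ i, inner ℝ (pd i (radMul i w hw) x) (w x) =
      (‖x‖ ^ 2)⁻¹ * ‖w x‖ ^ 2 - 2 * ((‖x‖ ^ 2)⁻¹) ^ 2 * ‖w x‖ ^ 2 * x i ^ 2 +
        inner ℝ (radMul i w hw x) (pd i w x) := by
    intro i
    rw [pd_radMul i w hw hx, radMul_apply, inner_add_left, real_inner_smul_left,
      real_inner_smul_left, real_inner_smul_left, real_inner_self_eq_norm_sq,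
      real_inner_comm (w x)]
    ring
  rw [Finset.sum_congr rfl fun i _ => e i, Finset.sum_add_distrib, Finset.sum_sub_distrib,
    Finset.sum_const, ← Finset.mul_sum, ← EuclideanSpace.real_norm_sq_eq]
  simp only [Finset.card_univ, Fintype.card_fin, nsmul_eq_mul]
  field_simp

/-- Integration by parts turns the integral into minus itself minus `(n - 2)` times the Hardy form.
-/
theorem integral_inner_radMul [Nontrivial (Rn n)] (w : 𝓢(Rn n, ℂ)) (hw : IsTest w) :
    ∫ x, ∑ i, inner ℝ (radMul i w hw x) (pd i w x) = -(((n : ℝ) - 2) / 2) * hardyForm w := by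
  have h0 : ∀ᵐ x : Rn n, x ≠ 0 := by simp [ae_iff]
  have i1 : Integrable fun x => ∑ i, inner ℝ (radMul i w hw x) (pd i w x) :=
    integrable_finsetSum _ fun i _ => integrable_real_inner _ _
  have e1 : ∫ x, ∑ i, inner ℝ (radMul i w hw x) (pd i w x) =
      -∫ x, ∑ i, inner ℝ (pd i (radMul i w hw) x) (w x) := by
    rw [integral_finsetSum _ fun i _ => integrable_real_inner _ _,
      integral_finsetSum _ fun i _ => integrable_real_inner _ _, ← Finset.sum_neg_distrib]
    exact Finset.sum_congr rfl fun i _ => integral_real_inner_pd i _ _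
  have e2 : ∫ x, ∑ i, inner ℝ (pd i (radMul i w hw) x) (w x) =
      ((n : ℝ) - 2) * hardyForm w + ∫ x, ∑ i, inner ℝ (radMul i w hw x) (pd i w x) := by
    rw [hardyForm, ← integral_const_mul, ← integral_add (hw.integrable_hardy.const_mul _) i1]
    refine integral_congr_ae ?_
    filter_upwards [h0] with x hx
    exact sum_inner_pd_radMul w hw hx
  linarith

/-- Hardy's inequality. -/
theorem hardy [Nontrivial (Rn n)] (w : 𝓢(Rn n, ℂ)) (hw : IsTest w) :
    (((n : ℝ) - 2) / 2) ^ 2 * hardyForm w ≤ dirichlet w := by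
  set l : ℝ := ((n : ℝ) - 2) / 2 with hl
  have h0 : ∀ᵐ x : Rn n, x ≠ 0 := by simp [ae_iff]
  have i1 : Integrable fun x => ∑ i, inner ℝ (radMul i w hw x) (pd i w x) :=
    integrable_finsetSum _ fun i _ => integrable_real_inner _ _
  -- This is the expansion of `|∇w + l x w / |x|²|² ≥ 0`. The cross term integrates to `-2 l²` times
  -- the Hardy form, against `l²` from the square.
  have pt : ∀ᵐ x : Rn n, 0 ≤ ∑ i, ‖pd i w x‖ ^ 2 +
      (2 * l * ∑ i, inner ℝ (radMul i w hw x) (pd i w x) + l ^ 2 * ((‖x‖ ^ 2)⁻¹ * ‖w x‖ ^ 2)) := by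
    filter_upwards [h0] with x hx
    have h1 : ‖x‖ ^ 2 ≠ 0 := pow_ne_zero 2 (norm_ne_zero_iff.2 hx)
    have : 0 ≤ ∑ i, ‖pd i w x + l • radMul i w hw x‖ ^ 2 := by positivity
    refine this.trans (le_of_eq ?_)
    have e : ∀ i, ‖pd i w x + l • radMul i w hw x‖ ^ 2 = ‖pd i w x‖ ^ 2 +
        2 * l * inner ℝ (radMul i w hw x) (pd i w x) +
        l ^ 2 * ((‖x‖ ^ 2)⁻¹) ^ 2 * ‖w x‖ ^ 2 * x i ^ 2 := by
      intro i
      rw [norm_add_sq_real, real_inner_smul_right, norm_smul, radMul_apply, norm_smul,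
        real_inner_comm, mul_pow, mul_pow, Real.norm_eq_abs, Real.norm_eq_abs, sq_abs, sq_abs]
      ring
    rw [Finset.sum_congr rfl fun i _ => e i, Finset.sum_add_distrib, Finset.sum_add_distrib,
      ← Finset.mul_sum, ← Finset.mul_sum, ← EuclideanSpace.real_norm_sq_eq]
    field_simp
    ring
  have := integral_nonneg_of_ae pt
  have i2 : Integrable fun x : Rn n => 2 * l * ∑ i, inner ℝ (radMul i w hw x) (pd i w x) +
      l ^ 2 * ((‖x‖ ^ 2)⁻¹ * ‖w x‖ ^ 2) := (i1.const_mul _).add (hw.integrable_hardy.const_mul _)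
  rw [integral_add (integrable_gradSq w) i2, integral_add (i1.const_mul _) (hw.integrable_hardy.const_mul _), integral_const_mul,
    integral_const_mul, integral_inner_radMul w hw] at this
  change 0 ≤ dirichlet w + (2 * l * (-l * hardyForm w) + l ^ 2 * hardyForm w) at this
  linarith

/-! ### The minimal operator -/

/-- The value of `-Δ + a / |x|²` on a test function. -/
noncomputable def testPair (a : ℝ) (w : 𝓢(Rn n, ℂ)) (hw : IsTest w) : L2 n × L2 n :=
  (toL2 w, toL2 (-(Δ w)) + (a : ℂ) • toL2 (divSq w hw))

theorem coeFn_testPair_snd (a : ℝ) (w : 𝓢(Rn n, ℂ)) (hw : IsTest w) :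
    (testPair a w hw).2 =ᵐ[volume]
      fun x => -(Δ (w : Rn n → ℂ) x) + ((a / ‖x‖ ^ 2 : ℝ) : ℂ) * w x := by
  filter_upwards [Lp.coeFn_add (toL2 (-(Δ w))) ((a : ℂ) • toL2 (divSq w hw)),
    Lp.coeFn_smul (a : ℂ) (toL2 (divSq w hw)), coeFn_toL2 (-(Δ w)), coeFn_toL2 (divSq w hw)]
    with x h1 h2 h3 h4
  change (toL2 (-(Δ w)) + (a : ℂ) • toL2 (divSq w hw)) x = _
  rw [h1, Pi.add_apply, h2, Pi.smul_apply, h3, h4, _root_.neg_apply, SchwartzMap.laplacian_apply,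
    divSq_apply, smul_eq_mul, ← mul_assoc, ← Complex.ofReal_mul, div_eq_mul_inv]

theorem mem_minimalGraph_iff (a : ℝ) (p : L2 n × L2 n) :
    p ∈ minimalGraph n a ↔ ∃ w hw, p = testPair a w hw := by
  constructor
  · rintro ⟨φ, h1, h2, h3, h4, h5⟩
    refine ⟨h2.toSchwartzMap h1, ⟨h2, h3⟩, Prod.ext (Lp.ext ?_) (Lp.ext ?_)⟩
    · exact h4.trans (coeFn_toL2 (h2.toSchwartzMap h1)).symm
    · exact h5.trans (coeFn_testPair_snd a (h2.toSchwartzMap h1) ⟨h2, h3⟩).symm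
  · rintro ⟨w, hw, rfl⟩
    exact ⟨w, w.smooth ⊤, hw.1, hw.2, coeFn_toL2 w, coeFn_testPair_snd a w hw⟩

theorem divSq_add {w z : 𝓢(Rn n, ℂ)} (hw : IsTest w) (hz : IsTest z) :
    divSq (w + z) (hw.add hz) = divSq w hw + divSq z hz := by
  ext x
  rw [_root_.add_apply, divSq_apply, divSq_apply, divSq_apply, _root_.add_apply, mul_add]

theorem divSq_smul {w : 𝓢(Rn n, ℂ)} (hw : IsTest w) (c : ℂ) :
    divSq (c • w) (hw.smul c) = c • divSq w hw := by
  ext x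
  rw [_root_.smul_apply, divSq_apply, divSq_apply, _root_.smul_apply, smul_eq_mul, smul_eq_mul,
    mul_left_comm]

theorem testPair_add (a : ℝ) {w z : 𝓢(Rn n, ℂ)} (hw : IsTest w) (hz : IsTest z) :
    testPair a (w + z) (hw.add hz) = testPair a w hw + testPair a z hz := by
  have e : Δ (w + z) = Δ w + Δ z := map_add (laplacianCLM ℝ (Rn n) 𝓢(Rn n, ℂ)) w z
  rw [testPair, testPair, testPair, divSq_add hw hz, e, neg_add, toLp_add, toLp_add, toLp_add,
    Prod.mk_add_mk, smul_add]
  congr 1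
  abel

theorem testPair_smul (a : ℝ) {w : 𝓢(Rn n, ℂ)} (hw : IsTest w) (c : ℂ) :
    testPair a (c • w) (hw.smul c) = c • testPair a w hw := by
  have e : Δ (c • w) = c • Δ w := by
    rw [← SchwartzMap.laplacianCLM_eq ℂ, map_smul, SchwartzMap.laplacianCLM_eq]
  rw [testPair, testPair, divSq_smul hw, e, ← smul_neg, toLp_smul, toLp_smul, toLp_smul,
    Prod.smul_mk, smul_add, smul_comm c]

/-- The graph of `-Δ + a / |x|²` on test functions, as a subspace. -/
noncomputable def minimalSubmodule (n : ℕ) (a : ℝ) : Submodule ℂ (L2 n × L2 n) where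
  carrier := minimalGraph n a
  zero_mem' := by
    rw [mem_minimalGraph_iff]
    refine ⟨(0 : ℂ) • 0, isTest_zero.smul 0, ?_⟩
    rw [testPair_smul _ isTest_zero, zero_smul]
  add_mem' := by
    intro p q hp hq
    rw [mem_minimalGraph_iff] at *
    obtain ⟨w, hw, rfl⟩ := hp
    obtain ⟨z, hz, rfl⟩ := hq
    exact ⟨w + z, hw.add hz, (testPair_add a hw hz).symm⟩
  smul_mem' := by
    intro c p hp
    rw [mem_minimalGraph_iff] at *
    obtain ⟨w, hw, rfl⟩ := hp
    exact ⟨c • w, hw.smul c, (testPair_smul a hw c).symm⟩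

theorem inner_testPair_self (a : ℝ) {w : 𝓢(Rn n, ℂ)} (hw : IsTest w) :
    (inner ℂ (testPair a w hw).2 (testPair a w hw).1).re = dirichlet w + a * hardyForm w := by
  have e : inner ℂ (toL2 (divSq w hw)) (toL2 w) = (hardyForm w : ℂ) := by
    rw [inner_toLp, hardyForm, ← integral_complex_ofReal]
    congr 1
    ext x
    rw [divSq_apply, map_mul, Complex.conj_ofReal, mul_assoc, ← Complex.normSq_eq_conj_mul_self,
      Complex.normSq_eq_norm_sq, Complex.ofReal_mul]
  rw [testPair, inner_add_left, inner_neg_laplacian_self, inner_smul_left, e, Complex.conj_ofReal,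
    ← Complex.ofReal_mul, ← Complex.ofReal_add, Complex.ofReal_re]

theorem inner_testPair_symm (a : ℝ) {w z : 𝓢(Rn n, ℂ)} (hw : IsTest w) (hz : IsTest z) :
    inner ℂ (testPair a w hw).2 (testPair a z hz).1 =
      inner ℂ (testPair a w hw).1 (testPair a z hz).2 := by
  rw [testPair, testPair, inner_add_left, inner_add_right, inner_smul_left, inner_smul_right,
    Complex.conj_ofReal, inner_toLp, inner_toLp, inner_toLp, inner_toLp]
  congr 1
  · simp only [_root_.neg_apply, map_neg, neg_mul, mul_neg, integral_neg]
    rw [integral_conj_laplacian]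
  · congr 2
    ext x
    rw [divSq_apply, divSq_apply, map_mul, Complex.conj_ofReal]
    ring

/-- The form of `-Δ + a / |x|²` controls the Dirichlet form. -/
theorem exists_dirichlet_le [Nontrivial (Rn n)] {a : ℝ} (ha : 0 < a + (((n : ℝ) - 2) / 2) ^ 2) :
    ∃ C : ℝ, 0 < C ∧ ∀ w : 𝓢(Rn n, ℂ), IsTest w →
      dirichlet w ≤ C * (dirichlet w + a * hardyForm w) := by
  rcases le_or_gt 0 a with h | h
  · refine ⟨1, one_pos, fun w _ => ?_⟩
    have := mul_nonneg h (hardyForm_nonneg w)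
    linarith
  · set l := (((n : ℝ) - 2) / 2) ^ 2 with hl
    have hl0 : 0 < l := by linarith
    -- For `a < 0`, Hardy gives `a ∫ |w|²/|x|² ≥ (a/l) ∫ |∇w|²`, so the form is at least `(a + l)/l`
    -- times the Dirichlet integral.
    refine ⟨l / (a + l), by positivity, fun w hw => ?_⟩
    have := mul_le_mul_of_nonpos_left (hardy w hw) h.le
    rw [← hl] at this
    rw [div_mul_eq_mul_div, le_div_iff₀ ha]
    linarith

theorem isNonnegSymmetric_minimal [Nontrivial (Rn n)] {a : ℝ}
    (ha : 0 < a + (((n : ℝ) - 2) / 2) ^ 2) : IsNonnegSymmetric (minimalSubmodule n a) := by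
  constructor
  · intro p hp q hq
    obtain ⟨w, hw, rfl⟩ := (mem_minimalGraph_iff a p).1 hp
    obtain ⟨z, hz, rfl⟩ := (mem_minimalGraph_iff a q).1 hq
    exact inner_testPair_symm a hw hz
  · intro p hp
    obtain ⟨w, hw, rfl⟩ := (mem_minimalGraph_iff a p).1 hp
    rw [inner_testPair_self]
    obtain ⟨C, hC, h⟩ := exists_dirichlet_le ha
    exact (mul_nonneg_iff_of_pos_left hC).1 ((dirichlet_nonneg w).trans (h w hw))

end TestFunctions

/-! ### Circle means and a Hardy inequality in the plane -/

section Plane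

/-- The Cauchy–Schwarz inequality against a constant. -/
theorem sq_intervalIntegral_le {L : ℝ} (hL : 0 < L) {f : ℝ → ℝ} (hf : Continuous f) :
    (∫ t in (0 : ℝ)..L, f t) ^ 2 ≤ L * ∫ t in (0 : ℝ)..L, f t ^ 2 := by
  set m := ∫ t in (0 : ℝ)..L, f t with hm
  have h1 : 0 ≤ ∫ t in (0 : ℝ)..L, (L * f t - m) ^ 2 :=
    intervalIntegral.integral_nonneg hL.le fun _ _ => sq_nonneg _
  have e : ∀ t, (L * f t - m) ^ 2 = L ^ 2 * f t ^ 2 - 2 * L * m * f t + m ^ 2 := fun t => by ring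
  simp only [e] at h1
  rw [intervalIntegral.integral_add (Continuous.intervalIntegrable (by fun_prop) _ _)
      (Continuous.intervalIntegrable (by fun_prop) _ _),
    intervalIntegral.integral_sub (Continuous.intervalIntegrable (by fun_prop) _ _)
      (Continuous.intervalIntegrable (by fun_prop) _ _), intervalIntegral.integral_const_mul,
    intervalIntegral.integral_const_mul, intervalIntegral.integral_const, ← hm, sub_zero,
    smul_eq_mul] at h1
  have h2 : 0 ≤ L * (L * (∫ t in (0 : ℝ)..L, f t ^ 2) - m ^ 2) := by nlinarith
  have := (mul_nonneg_iff_of_pos_left hL).1 h2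
  linarith

/-- The plane as the complex plane. -/
noncomputable def ofC : ℂ ≃ₗᵢ[ℝ] Rn 2 := Complex.orthonormalBasisOneI.repr

/-- The rotation of the plane by the angle `t`. -/
noncomputable def rot (t : ℝ) : Rn 2 ≃ₗᵢ[ℝ] Rn 2 :=
  (ofC.symm.trans (rotation (Circle.exp t))).trans ofC

theorem rot_apply (t : ℝ) (x : Rn 2) :
    rot t x = ofC (Complex.exp (t * Complex.I) * ofC.symm x) := rfl

theorem rot_zero (x : Rn 2) : rot 0 x = x := by
  rw [rot_apply]
  simp

theorem rot_add (s t : ℝ) (x : Rn 2) : rot (s + t) x = rot s (rot t x) := by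
  rw [rot_apply, rot_apply, rot_apply, LinearIsometryEquiv.symm_apply_apply, ← mul_assoc,
    ← Complex.exp_add]
  push_cast
  rw [add_mul]

theorem rot_two_pi (t : ℝ) (x : Rn 2) : rot (t + 2 * Real.pi) x = rot t x := by
  rw [rot_apply, rot_apply]
  push_cast
  rw [add_mul, Complex.exp_add, Complex.exp_two_pi_mul_I, mul_one]

theorem continuous_rot : Continuous fun p : ℝ × Rn 2 => rot p.1 p.2 := by
  simp only [rot_apply]
  fun_prop

theorem continuous_rot_left (x : Rn 2) : Continuous fun t => rot t x := by
  simp only [rot_apply]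
  fun_prop

theorem exists_rot_eq (x : Rn 2) : ∃ t, x = rot t (ofC (‖x‖ : ℂ)) := by
  refine ⟨Complex.arg (ofC.symm x), ?_⟩
  rw [rot_apply, LinearIsometryEquiv.symm_apply_apply, ← LinearIsometryEquiv.symm_apply_eq, mul_comm,
    ← ofC.symm.norm_map x]
  exact (Complex.norm_mul_exp_arg_mul_I _).symm

theorem hasDerivAt_rot (x : Rn 2) (t : ℝ) :
    HasDerivAt (fun t => rot t x) (ofC (Complex.I * (Complex.exp (t * Complex.I) * ofC.symm x))) t := by
  have h1 : HasDerivAt (fun t : ℝ => (t : ℂ) * Complex.I) Complex.I t := by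
    simpa using (Complex.ofRealCLM.hasDerivAt (x := t)).mul_const Complex.I
  have h2 := (h1.cexp.mul_const (ofC.symm x))
  have h3 := (ofC.toContinuousLinearEquiv : ℂ →L[ℝ] Rn 2).hasFDerivAt.comp_hasDerivAt t h2
  convert! h3 using 1
  change ofC _ = ofC _
  congr 1
  ring

theorem norm_deriv_rot (x : Rn 2) (t : ℝ) :
    ‖ofC (Complex.I * (Complex.exp (t * Complex.I) * ofC.symm x))‖ = ‖x‖ := by
  rw [LinearIsometryEquiv.norm_map, norm_mul, norm_mul, Complex.norm_I, Complex.norm_exp_ofReal_mul_I,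
    LinearIsometryEquiv.norm_map, one_mul, one_mul]

attribute [irreducible] rot

/-- The integral over the circle through `x`. -/
noncomputable def circleInt (w : Rn 2 → ℂ) (x : Rn 2) : ℂ := ∫ t in (0 : ℝ)..2 * Real.pi, w (rot t x)

theorem circleInt_rot (w : Rn 2 → ℂ) (s : ℝ) (x : Rn 2) :
    circleInt w (rot s x) = circleInt w x := by
  have hp : Function.Periodic (fun t => w (rot t x)) (2 * Real.pi) := fun t => by
    simp only [rot_two_pi]
  have := hp.intervalIntegral_add_eq s 0
  rw [zero_add] at this
  rw [circleInt, circleInt, ← this]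
  simp only [← rot_add]
  rw [intervalIntegral.integral_comp_add_right (fun t => w (rot t x)) s, zero_add, add_comm]

theorem continuous_circleInt {w : Rn 2 → ℂ} (hw : Continuous w) : Continuous (circleInt w) := by
  have h : Continuous (Function.uncurry fun (x : Rn 2) (t : ℝ) => w (rot t x)) :=
    hw.comp (continuous_rot.comp (continuous_snd.prodMk continuous_fst))
  exact intervalIntegral.continuous_parametric_intervalIntegral_of_continuous' h _ _

/-- Written as a function of `|x|²`, the circle integral can be tested against bumps in that
variable. -/
theorem circleInt_eq (w : Rn 2 → ℂ) (x : Rn 2) : circleInt w x = circleInt w (ofC (√(‖x‖ ^ 2) : ℝ)) := by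
  obtain ⟨t, ht⟩ := exists_rot_eq x
  rw [Real.sqrt_sq (norm_nonneg x)]
  conv_lhs => rw [ht]
  exact circleInt_rot w t _

theorem integral_comp_rot {E : Type*} [NormedAddCommGroup E] [NormedSpace ℝ E] (t : ℝ)
    (f : Rn 2 → E) : ∫ x, f (rot t x) = ∫ x, f x :=
  (rot t).measurePreserving.integral_comp' (f := (rot t).toHomeomorph.toMeasurableEquiv) f

theorem isFiniteMeasure_restrict_uIoc :
    IsFiniteMeasure (volume.restrict (Set.uIoc 0 (2 * Real.pi))) := by
  rw [Set.uIoc_of_le (by positivity)]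
  infer_instance

/-- By Fubini, the integral averages those of `φ(x) w(rot t x)` over `t`; each equals the integral
of `φ w` because `φ` is rotation invariant. -/
theorem integral_mul_circleInt {w φ : 𝓢(Rn 2, ℂ)} (hφ : IsRadial φ) (h : ∫ x, φ x * w x = 0) :
    ∫ x, φ x * circleInt w x = 0 := by
  have e : ∀ x, φ x * circleInt w x = ∫ t in (0 : ℝ)..2 * Real.pi, φ x * w (rot t x) :=
    fun x => (intervalIntegral.integral_const_mul _ _).symm
  simp only [e]
  rw [← intervalIntegral_integral_swap (f := fun t x => φ x * w (rot t x))]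
  · have e2 : ∀ t, ∫ x, φ x * w (rot t x) = 0 := by
      intro t
      rw [← h, ← integral_comp_rot t (fun x => φ x * w x)]
      congr 1
      ext x
      rw [hφ (rot t x) x ((rot t).norm_map x)]
    simp [e2]
  · have := isFiniteMeasure_restrict_uIoc
    have hI : Integrable (fun p : ℝ × Rn 2 => ‖φ p.2‖ * ‖w.toBoundedContinuousFunction‖)
        ((volume.restrict (Set.uIoc 0 (2 * Real.pi))).prod volume) :=
      (φ.integrable.norm.mul_const _).comp_snd _
    have hc : Continuous fun p : ℝ × Rn 2 => φ p.2 * w (rot p.1 p.2) :=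
      (φ.continuous.comp continuous_snd).mul (w.continuous.comp continuous_rot)
    refine hI.mono' hc.aestronglyMeasurable (Eventually.of_forall fun p => ?_)
    rw [Function.uncurry, norm_mul]
    gcongr
    exact w.toBoundedContinuousFunction.norm_coe_le_norm _

/-- The circle integral is continuous, radial and orthogonal to radial test functions. If nonzero at
`x₀`, its real inner product with that value would have positive integral against a radial bump. -/
theorem circleInt_eq_zero {w : 𝓢(Rn 2, ℂ)}
    (h : ∀ φ : 𝓢(Rn 2, ℂ), IsRadial φ → ∫ x, φ x * w x = 0) (x₀ : Rn 2) :
    circleInt w x₀ = 0 := by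
  by_contra hne
  set G : ℝ → ℝ := fun s => inner ℝ (circleInt w x₀) (circleInt w (ofC (√s : ℝ))) with hG
  have hGc : Continuous G := by
    have := continuous_circleInt w.continuous
    fun_prop
  have hGx : ∀ x, G (‖x‖ ^ 2) = inner ℝ (circleInt w x₀) (circleInt w x) := fun x => by
    rw [circleInt_eq w x]
  have hG0 : 0 < G (‖x₀‖ ^ 2) := by
    rw [hGx, real_inner_self_eq_norm_sq]
    have := norm_pos_iff.2 hne
    positivity
  obtain ⟨δ, hδ, hball⟩ := Metric.isOpen_iff.1 (isOpen_lt continuous_const hGc) _ hG0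
  -- A bump in `|x|²`, not in `|x|`, is smooth at the origin as well.
  let η : ContDiffBump (‖x₀‖ ^ 2) := ⟨δ / 2, δ, by positivity, by linarith⟩
  have hc : HasCompactSupport fun x : Rn 2 => (η (‖x‖ ^ 2) : ℂ) := by
    refine HasCompactSupport.of_support_subset_isCompact
      (isCompact_closedBall (0 : Rn 2) (√(‖x₀‖ ^ 2 + δ))) fun x hx => ?_
    rw [mem_closedBall_zero_iff]
    by_contra hlt
    have h2 : ‖x₀‖ ^ 2 + δ < ‖x‖ ^ 2 := (Real.sqrt_lt' (lt_of_le_of_lt (Real.sqrt_nonneg _)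
      (not_le.1 hlt))).1 (not_le.1 hlt)
    refine hx ?_
    change (η (‖x‖ ^ 2) : ℂ) = 0
    rw [η.zero_of_le_dist, Complex.ofReal_zero]
    change δ ≤ _
    rw [Real.dist_eq, abs_of_pos] <;> linarith
  have hs : ContDiff ℝ ∞ fun x : Rn 2 => (η (‖x‖ ^ 2) : ℂ) :=
    Complex.ofRealCLM.contDiff.comp (η.contDiff.comp (contDiff_norm_sq ℝ))
  have hrad : IsRadial (hc.toSchwartzMap hs) := fun x y hxy => by
    change (η (‖x‖ ^ 2) : ℂ) = (η (‖y‖ ^ 2) : ℂ)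
    rw [hxy]
  have key := integral_mul_circleInt hrad (h _ hrad)
  have hcont : Continuous fun x : Rn 2 => η (‖x‖ ^ 2) * G (‖x‖ ^ 2) := by
    have := η.continuous
    fun_prop
  have key2 : ∫ x : Rn 2, η (‖x‖ ^ 2) * G (‖x‖ ^ 2) = 0 := by
    have hi : Integrable fun x : Rn 2 => (η (‖x‖ ^ 2) : ℂ) * circleInt w x :=
      Continuous.integrable_of_hasCompactSupport
        (hs.continuous.mul (continuous_circleInt w.continuous)) hc.mul_right
    have := (innerSL ℝ (circleInt w x₀)).integral_comp_comm hi
    change _ = inner ℝ (circleInt w x₀) (∫ x : Rn 2, (η (‖x‖ ^ 2) : ℂ) * circleInt w x) at this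
    change ∫ x : Rn 2, (η (‖x‖ ^ 2) : ℂ) * circleInt w x = 0 at key
    rw [key, inner_zero_right] at this
    rw [← this]
    congr 1
    ext x
    rw [hGx]
    change _ = inner ℝ (circleInt w x₀) ((η (‖x‖ ^ 2) : ℂ) * circleInt w x)
    rw [← Complex.real_smul, real_inner_smul_right]
  have hpos := hcont.integral_pos_of_hasCompactSupport_nonneg_nonzero (μ := volume) (x := x₀)
    ?_ ?_ ?_
  · exact hpos.ne' key2
  · have : HasCompactSupport fun x : Rn 2 => η (‖x‖ ^ 2) := by
      have := hc.comp_left (g := Complex.re) Complex.zero_re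
      exact this
    exact this.mul_right
  · intro x
    by_cases hx : ‖x‖ ^ 2 ∈ Metric.ball (‖x₀‖ ^ 2) δ
    · exact mul_nonneg η.nonneg (hball hx).le
    · change 0 ≤ η (‖x‖ ^ 2) * G (‖x‖ ^ 2)
      rw [η.zero_of_le_dist, zero_mul]
      exact not_lt.1 hx
  · refine mul_ne_zero ?_ hG0.ne'
    rw [η.one_of_mem_closedBall (Metric.mem_closedBall_self (by positivity))]
    exact one_ne_zero

theorem norm_fderiv_apply_sq_le {n : ℕ} (w : 𝓢(Rn n, ℂ)) (x v : Rn n) :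
    ‖fderiv ℝ w x v‖ ^ 2 ≤ ‖v‖ ^ 2 * ∑ i, ‖pd i w x‖ ^ 2 := by
  have e : fderiv ℝ w x v = ∑ i, v i • pd i w x := by
    conv_lhs => rw [← (EuclideanSpace.basisFun (Fin n) ℝ).sum_repr v]
    rw [map_sum]
    refine Finset.sum_congr rfl fun i _ => ?_
    rw [map_smul, pd_apply, EuclideanSpace.basisFun_repr]
  have h1 : ‖fderiv ℝ w x v‖ ≤ ∑ i, |v i| * ‖pd i w x‖ := by
    rw [e]
    refine (norm_sum_le _ _).trans (le_of_eq ?_)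
    simp only [norm_smul, Real.norm_eq_abs]
  refine (pow_le_pow_left₀ (norm_nonneg _) h1 2).trans ?_
  refine (Finset.sum_mul_sq_le_sq_mul_sq _ _ _).trans (le_of_eq ?_)
  simp only [sq_abs]
  rw [EuclideanSpace.real_norm_sq_eq]

theorem continuous_gradSq {n : ℕ} (w : 𝓢(Rn n, ℂ)) : Continuous fun x => ∑ i, ‖pd i w x‖ ^ 2 :=
  continuous_finsetSum _ fun i _ => (pd i w).continuous.norm.pow 2

theorem continuous_sqrt_gradSq_rot (w : 𝓢(Rn 2, ℂ)) (x : Rn 2) :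
    Continuous fun t => √(∑ i, ‖pd i w (rot t x)‖ ^ 2) :=
  Real.continuous_sqrt.comp ((continuous_gradSq w).comp (continuous_rot_left x))

/-- The fundamental theorem of calculus along the orbit `t ↦ rot t x`, whose speed is `‖x‖`. The
integral is enlarged to the whole circle to make the bound uniform in `t`. -/
theorem norm_sub_rot_le (w : 𝓢(Rn 2, ℂ)) (x : Rn 2) {t : ℝ} (ht : t ∈ Set.Icc 0 (2 * Real.pi)) :
    ‖w (rot t x) - w x‖ ≤
      ‖x‖ * ∫ t in (0 : ℝ)..2 * Real.pi, √(∑ i, ‖pd i w (rot t x)‖ ^ 2) := by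
  set f : ℝ → ℝ := fun t => √(∑ i, ‖pd i w (rot t x)‖ ^ 2) with hf
  have hfc : Continuous f := continuous_sqrt_gradSq_rot w x
  have hrot : Continuous fun t => rot t x := continuous_rot_left x
  set d : ℝ → Rn 2 := fun t => ofC (Complex.I * (Complex.exp (t * Complex.I) * ofC.symm x)) with hd
  have hdd : Continuous d := by fun_prop
  have hder : ∀ t, HasDerivAt (fun t => w (rot t x)) (fderiv ℝ w (rot t x) (d t)) t :=
    fun t => (w.hasFDerivAt _).comp_hasDerivAt t (hasDerivAt_rot x t)
  have hb : ∀ t, ‖fderiv ℝ w (rot t x) (d t)‖ ≤ ‖x‖ * f t := by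
    intro t
    have h0 : 0 ≤ ‖x‖ * f t := mul_nonneg (norm_nonneg _) (Real.sqrt_nonneg _)
    refine (pow_le_pow_iff_left₀ (norm_nonneg _) h0 two_ne_zero).1 ?_
    rw [mul_pow, hf, Real.sq_sqrt (Finset.sum_nonneg fun _ _ => sq_nonneg _),
      ← norm_deriv_rot x t]
    exact norm_fderiv_apply_sq_le w _ _
  have hdc : Continuous fun t : ℝ => fderiv ℝ w (rot t x) (d t) :=
    (((w.smooth ⊤).continuous_fderiv (by simp)).comp hrot).clm_apply hdd
  have e := intervalIntegral.integral_eq_sub_of_hasDerivAt (a := 0) (b := t)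
    (fun t _ => hder t) (hdc.intervalIntegrable _ _)
  rw [rot_zero] at e
  rw [← e]
  refine (intervalIntegral.norm_integral_le_integral_norm ht.1).trans ?_
  refine (intervalIntegral.integral_mono_on ht.1 (hdc.norm.intervalIntegrable _ _)
    ((continuous_const.mul hfc).intervalIntegrable _ _) (fun t _ => hb t)).trans ?_
  rw [← intervalIntegral.integral_const_mul]
  refine intervalIntegral.integral_mono_interval le_rfl ht.1 ht.2
    (Eventually.of_forall fun t => ?_) ((continuous_const.mul hfc).intervalIntegrable _ _)
  exact mul_nonneg (norm_nonneg _) (Real.sqrt_nonneg _)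

/-- A vanishing mean makes `-w x` the average of `w (rot t x) - w x`, so the oscillation on the
circle bounds `w x`; Cauchy–Schwarz in `t` squares this. -/
theorem norm_sq_le_of_circleInt_eq_zero {w : 𝓢(Rn 2, ℂ)} {x : Rn 2} (h : circleInt w x = 0) :
    ‖w x‖ ^ 2 ≤ 2 * Real.pi * ‖x‖ ^ 2 *
      ∫ t in (0 : ℝ)..2 * Real.pi, ∑ i, ‖pd i w (rot t x)‖ ^ 2 := by
  have hπ : 0 < 2 * Real.pi := by positivity
  have hwc : Continuous fun t => w (rot t x) := w.continuous.comp (continuous_rot_left x)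
  set M : ℝ := ‖x‖ * ∫ t in (0 : ℝ)..2 * Real.pi, √(∑ i, ‖pd i w (rot t x)‖ ^ 2) with hM
  have hwx : ‖w x‖ ≤ M := by
    have e : ∫ t in (0 : ℝ)..2 * Real.pi, (w (rot t x) - w x) = -((2 * Real.pi) • w x) := by
      rw [intervalIntegral.integral_sub (hwc.intervalIntegrable _ _)
        (continuous_const.intervalIntegrable _ _), intervalIntegral.integral_const, sub_zero]
      change circleInt w x - _ = _
      rw [h, zero_sub]
    have h1 : ‖(2 * Real.pi) • w x‖ ≤ M * |2 * Real.pi - 0| := by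
      rw [← norm_neg, ← e]
      refine intervalIntegral.norm_integral_le_of_norm_le_const fun t ht => norm_sub_rot_le w x ?_
      rw [Set.uIoc_of_le hπ.le] at ht
      exact ⟨ht.1.le, ht.2⟩
    rw [norm_smul, sub_zero, abs_of_pos hπ, Real.norm_of_nonneg hπ.le, mul_comm] at h1
    exact le_of_mul_le_mul_right h1 hπ
  refine (pow_le_pow_left₀ (norm_nonneg _) hwx 2).trans ?_
  rw [hM, mul_pow, mul_comm (2 * Real.pi), mul_assoc]
  refine mul_le_mul_of_nonneg_left ?_ (sq_nonneg _)
  refine (sq_intervalIntegral_le hπ (continuous_sqrt_gradSq_rot w x)).trans (le_of_eq ?_)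
  congr 1
  refine intervalIntegral.integral_congr fun t _ => ?_
  exact Real.sq_sqrt (Finset.sum_nonneg fun _ _ => sq_nonneg _)

/-- A Hardy inequality for functions with vanishing circle means. -/
theorem hardyForm_le_of_circleInt_eq_zero {w : 𝓢(Rn 2, ℂ)} (hw : IsTest w)
    (h : ∀ x, circleInt w x = 0) : hardyForm w ≤ (2 * Real.pi) ^ 2 * dirichlet w := by
  have hπ : 0 < 2 * Real.pi := by positivity
  have hI : Integrable (fun p : ℝ × Rn 2 => ∑ i, ‖pd i w (rot p.1 p.2)‖ ^ 2)
      ((volume.restrict (Set.uIoc 0 (2 * Real.pi))).prod volume) := by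
    have := isFiniteMeasure_restrict_uIoc
    have hm : Continuous fun p : ℝ × Rn 2 => ∑ i, ‖pd i w (rot p.1 p.2)‖ ^ 2 :=
      (continuous_gradSq w).comp continuous_rot
    rw [integrable_prod_iff hm.aestronglyMeasurable]
    have e : ∀ t, ∫ x, ‖∑ i, ‖pd i w (rot t x)‖ ^ 2‖ = dirichlet w := by
      intro t
      rw [dirichlet, ← integral_comp_rot t (fun x => ∑ i, ‖pd i w x‖ ^ 2)]
      congr 1
      ext x
      exact Real.norm_of_nonneg (by positivity)
    refine ⟨Eventually.of_forall fun t => ?_, ?_⟩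
    · exact (rot t).measurePreserving.integrable_comp_of_integrable (integrable_gradSq w)
    · simp only [e]
      exact integrable_const _
  have h2 : ∫ x, ∫ t in (0 : ℝ)..2 * Real.pi, ∑ i, ‖pd i w (rot t x)‖ ^ 2 =
      2 * Real.pi * dirichlet w := by
    rw [← intervalIntegral_integral_swap (f := fun t x => ∑ i, ‖pd i w (rot t x)‖ ^ 2) hI]
    have e : ∀ t, ∫ x, ∑ i, ‖pd i w (rot t x)‖ ^ 2 = dirichlet w := fun t =>
      integral_comp_rot t (fun x => ∑ i, ‖pd i w x‖ ^ 2)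
    simp only [e, intervalIntegral.integral_const, sub_zero, smul_eq_mul]
  have hI2 : Integrable fun x => ∫ t in (0 : ℝ)..2 * Real.pi, ∑ i, ‖pd i w (rot t x)‖ ^ 2 := by
    have := hI.integral_prod_right
    simp only [Set.uIoc_of_le hπ.le] at this
    simpa only [intervalIntegral.integral_of_le hπ.le] using this
  -- The factor `‖x‖²` of the pointwise bound cancels the Hardy weight. Rotation invariance of the
  -- Dirichlet integral supplies the second factor `2π`.
  calc hardyForm w ≤ ∫ x, 2 * Real.pi *
        ∫ t in (0 : ℝ)..2 * Real.pi, ∑ i, ‖pd i w (rot t x)‖ ^ 2 := by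
        refine integral_mono hw.integrable_hardy (hI2.const_mul _) fun x => ?_
        rcases eq_or_ne x 0 with rfl | hx
        · simp only [norm_zero]
          have : 0 ≤ ∫ t in (0 : ℝ)..2 * Real.pi, ∑ i, ‖pd i w (rot t 0)‖ ^ 2 :=
            intervalIntegral.integral_nonneg hπ.le fun _ _ => by positivity
          simpa using mul_nonneg hπ.le this
        · have h0 : 0 < ‖x‖ ^ 2 := pow_pos (norm_pos_iff.2 hx) 2
          simp only
          rw [inv_mul_le_iff₀ h0]
          refine (norm_sq_le_of_circleInt_eq_zero (h x)).trans (le_of_eq ?_)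
          ring
    _ = (2 * Real.pi) ^ 2 * dirichlet w := by
        rw [integral_const_mul, h2]
        ring

end Plane

/-! ### Annular cutoffs and their effect on the forms -/

section Cutoff

variable {n : ℕ}

theorem exists_norm_fderiv_chi_le : ∃ L : ℝ, 0 ≤ L ∧ ∀ x : Rn n, ‖fderiv ℝ chi x‖ ≤ L := by
  have hc : HasCompactSupport (chi : Rn n → ℝ) := by
    refine HasCompactSupport.of_support_subset_isCompact
      (isCompact_closedBall (0 : Rn n) 2) fun x hx => ?_
    rw [mem_closedBall_zero_iff]
    by_contra h
    exact hx (chi_eq_zero (by nlinarith [not_le.1 h]))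
  obtain ⟨L, hL⟩ := (hc.fderiv (𝕜 := ℝ)).exists_bound_of_continuous
    (contDiff_chi.continuous_fderiv (by simp))
  exact ⟨L, (norm_nonneg _).trans (hL 0), hL⟩

theorem fderiv_chi_eq_zero {x : Rn n} (h : 2 ≤ ‖x‖ ^ 2) : fderiv ℝ chi x = 0 := by
  refine IsLocalMin.fderiv_eq_zero (Eventually.of_forall fun y => ?_)
  rw [chi_eq_zero h]
  exact chi_nonneg y

theorem norm_fderiv_annulusFun_le (k : ℕ) (x : Rn n) :
    ‖fderiv ℝ (annulusFun k) x‖ ≤ ((k : ℝ) + 1)⁻¹ * ‖fderiv ℝ chi (((k : ℝ) + 1)⁻¹ • x)‖ +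
      ((k : ℝ) + 1) * ‖fderiv ℝ chi (((k : ℝ) + 1) • x)‖ := by
  have hd : ∀ y : Rn n, HasFDerivAt chi (fderiv ℝ chi y) y := fun y =>
    (contDiff_chi.differentiable (by simp) y).hasFDerivAt
  have hc : ∀ c : ℝ, HasFDerivAt (fun x : Rn n => chi (c • x)) (c • fderiv ℝ chi (c • x)) x := by
    intro c
    have h := (hd (c • x)).comp x ((hasFDerivAt_id x).const_smul c)
    convert! h using 1
    ext v
    simp
  have h := (hc ((k : ℝ) + 1)⁻¹).mul ((hc ((k : ℝ) + 1)).const_sub 1)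
  have e : fderiv ℝ (annulusFun k) x = _ := HasFDerivAt.fderiv h
  have hk : (0 : ℝ) < k + 1 := by positivity
  rw [e]
  refine (norm_add_le _ _).trans ?_
  rw [norm_smul, norm_smul, norm_neg, norm_smul, norm_smul, Real.norm_of_nonneg hk.le,
    Real.norm_of_nonneg (inv_nonneg.2 hk.le), Real.norm_of_nonneg (chi_nonneg _),
    Real.norm_of_nonneg (sub_nonneg.2 (chi_le_one _)), add_comm]
  refine add_le_add ?_ ?_
  · exact mul_le_of_le_one_left (by positivity) (by linarith [chi_nonneg (((k : ℝ) + 1) • x)])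
  · exact mul_le_of_le_one_left (by positivity) (chi_le_one _)

/-- The gradients of the annular cutoffs are bounded by a function comparable to `1 + 1/|x|²`. -/
theorem exists_norm_fderiv_annulusFun_sq_le : ∃ L : ℝ, ∀ (k : ℕ) (x : Rn n), x ≠ 0 →
    ‖fderiv ℝ (annulusFun k) x‖ ^ 2 ≤ L * ((‖x‖ ^ 2)⁻¹ + 1) := by
  obtain ⟨L, hL0, hL⟩ := exists_norm_fderiv_chi_le (n := n)
  -- The outer cutoff contributes at most `L`. The inner gradient lives where `(k + 1)² |x|² < 2`,
  -- so its square is at most `2 L² / |x|²`; squaring the sum costs another factor two.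
  refine ⟨4 * L ^ 2, fun k x hx => ?_⟩
  have hk : (1 : ℝ) ≤ k + 1 := by linarith [k.cast_nonneg (α := ℝ)]
  have hx0 : 0 < ‖x‖ ^ 2 := pow_pos (norm_pos_iff.2 hx) 2
  have h1 : ((k : ℝ) + 1)⁻¹ * ‖fderiv ℝ chi (((k : ℝ) + 1)⁻¹ • x)‖ ≤ L :=
    (mul_le_of_le_one_left (norm_nonneg _) (inv_le_one_of_one_le₀ hk)).trans (hL _)
  have h2 : (((k : ℝ) + 1) * ‖fderiv ℝ chi (((k : ℝ) + 1) • x)‖) ^ 2 ≤ 2 * L ^ 2 * (‖x‖ ^ 2)⁻¹ := by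
    rcases le_or_gt 2 (‖((k : ℝ) + 1) • x‖ ^ 2) with h | h
    · rw [fderiv_chi_eq_zero h, norm_zero, mul_zero, zero_pow two_ne_zero]
      positivity
    · rw [norm_smul_sq] at h
      rw [← div_eq_mul_inv, le_div_iff₀ hx0, mul_pow]
      have := pow_le_pow_left₀ (norm_nonneg _) (hL (((k : ℝ) + 1) • x)) 2
      calc _ = (((k : ℝ) + 1) ^ 2 * ‖x‖ ^ 2) * ‖fderiv ℝ chi (((k : ℝ) + 1) • x)‖ ^ 2 := by ring
        _ ≤ 2 * L ^ 2 := by gcongr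
  have h3 := norm_fderiv_annulusFun_le k x
  have h4 : 0 ≤ ((k : ℝ) + 1)⁻¹ * ‖fderiv ℝ chi (((k : ℝ) + 1)⁻¹ • x)‖ := by positivity
  have h5 := pow_le_pow_left₀ (norm_nonneg _) h3 2
  have h6 := pow_le_pow_left₀ h4 h1 2
  have h7 : 0 ≤ L ^ 2 := sq_nonneg L
  nlinarith [add_sq_le (a := ((k : ℝ) + 1)⁻¹ * ‖fderiv ℝ chi (((k : ℝ) + 1)⁻¹ • x)‖)
    (b := ((k : ℝ) + 1) * ‖fderiv ℝ chi (((k : ℝ) + 1) • x)‖)]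

theorem tendsto_norm_fderiv_annulusFun {x : Rn n} (hx : x ≠ 0) :
    Tendsto (fun k : ℕ => ‖fderiv ℝ (annulusFun k) x‖) atTop (𝓝 0) := by
  obtain ⟨L, hL0, hL⟩ := exists_norm_fderiv_chi_le (n := n)
  have h1 : Tendsto (fun k : ℕ => (k : ℝ) + 1) atTop atTop :=
    tendsto_atTop_add_const_right _ _ tendsto_natCast_atTop_atTop
  have h2 : Tendsto (fun k : ℕ => ((k : ℝ) + 1)⁻¹ * L) atTop (𝓝 0) := by
    simpa using (tendsto_inv_atTop_zero.comp h1).mul_const L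
  have h0 : 0 < ‖x‖ := norm_pos_iff.2 hx
  refine squeeze_zero' (Eventually.of_forall fun _ => norm_nonneg _) ?_ h2
  filter_upwards [h1.eventually_ge_atTop (2 / ‖x‖)] with k h3
  have h4 : (2 : ℝ) ≤ ((k : ℝ) + 1) * ‖x‖ := (div_le_iff₀ h0).1 h3
  refine (norm_fderiv_annulusFun_le k x).trans ?_
  rw [fderiv_chi_eq_zero (x := ((k : ℝ) + 1) • x), norm_zero, mul_zero, add_zero]
  · gcongr
    exact hL _
  · rw [norm_smul, Real.norm_of_nonneg (by positivity)]
    nlinarith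

/-- A Schwartz function, cut off to an annulus. -/
noncomputable def cut (k : ℕ) (f : 𝓢(Rn n, ℂ)) : 𝓢(Rn n, ℂ) :=
  annulusMul k f fun _ _ => (f.smooth ⊤).contDiffAt

theorem cut_apply (k : ℕ) (f : 𝓢(Rn n, ℂ)) (x : Rn n) : cut k f x = annulusFun k x • f x := by
  rw [Complex.real_smul]
  rfl

theorem isTest_cut (k : ℕ) (f : 𝓢(Rn n, ℂ)) : IsTest (cut k f) := isTest_annulusMul _ _ _

theorem toL2_cut (k : ℕ) (f : 𝓢(Rn n, ℂ)) : toL2 (cut k f) = mulS (annulus k 0) (toL2 f) := by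
  refine Lp.ext ?_
  filter_upwards [coeFn_toL2 (cut k f), coeFn_toL2 f, coeFn_mulS (annulus k 0) (toL2 f)]
    with x h1 h2 h3
  rw [h1, h3, h2, cut_apply, annulus_zero_apply, Complex.real_smul]

theorem norm_pd_cut_sq_le (k : ℕ) (f : 𝓢(Rn n, ℂ)) (i : Fin n) (x : Rn n) :
    ‖pd i (cut k f) x‖ ^ 2 ≤
      2 * ‖pd i f x‖ ^ 2 + 2 * (‖fderiv ℝ (annulusFun k) x‖ ^ 2 * ‖f x‖ ^ 2) := by
  have h1 : HasFDerivAt (annulusFun k) (fderiv ℝ (annulusFun k) x) x :=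
    ((contDiff_annulusFun k).differentiable (by simp) x).hasFDerivAt
  have h2 : HasFDerivAt (cut k f) _ x :=
    (h1.smul (f.hasFDerivAt x)).congr_of_eventuallyEq (Eventually.of_forall (cut_apply k f))
  have e : pd i (cut k f) x = annulusFun k x • pd i f x +
      (fderiv ℝ (annulusFun k) x (EuclideanSpace.basisFun (Fin n) ℝ i)) • f x := by
    rw [pd_apply, h2.fderiv, pd_apply]
    rfl
  have h3 : ‖annulusFun k x • pd i f x‖ ≤ ‖pd i f x‖ := by
    rw [norm_smul, Real.norm_of_nonneg (annulusFun_nonneg k x)]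
    exact mul_le_of_le_one_left (norm_nonneg _) (annulusFun_le_one k x)
  have h4 : ‖(fderiv ℝ (annulusFun k) x (EuclideanSpace.basisFun (Fin n) ℝ i)) • f x‖ ≤
      ‖fderiv ℝ (annulusFun k) x‖ * ‖f x‖ := by
    rw [norm_smul]
    gcongr
    refine (ContinuousLinearMap.le_opNorm _ _).trans (le_of_eq ?_)
    rw [(EuclideanSpace.basisFun (Fin n) ℝ).norm_eq_one, mul_one]
  have h5 : ‖pd i (cut k f) x‖ ≤ ‖pd i f x‖ + ‖fderiv ℝ (annulusFun k) x‖ * ‖f x‖ := by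
    rw [e]
    exact (norm_add_le _ _).trans (add_le_add h3 h4)
  refine (pow_le_pow_left₀ (norm_nonneg _) h5 2).trans (add_sq_le.trans (le_of_eq ?_))
  ring

/-- Differentiating the cutoff produces `|∇η_k|² |f|²`, which tends to zero pointwise and is
dominated by `(1 + 1/|x|²) |f|²`. The factor two comes from squaring the product rule and is
harmless for equivalence of norms. -/
theorem exists_dirichlet_cut_le [Nontrivial (Rn n)] {f : 𝓢(Rn n, ℂ)}
    (hf : Integrable fun x => (‖x‖ ^ 2)⁻¹ * ‖f x‖ ^ 2) :
    ∃ e : ℕ → ℝ, Tendsto e atTop (𝓝 0) ∧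
      ∀ k, dirichlet (cut k f) ≤ 2 * (dirichlet f + e k) := by
  obtain ⟨L, hL⟩ := exists_norm_fderiv_annulusFun_sq_le (n := n)
  have h0 : ∀ᵐ x : Rn n, x ≠ 0 := by simp [ae_iff]
  set g : ℕ → Rn n → ℝ := fun k x => ‖fderiv ℝ (annulusFun k) x‖ ^ 2 * ‖f x‖ ^ 2 with hg
  have hgc : ∀ k, Continuous (g k) := fun k => by
    have h1 : Continuous fun x : Rn n => fderiv ℝ (annulusFun k) x :=
      (contDiff_annulusFun k).continuous_fderiv (by simp)
    exact (h1.norm.pow 2).mul (f.continuous.norm.pow 2)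
  have hbound : ∀ k, ∀ᵐ x : Rn n, ‖g k x‖ ≤ L * ((‖x‖ ^ 2)⁻¹ * ‖f x‖ ^ 2 + ‖f x‖ ^ 2) := by
    intro k
    filter_upwards [h0] with x hx
    rw [Real.norm_of_nonneg (by positivity)]
    have := mul_le_mul_of_nonneg_right (hL k x hx) (sq_nonneg ‖f x‖)
    refine this.trans (le_of_eq ?_)
    ring
  have hdom : Integrable fun x : Rn n => L * ((‖x‖ ^ 2)⁻¹ * ‖f x‖ ^ 2 + ‖f x‖ ^ 2) :=
    (hf.add (integrable_norm_sq f)).const_mul L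
  have hgi : ∀ k, Integrable (g k) := fun k =>
    hdom.mono' (hgc k).aestronglyMeasurable (hbound k)
  have hlim : Tendsto (fun k => ∫ x, g k x) atTop (𝓝 0) := by
    have := tendsto_integral_of_dominated_convergence (μ := (volume : Measure (Rn n)))
      (F := g) (f := fun _ => (0 : ℝ)) _ (fun k => (hgc k).aestronglyMeasurable) hdom hbound ?_
    · simpa using this
    · filter_upwards [h0] with x hx
      simpa using ((tendsto_norm_fderiv_annulusFun hx).pow 2).mul_const (‖f x‖ ^ 2)
  refine ⟨fun k => n * ∫ x, g k x, by simpa using hlim.const_mul (n : ℝ), fun k => ?_⟩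
  have : ∫ x, (2 * ∑ i, ‖pd i f x‖ ^ 2 + 2 * (n * g k x)) =
      2 * (dirichlet f + n * ∫ x, g k x) := by
    rw [integral_add ((integrable_gradSq f).const_mul 2) (((hgi k).const_mul _).const_mul 2),
      integral_const_mul, integral_const_mul, integral_const_mul, dirichlet]
    ring
  rw [← this]
  refine integral_mono (integrable_gradSq _) (((integrable_gradSq f).const_mul 2).add
    (((hgi k).const_mul _).const_mul 2)) fun x => ?_
  refine (Finset.sum_le_sum fun i _ => norm_pd_cut_sq_le k f i x).trans (le_of_eq ?_)
  rw [Finset.sum_add_distrib, ← Finset.mul_sum, Finset.sum_const, Finset.card_univ, Fintype.card_fin,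
    nsmul_eq_mul]
  ring

/-! ### Integrability of `|f|² / |x|²` -/

theorem integrable_hardy_of_bound {f : 𝓢(Rn n, ℂ)} {g : Rn n → ℝ}
    (hg : IntegrableOn g (Metric.ball 0 1)) (hfg : ∀ x, (‖x‖ ^ 2)⁻¹ * ‖f x‖ ^ 2 ≤ g x) :
    Integrable fun x => (‖x‖ ^ 2)⁻¹ * ‖f x‖ ^ 2 := by
  have hm : AEStronglyMeasurable (fun x : Rn n => (‖x‖ ^ 2)⁻¹ * ‖f x‖ ^ 2) volume := by
    refine AEStronglyMeasurable.mul ?_ (f.continuous.norm.pow 2).aestronglyMeasurable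
    exact ((measurable_norm.pow_const 2).inv).aestronglyMeasurable
  refine ((hg.integrable_indicator measurableSet_ball).add (integrable_norm_sq f)).mono' hm
    (Eventually.of_forall fun x => ?_)
  rw [Real.norm_of_nonneg (by positivity)]
  by_cases hx : x ∈ Metric.ball (0 : Rn n) 1
  · rw [Pi.add_apply, Set.indicator_of_mem hx]
    have := hfg x
    have := sq_nonneg ‖f x‖
    linarith
  · rw [Pi.add_apply, Set.indicator_of_notMem hx, zero_add]
    rw [mem_ball_zero_iff, not_lt] at hx
    exact mul_le_of_le_one_left (sq_nonneg _) (inv_le_one_of_one_le₀ (one_le_pow₀ hx))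

/-- In polar coordinates `|x|⁻²` has density `r ^ (n - 3)`, integrable at the origin once `n ≥ 3`.
-/
theorem integrable_hardy_of_three_le (hn : 3 ≤ n) (f : 𝓢(Rn n, ℂ)) :
    Integrable fun x => (‖x‖ ^ 2)⁻¹ * ‖f x‖ ^ 2 := by
  have : Nonempty (Fin n) := ⟨⟨0, by omega⟩⟩
  set C := ‖f.toBoundedContinuousFunction‖
  refine integrable_hardy_of_bound (g := fun x => (‖x‖ ^ 2)⁻¹ * C ^ 2) ?_ fun x => ?_
  · refine Integrable.mul_const ?_ _
    refine (integrableOn_fun_norm_addHaar volume (f := fun y : ℝ => (y ^ 2)⁻¹)).2 ?_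
    rw [finrank_euclideanSpace_fin]
    have h1 : IntegrableOn (fun y : ℝ => y ^ (n - 3)) (Set.Ioo 0 1) :=
      (continuous_pow _).integrableOn_Icc.mono_set Set.Ioo_subset_Icc_self
    refine h1.congr_fun (fun y hy => ?_) measurableSet_Ioo
    have hy0 : y ≠ 0 := hy.1.ne'
    have : n - 1 = (n - 3) + 2 := by omega
    rw [this, smul_eq_mul, pow_add]
    field_simp
  · gcongr
    exact f.toBoundedContinuousFunction.norm_coe_le_norm x

/-- A bounded derivative gives `|f x| ≤ C |x|`, which cancels the singular weight. -/
theorem integrable_hardy_of_apply_zero {f : 𝓢(Rn n, ℂ)} (hf : f 0 = 0) :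
    Integrable fun x => (‖x‖ ^ 2)⁻¹ * ‖f x‖ ^ 2 := by
  set C := ‖(SchwartzMap.fderivCLM ℝ (Rn n) ℂ f).toBoundedContinuousFunction‖
  have hC : ∀ x, ‖f x‖ ≤ C * ‖x‖ := by
    intro x
    have := Convex.norm_image_sub_le_of_norm_fderiv_le (𝕜 := ℝ) (f := f) (C := C) (s := Set.univ)
      (x := 0) (y := x) (fun y _ => f.differentiableAt)
      (fun y _ => (SchwartzMap.fderivCLM ℝ (Rn n) ℂ f).toBoundedContinuousFunction.norm_coe_le_norm y)
      convex_univ trivial trivial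
    simpa [hf] using this
  refine integrable_hardy_of_bound (g := fun _ => C ^ 2) ?_ fun x => ?_
  · exact integrableOn_const measure_ball_lt_top.ne
  · rcases eq_or_ne x 0 with rfl | hx
    · simp [hf, sq_nonneg]
    · rw [inv_mul_le_iff₀ (pow_pos (norm_pos_iff.2 hx) 2), ← mul_pow, mul_comm ‖x‖]
      exact pow_le_pow_left₀ (norm_nonneg _) (hC x) 2

theorem circleInt_toL2_eq_zero {b : Prop} (hb : b) {f : 𝓢(Rn 2, ℂ)} (hf : toL2 f ∈ radialCompl 2 b)
    (x : Rn 2) : circleInt f x = 0 := by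
  refine circleInt_eq_zero (fun φ hφ => ?_) x
  rw [← hf hb φ hφ]
  refine integral_congr_ae ?_
  filter_upwards [coeFn_toL2 f] with x hx
  rw [hx]

/-- The Hardy inequality, on functions orthogonal to radial functions in the plane. -/
theorem exists_hardyForm_cut_le (hn : 2 ≤ n) : ∃ C : ℝ, 0 ≤ C ∧ ∀ f : 𝓢(Rn n, ℂ),
    toL2 f ∈ radialCompl n (n = 2) → (Integrable fun x => (‖x‖ ^ 2)⁻¹ * ‖f x‖ ^ 2) ∧
      ∀ k, hardyForm (cut k f) ≤ C * dirichlet (cut k f) := by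
  rcases hn.eq_or_lt with rfl | hn
  · refine ⟨(2 * Real.pi) ^ 2, by positivity, fun f hf => ?_⟩
    have hz := circleInt_toL2_eq_zero rfl hf
    constructor
    -- The circle through the origin degenerates to a point, so its vanishing mean forces `f 0 = 0`.
    · refine integrable_hardy_of_apply_zero ?_
      have h0 := hz 0
      rw [circleInt] at h0
      simp only [map_zero, intervalIntegral.integral_const, sub_zero] at h0
      exact (smul_eq_zero.1 h0).resolve_left (by positivity)
    -- The cutoff is constant on circles, so circle means remain zero.
    · refine fun k => hardyForm_le_of_circleInt_eq_zero (isTest_cut k f) fun x => ?_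
      have e : ∀ t, cut k f (rot t x) = annulusFun k x • f (rot t x) := fun t => by
        rw [cut_apply, annulusFun_radial k ((rot t).norm_map x)]
      have h0 := hz x
      rw [circleInt] at h0 ⊢
      simp only [e]
      rw [intervalIntegral.integral_smul, h0, smul_zero]
  · have : Nonempty (Fin n) := ⟨⟨0, by omega⟩⟩
    have hl : (0 : ℝ) < (((n : ℝ) - 2) / 2) ^ 2 := by
      have : (3 : ℝ) ≤ n := by exact_mod_cast hn
      have : (0 : ℝ) < ((n : ℝ) - 2) / 2 := by linarith
      positivity
    refine ⟨((((n : ℝ) - 2) / 2) ^ 2)⁻¹, by positivity, fun f _ =>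
      ⟨integrable_hardy_of_three_le hn f, fun k => ?_⟩⟩
    rw [← div_eq_inv_mul, le_div_iff₀ hl, mul_comm]
    exact hardy _ (isTest_cut k f)

end Cutoff

/-! ### Schwartz approximation compatible with radial orthogonality -/

section FourierSmooth

open Laplacian

variable {n : ℕ}

theorem integrable_pow_mul_annulus (k j : ℕ) (v : L2 n) :
    Integrable fun x : Rn n => ‖x‖ ^ j * ‖annulus k 0 x * v x‖ := by
  have hg : ∀ x : Rn n, x ≠ 0 → ContDiffAt ℝ ∞ (fun x : Rn n => ((‖x‖ ^ j : ℝ) : ℂ)) x :=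
    fun x hx => Complex.ofRealCLM.contDiff.contDiffAt.comp x ((contDiffAt_norm ℝ hx).pow j)
  refine (integrable_schwartz_mul (annulusMul k _ hg) v).norm.congr (Eventually.of_forall fun x => ?_)
  simp only
  rw [annulusMul_apply, annulus_zero_apply, norm_mul, norm_mul, norm_mul, Complex.norm_real,
    Complex.norm_real (‖x‖ ^ j), Real.norm_of_nonneg (pow_nonneg (norm_nonneg x) j)]
  ring

/-- The Fourier transform of a function supported in an annulus is smooth. -/
theorem exists_contDiff_fourierL2 [Nontrivial (Rn n)] (k : ℕ) (v : L2 n) :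
    ∃ F : Rn n → ℂ, ContDiff ℝ ∞ F ∧ fourierL2 n (mulS (annulus k 0) v) =ᵐ[volume] F := by
  set g : Rn n → ℂ := fun x => annulus k 0 x * v x with hg
  have hgi : Integrable g := integrable_schwartz_mul _ v
  have hF : ContDiff ℝ ∞ (𝓕 g) :=
    Real.contDiff_fourier fun j _ => integrable_pow_mul_annulus k j v
  refine ⟨𝓕 g, hF, ?_⟩
  have := ae_eq_zero_of_forall_schwartz
    (w := fun ξ => fourierL2 n (mulS (annulus k 0) v) ξ - 𝓕 g ξ)
    (((L2.locallyIntegrable _).sub hF.continuous.locallyIntegrable).locallyIntegrableOn _) (by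
      intro φ h1 _
      have i2 : Integrable fun ξ => φ ξ * 𝓕 g ξ :=
        (φ.continuous.mul hF.continuous).integrable_of_hasCompactSupport h1.mul_right
      simp only [mul_sub]
      rw [integral_sub (integrable_schwartz_mul _ _) i2, integral_fourierL2, sub_eq_zero]
      have e : ∫ ξ, 𝓕 (φ : Rn n → ℂ) ξ • g ξ = ∫ ξ, φ ξ • 𝓕 g ξ := by
        simpa using! (VectorFourier.integral_fourierIntegral_smul_eq_flip (L := innerₗ (Rn n))
          Real.continuous_fourierChar continuous_inner φ.integrable hgi)
      refine Eq.trans ?_ e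
      refine integral_congr_ae ?_
      filter_upwards [coeFn_mulS (annulus k 0) v] with x hx
      rw [hx]
      rfl)
  filter_upwards [this] with ξ hξ
  exact sub_eq_zero.1 hξ

/-- Schwartz functions orthogonal to radial functions are dense, in a form adapted to
`(-Δ + ε)⁻¹`. -/
theorem exists_schwartz_approx [Nontrivial (Rn n)] {b : Prop} {v : L2 n}
    (hv : v ∈ radialCompl n b) {ε : ℝ} (hε : 0 < ε) :
    ∃ f : ℕ → 𝓢(Rn n, ℂ), (∀ k, toL2 (f k) ∈ radialCompl n b) ∧
      Tendsto (fun k => toL2 (-(Δ (f k))) + (ε : ℂ) • toL2 (f k)) atTop (𝓝 v) := by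
  choose F hF1 hF2 using fun k => exists_contDiff_fourierL2 k v
  have hr : ∀ x : Rn n, x ≠ 0 → ContDiffAt ℝ ∞
      (fun ξ : Rn n => ((((2 * Real.pi * ‖ξ‖) ^ 2 + ε)⁻¹ : ℝ) : ℂ)) x := by
    intro x hx
    refine Complex.ofRealCLM.contDiff.contDiffAt.comp x (ContDiffAt.inv ?_ (by positivity))
    exact ((contDiffAt_const.mul (contDiffAt_norm ℝ hx)).pow 2).add contDiffAt_const
  -- Two cutoffs are used: the spatial one makes the Fourier transform smooth, and the frequency one
  -- gives it compact support. Division by `|2πξ|² + ε` arranges that applying `-Δ + ε` recovers the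
  -- doubly cut-off `v`; every factor is radial and preserves the orthogonality.
  set G : ℕ → 𝓢(Rn n, ℂ) := fun k =>
    annulusMul k _ (fun x hx => (hr x hx).mul (hF1 k).contDiffAt) with hG
  have hrad : ∀ k, IsRadial (annulusMul k _ hr) := by
    intro k x y hxy
    rw [annulusMul_apply, annulusMul_apply, annulusFun_radial k hxy, hxy]
  have hGeq : ∀ k, toL2 (G k) = mulS (annulusMul k _ hr) (fourierL2 n (mulS (annulus k 0) v)) := by
    intro k
    refine Lp.ext ?_
    filter_upwards [coeFn_toL2 (G k), hF2 k,
      coeFn_mulS (annulusMul k _ hr) (fourierL2 n (mulS (annulus k 0) v))] with ξ h1 h2 h3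
    rw [h1, h3, h2, hG, annulusMul_apply, annulusMul_apply]
    ring
  have hfG : ∀ k, fourierL2 n (toL2 (𝓕⁻ (G k))) = toL2 (G k) := by
    intro k
    rw [fourierL2_toL2, fourier_fourierInv_eq]
  refine ⟨fun k => 𝓕⁻ (G k), fun k => ?_, ?_⟩
  · have e : toL2 (𝓕⁻ (G k)) = (fourierL2 n).symm (toL2 (G k)) := by
      rw [← hfG, LinearIsometryEquiv.symm_apply_apply]
    rw [e, hGeq]
    exact fourierL2_symm_mem_radialCompl (mulS_mem_radialCompl (fourierL2_mem_radialCompl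
      (mulS_mem_radialCompl hv (isRadial_annulus k 0))) (hrad k))
  · have key : ∀ k, fourierL2 n (toL2 (-(Δ (𝓕⁻ (G k)))) + (ε : ℂ) • toL2 (𝓕⁻ (G k))) =
        mulS (annulus k 0) (fourierL2 n (mulS (annulus k 0) v)) := by
      intro k
      rw [map_add, map_smul, hfG, fourierL2_toL2]
      refine Lp.ext ?_
      filter_upwards [Lp.coeFn_add (toL2 (𝓕 (-(Δ (𝓕⁻ (G k)))))) ((ε : ℂ) • toL2 (G k)),
        Lp.coeFn_smul (ε : ℂ) (toL2 (G k)), coeFn_toL2 (G k), hF2 k,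
        coeFn_toL2 (𝓕 (-(Δ (𝓕⁻ (G k))))),
        coeFn_mulS (annulus k 0) (fourierL2 n (mulS (annulus k 0) v))] with ξ h1 h2 h3 h4 h5 h6
      rw [h1, Pi.add_apply, h2, Pi.smul_apply, h3, h5, h6, h4, fourier_neg_laplacian,
        fourier_fourierInv_eq, annulus_zero_apply, smul_eq_mul, ← add_mul, ← Complex.ofReal_add, hG,
        annulusMul_apply]
      have hne : (((2 * Real.pi * ‖ξ‖) ^ 2 + ε : ℝ) : ℂ) ≠ 0 :=
        Complex.ofReal_ne_zero.2 (by positivity)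
      rw [Complex.ofReal_inv, mul_left_comm, mul_inv_cancel_left₀ hne]
    rw [← (fourierL2 n).symm_apply_apply v]
    have e : ∀ k, toL2 (-(Δ (𝓕⁻ (G k)))) + (ε : ℂ) • toL2 (𝓕⁻ (G k)) =
        (fourierL2 n).symm (mulS (annulus k 0) (fourierL2 n (mulS (annulus k 0) v))) := by
      intro k
      rw [← key k, LinearIsometryEquiv.symm_apply_apply]
    simp only [e]
    refine ((fourierL2 n).symm.continuous.tendsto _).comp ?_
    rw [tendsto_iff_norm_sub_tendsto_zero]
    have h1 := tendsto_iff_norm_sub_tendsto_zero.1 (tendsto_mulS_annulus v)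
    have h2 := tendsto_iff_norm_sub_tendsto_zero.1 (tendsto_mulS_annulus (fourierL2 n v))
    refine squeeze_zero (fun _ => norm_nonneg _) (fun k => ?_) (by simpa using h1.add h2)
    have e2 : mulS (annulus k 0) (fourierL2 n (mulS (annulus k 0) v)) - fourierL2 n v =
        mulS (annulus k 0) (fourierL2 n (mulS (annulus k 0) v - v)) +
          (mulS (annulus k 0) (fourierL2 n v) - fourierL2 n v) := by
      rw [map_sub, map_sub]
      abel
    rw [e2]
    refine (norm_add_le _ _).trans (add_le_add ?_ le_rfl)
    refine (norm_mulS_annulus_le _ _).trans (le_of_eq ?_)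
    rw [LinearIsometryEquiv.norm_map]

end FourierSmooth

/-! ### Comparison of the resolvents of `P_a` and `-Δ` -/

section Comparison

open Laplacian

variable {n : ℕ} {a : ℝ}

theorem mem_minimalSubmodule {w : 𝓢(Rn n, ℂ)} (hw : IsTest w) :
    testPair a w hw ∈ minimalSubmodule n a :=
  (mem_minimalGraph_iff a _).2 ⟨w, hw, rfl⟩

theorem exists_isResolvent_Pgraph [Nontrivial (Rn n)] (ha : 0 < a + (((n : ℝ) - 2) / 2) ^ 2) :
    ∃ R, IsResolvent (Pgraph n a) R :=
  (isNonnegSymmetric_minimal ha).exists_isResolvent.1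

/-- If `R h = 0`, the pair `(0, h)` is in the graph, so the adjoint relation makes `h` orthogonal to
all test functions, which determine it almost everywhere. -/
theorem IsResolvent.injective_of_Pgraph [Nontrivial (Rn n)] {R : L2 n →L[ℂ] L2 n}
    (hR : IsResolvent (Pgraph n a) R) : Function.Injective R := by
  rw [injective_iff_map_eq_zero]
  intro h hh
  have hm : (R h, h - R h) ∈ Pgraph n a := by
    rw [hR.2.2]
    exact ⟨h, rfl⟩
  rw [hh, sub_zero] at hm
  have hz : ∀ w : 𝓢(Rn n, ℂ), IsTest w → ∫ x, (starRingEnd ℂ) (h x) * w x = 0 := by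
    intro w hw
    have := hm.1 _ ((mem_minimalGraph_iff a _).2 ⟨w, hw, rfl⟩)
    simp only [inner_zero_left] at this
    rw [← this, testPair, L2.inner_eq_integral]
    refine integral_congr_ae ?_
    filter_upwards [coeFn_toL2 w] with x hx
    rw [hx]
  have hl : LocallyIntegrable fun x => (starRingEnd ℂ) (h x) := by
    intro x
    obtain ⟨U, hU, hi⟩ := L2.locallyIntegrable h x
    refine ⟨U, hU, hi.norm.mono' ?_ (Eventually.of_forall fun x => ?_)⟩
    · exact Complex.continuous_conj.comp_aestronglyMeasurable hi.1
    · simp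
  have := ae_eq_zero_of_forall_schwartz (hl.locallyIntegrableOn _) (fun φ h1 h2 => by
    have := hz φ ⟨h1, h2⟩
    simp only [mul_comm (φ _)]
    exact this)
  refine Lp.ext ?_
  filter_upwards [this, Lp.coeFn_zero ℂ 2 (volume : Measure (Rn n))] with x h1 h2
  rw [h2]
  exact (map_eq_zero _).1 h1

/-- The resolvent of `P_a` is dominated by the free resolvent. -/
theorem exists_greenOp_le [Nontrivial (Rn n)] (ha : 0 < a + (((n : ℝ) - 2) / 2) ^ 2)
    {R : L2 n →L[ℂ] L2 n} (hR : IsResolvent (Pgraph n a) R) :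
    ∃ C : ℝ, 1 ≤ C ∧ ∀ ε > 0, ∀ h, (inner ℂ h (greenOp ε R h)).re ≤
      C * (inner ℂ h (greenOp ε (freeResolvent n) h)).re := by
  obtain ⟨C, hC, hD⟩ := exists_dirichlet_le (n := n) ha
  refine ⟨max C 1, le_max_right _ _, fun ε hε h => ?_⟩
  have hS := isNonnegSymmetric_minimal (n := n) ha
  -- Test functions converging in form to `(P_a + ε)⁻¹ h` are put into Cauchy–Schwarz for `-Δ + ε`.
  -- The limit reads `P² ≤ C Q P`, and one factor `P` cancels.
  obtain ⟨w, hw, h1, h2⟩ := exists_seq_greenOp hS hR hε h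
  set P := (inner ℂ h (greenOp ε R h)).re with hP
  set Q := (inner ℂ h (greenOp ε (freeResolvent n) h)).re with hQ
  have hP0 : 0 ≤ P := greenOp_nonneg hR.1 hR.2.1 hε h
  have hQ0 : 0 ≤ Q := greenOp_nonneg freeResolvent_nonneg freeResolvent_le_one hε h
  have key : ∀ k, ‖inner ℂ h (w k).1‖ ^ 2 ≤
      Q * (max C 1 * ((inner ℂ (w k).2 (w k).1).re + ε * ‖(w k).1‖ ^ 2)) := by
    intro k
    obtain ⟨z, hz, hzw⟩ := (mem_minimalGraph_iff a _).1 (hw k)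
    rw [hzw]
    refine (norm_inner_toLp_sq_le hε h z).trans ?_
    refine mul_le_mul_of_nonneg_left ?_ hQ0
    rw [inner_testPair_self, mul_add]
    have h3 := hD z hz
    have h4 : 0 ≤ dirichlet z + a * hardyForm z :=
      (mul_nonneg_iff_of_pos_left hC).1 ((dirichlet_nonneg z).trans h3)
    refine add_le_add (h3.trans (mul_le_mul_of_nonneg_right (le_max_left _ _) h4)) ?_
    exact le_mul_of_one_le_left (by positivity) (le_max_right _ _)
  have lim : ‖inner ℂ h (greenOp ε R h)‖ ^ 2 ≤ Q * (max C 1 * P) :=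
    le_of_tendsto_of_tendsto' ((tendsto_const_nhds.inner h1).norm.pow 2)
      ((h2.const_mul _).const_mul _) key
  have h5 : P ^ 2 ≤ Q * (max C 1 * P) := by
    refine le_trans ?_ lim
    rw [← sq_abs]
    exact pow_le_pow_left₀ (abs_nonneg _) (Complex.abs_re_le_norm _) 2
  rcases hP0.eq_or_lt with h6 | h6
  · rw [← h6]
    positivity
  · refine le_of_mul_le_mul_right ?_ h6
    nlinarith

/-- The form of `P_a` on cutoffs of functions orthogonal to radial functions is dominated by the
Dirichlet form. -/
theorem exists_norm_inner_sq_le (hn : 2 ≤ n) [Nontrivial (Rn n)]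
    (ha : 0 < a + (((n : ℝ) - 2) / 2) ^ 2) {R : L2 n →L[ℂ] L2 n}
    (hR : IsResolvent (Pgraph n a) R) :
    ∃ C : ℝ, 1 ≤ C ∧ ∀ ε > 0, ∀ h, ∀ f : 𝓢(Rn n, ℂ), toL2 f ∈ radialCompl n (n = 2) →
      ‖inner ℂ h (toL2 f)‖ ^ 2 ≤ (inner ℂ h (greenOp ε R h)).re *
        (C * (dirichlet f + ε * ‖toL2 f‖ ^ 2)) := by
  obtain ⟨C, hC, hH⟩ := exists_hardyForm_cut_le hn
  -- The factor `1 + |a| C` bounds the form of `P_a` by the Dirichlet form; the factor `2` is the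
  -- cost of the cutoff.
  refine ⟨2 * (1 + |a| * C), ?_, fun ε hε h f hf => ?_⟩
  · have : 0 ≤ |a| * C := by positivity
    linarith
  obtain ⟨hi, hH⟩ := hH f hf
  obtain ⟨e, he, hcut⟩ := exists_dirichlet_cut_le hi
  have hS := isNonnegSymmetric_minimal (n := n) ha
  set P := (inner ℂ h (greenOp ε R h)).re with hP
  have hP0 : 0 ≤ P := greenOp_nonneg hR.1 hR.2.1 hε h
  have key : ∀ k, ‖inner ℂ h (toL2 (cut k f))‖ ^ 2 ≤
      P * (2 * (1 + |a| * C) * (dirichlet f + e k + ε * ‖toL2 f‖ ^ 2)) := by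
    intro k
    refine (norm_inner_sq_le_greenOp hS hR hε h (mem_minimalSubmodule (isTest_cut k f))).trans ?_
    refine mul_le_mul_of_nonneg_left ?_ hP0
    rw [inner_testPair_self]
    have h1 : a * hardyForm (cut k f) ≤ |a| * (C * dirichlet (cut k f)) :=
      (mul_le_mul_of_nonneg_right (le_abs_self a) (hardyForm_nonneg _)).trans
        (mul_le_mul_of_nonneg_left (hH k) (abs_nonneg a))
    have h2 : ‖(testPair a (cut k f) (isTest_cut k f)).1‖ ≤ ‖toL2 f‖ := by
      change ‖toL2 (cut k f)‖ ≤ _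
      rw [toL2_cut]
      exact norm_mulS_annulus_le k _
    have h3 := pow_le_pow_left₀ (norm_nonneg _) h2 2
    have h4 : 0 ≤ |a| * C := by positivity
    have h5 := mul_le_mul_of_nonneg_left (hcut k) (by linarith : 0 ≤ 1 + |a| * C)
    have h6 := mul_le_mul_of_nonneg_left h3 hε.le
    have h7 : 0 ≤ ε * ‖toL2 f‖ ^ 2 := by positivity
    have h8 : 0 ≤ |a| * C * (ε * ‖toL2 f‖ ^ 2) := mul_nonneg h4 h7
    nlinarith
  have l1 : Tendsto (fun k => toL2 (cut k f)) atTop (𝓝 (toL2 f)) := by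
    simp only [toL2_cut]
    exact tendsto_mulS_annulus _
  have l2 : Tendsto (fun k => P * (2 * (1 + |a| * C) * (dirichlet f + e k + ε * ‖toL2 f‖ ^ 2)))
      atTop (𝓝 (P * (2 * (1 + |a| * C) * (dirichlet f + 0 + ε * ‖toL2 f‖ ^ 2)))) :=
    (((he.const_add _).add_const _).const_mul _).const_mul _
  rw [add_zero] at l2
  exact le_of_tendsto_of_tendsto' ((tendsto_const_nhds.inner l1).norm.pow 2) l2 key

/-- The free resolvent is dominated by the resolvent of `P_a`, on functions orthogonal to radial
functions in the plane. -/
theorem exists_greenOp_ge (hn : 2 ≤ n) [Nontrivial (Rn n)]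
    (ha : 0 < a + (((n : ℝ) - 2) / 2) ^ 2) {R : L2 n →L[ℂ] L2 n}
    (hR : IsResolvent (Pgraph n a) R) :
    ∃ C : ℝ, 1 ≤ C ∧ ∀ ε > 0, ∀ h, ∀ v ∈ radialCompl n (n = 2),
      (∀ f ∈ radialCompl n (n = 2), inner ℂ v f = inner ℂ h f) →
      (inner ℂ v (greenOp ε (freeResolvent n) v)).re ≤ C * (inner ℂ h (greenOp ε R h)).re := by
  obtain ⟨C, hC, hle⟩ := exists_norm_inner_sq_le hn ha hR
  refine ⟨C, hC, fun ε hε h v hv hvh => ?_⟩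
  -- The roles are now exchanged: `f k` approximates `(-Δ + ε)⁻¹ v` within the orthogonal subspace,
  -- where pairing with `v` and with `h` agree.
  obtain ⟨f, hf, hlim⟩ := exists_schwartz_approx hv hε
  set P := (inner ℂ h (greenOp ε R h)).re with hP
  have hP0 : 0 ≤ P := greenOp_nonneg hR.1 hR.2.1 hε h
  set Q := (inner ℂ v (greenOp ε (freeResolvent n) v)).re with hQ
  have hQ0 : 0 ≤ Q := greenOp_nonneg freeResolvent_nonneg freeResolvent_le_one hε v
  set v' : ℕ → L2 n := fun k => toL2 (-(Δ (f k))) + (ε : ℂ) • toL2 (f k) with hv'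
  have hgv : ∀ k, greenOp ε (freeResolvent n) (v' k) = toL2 (f k) := fun k =>
    greenOp_freeResolvent_laplacian hε (f k)
  have hform : ∀ k, dirichlet (f k) + ε * ‖toL2 (f k)‖ ^ 2 =
      (inner ℂ (v' k) (greenOp ε (freeResolvent n) (v' k))).re := by
    intro k
    rw [hgv, hv', inner_add_left, inner_neg_laplacian_self, inner_smul_left,
      inner_self_eq_norm_sq_to_K, Complex.conj_ofReal, Complex.add_re, Complex.ofReal_re,
      Complex.re_ofReal_mul]
    norm_cast
  have key : ∀ k, ‖inner ℂ v (greenOp ε (freeResolvent n) (v' k))‖ ^ 2 ≤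
      P * (C * (inner ℂ (v' k) (greenOp ε (freeResolvent n) (v' k))).re) := by
    intro k
    rw [← hform, hgv, hvh _ (hf k)]
    exact hle ε hε h (f k) (hf k)
  have l1 : Tendsto (fun k => greenOp ε (freeResolvent n) (v' k)) atTop
      (𝓝 (greenOp ε (freeResolvent n) v)) :=
    ((greenOp ε (freeResolvent n)).continuous.tendsto v).comp hlim
  have lim : ‖inner ℂ v (greenOp ε (freeResolvent n) v)‖ ^ 2 ≤ P * (C * Q) :=
    le_of_tendsto_of_tendsto' ((tendsto_const_nhds.inner l1).norm.pow 2)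
      (((Complex.continuous_re.tendsto _).comp (hlim.inner l1)).const_mul _ |>.const_mul _) key
  have h5 : Q ^ 2 ≤ P * (C * Q) := by
    refine le_trans ?_ lim
    rw [← sq_abs]
    exact pow_le_pow_left₀ (abs_nonneg _) (Complex.abs_re_le_norm _) 2
  rcases hQ0.eq_or_lt with h6 | h6
  · rw [← h6]
    positivity
  · refine le_of_mul_le_mul_right ?_ h6
    nlinarith

end Comparison

/-- A fixed vector of `R` spans the kernel of `A`, and `‖(1 - R) ^ (1/2) h‖² = ⟪h, (1 - R) h⟫ = 0`
places it in the kernel of `A ^ (1/2)`. -/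
theorem powRel_half_zero {H : Type*} [NormedAddCommGroup H] [InnerProductSpace ℂ H]
    [CompleteSpace H] {R : H →L[ℂ] H} (h0 : 0 ≤ R) (h1 : R ≤ 1) {h : H} (hh : R h = h) :
    PowRel R (1 / 2) h 0 := by
  have e : (1 - R) ^ (1 / 2 : ℝ) * (1 - R) ^ (1 / 2 : ℝ) = 1 - R := by
    rw [← CFC.sqrt_eq_rpow, CFC.sqrt_mul_sqrt_self _ (sub_nonneg.2 h1)]
  have e2 : ((1 - R) ^ (1 / 2 : ℝ)) (((1 - R) ^ (1 / 2 : ℝ)) h) = 0 := by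
    rw [← mul_apply_eq_comp, e]
    simp [hh]
  rw [PowRel, map_zero, ← inner_self_eq_zero (𝕜 := ℂ)]
  rw [one_sub_rpow_eq_cfc h0 h1 (by norm_num)] at e2 ⊢
  rw [inner_cfc_left, e2, inner_zero_right]

variable {n : ℕ} {a : ℝ}

theorem exists_isComparable (hn : 2 ≤ n) [Nontrivial (Rn n)]
    (ha : 0 < a + (((n : ℝ) - 2) / 2) ^ 2) :
    ∃ R C, IsComparable (Pgraph n a) R (n = 2) C := by
  obtain ⟨R, hR⟩ := exists_isResolvent_Pgraph (n := n) ha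
  obtain ⟨C₁, hC₁, hle⟩ := exists_greenOp_le ha hR
  obtain ⟨C₂, hC₂, hge⟩ := exists_greenOp_ge hn ha hR
  refine ⟨R, max C₁ C₂, hR, hR.injective_of_Pgraph, fun h hh => ?_, hC₁.trans (le_max_left _ _),
    fun ε hε h => (hle ε hε h).trans (mul_le_mul_of_nonneg_right (le_max_left _ _)
      (greenOp_nonneg freeResolvent_nonneg freeResolvent_le_one hε h)),
    fun ε hε h v hv hvh => (hge ε hε h v hv hvh).trans (mul_le_mul_of_nonneg_right
      (le_max_right _ _) (greenOp_nonneg hR.1 hR.2.1 hε h))⟩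
  -- Zero is not an eigenvalue of `P_a`: the Heinz inequality at `σ = 1/2` would put `h` in the
  -- kernel of `(-Δ) ^ (1/2)`, whose symbol is nonzero almost everywhere.
  obtain ⟨g, hg, hg0⟩ := PowRel.heinz (E := 1) freeResolvent_nonneg freeResolvent_le_one hR.1 hR.2.1
    freeResolvent_injective (fun _ _ => rfl) hC₁ (fun ε hε h => hle ε hε h) (by norm_num) le_rfl
    (powRel_half_zero hR.1 hR.2.1 hh) rfl
  rw [norm_zero, mul_zero, norm_le_zero_iff] at hg0
  subst hg0
  rw [powRel_freeResolvent_iff (by norm_num), map_zero] at hg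
  have hne : ∀ᵐ x : Rn n, x ≠ 0 := by simp [ae_iff]
  rw [← (fourierL2 n).map_eq_zero_iff]
  refine Lp.ext ?_
  filter_upwards [hg, hne, Lp.coeFn_zero ℂ 2 (volume : Measure (Rn n))] with ξ h1 h2 h3
  rw [h3] at h1 ⊢
  refine (mul_eq_zero.1 h1.symm).resolve_left (Complex.ofReal_ne_zero.2 ?_)
  have : 0 < ‖ξ‖ := norm_pos_iff.2 h2
  positivity

end InverseSquare

theorem proposition1 (n : ℕ) (a s : ℝ) (X : Set 𝓢'(InverseSquare.Rn n, ℂ))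
    (hX : (3 ≤ n ∧ X = InverseSquare.homSobolev n s) ∨
      (n = 2 ∧ X = InverseSquare.homSobolevGeOne n s))
    (ha : 0 < a + (((n : ℝ) - 2) / 2) ^ 2) (hs : -1 ≤ s ∧ s ≤ 1) :
    ∃ C₁ C₂ : ℝ, 0 < C₁ ∧ 0 < C₂ ∧ ∀ u ∈ X,
      (∃! g : InverseSquare.L2 n, InverseSquare.IsPow n a s X u g) ∧
      (∀ g : InverseSquare.L2 n, InverseSquare.IsPow n a s X u g →
        C₁ * InverseSquare.homNorm s u ≤ ‖g‖ ∧ ‖g‖ ≤ C₂ * InverseSquare.homNorm s u) ∧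
      (∀ f : InverseSquare.L2 n, Lp.toTemperedDistribution f = u →
        ∃ g : InverseSquare.L2 n,
          (f, g) ∈ InverseSquare.powGraph (InverseSquare.Pgraph n a) (s / 2)) := by
  have hn : 2 ≤ n := by omega
  have : Nonempty (Fin n) := ⟨⟨0, by omega⟩⟩
  have : Nontrivial (InverseSquare.Rn n) := inferInstance
  obtain ⟨R, C, hc⟩ := InverseSquare.exists_isComparable hn ha
  -- The proposition `n = 2` serves as the switch for the orthogonality condition, which merges the
  -- two cases.
  have hX' : X = InverseSquare.homSpace n s (n = 2) := by
    rcases hX with ⟨h3, rfl⟩ | ⟨rfl, rfl⟩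
    · ext u
      simp [InverseSquare.homSpace, show n ≠ 2 by omega]
    · simp [InverseSquare.homSpace, InverseSquare.homSobolevGeOne]
  have hC : 0 < C := zero_lt_one.trans_le hc.one_le
  exact ⟨C⁻¹, C, inv_pos.2 hC, hC, fun u hu => hc.main hs hX' u hu⟩
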